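/- **Proposition 2.3.** Let $n\ge 3$, let $\Omega\subset\mathbf R^n$ be a bounded open set with $C^\infty$ boundary, with unit exterior normal $\nu$ and surface measure $d\sigma$ on $\partial\Omega$, and let $\tilde\Omega\supset\overline\Omega$ be open. Let $\varphi\in C^\infty(\tilde\Omega;\mathbf R)$ be a limiting Carleman weight, i.e. $\nabla\varphi\neq 0$ everywhere on $\tilde\Omega$ and, with $p_\varphi(x,\xi)=\xi^2-(\nabla\varphi)^2+2i\,\nabla\varphi\cdot\xi$, the Poisson bracket satisfies $$\{\operatorname{Re}p_\varphi,\operatorname{Im}p_\varphi\}(x,\xi)=0\quad\text{whenever } x\in\tilde\Omega,\ \xi\in\mathbf R^n,\ p_\varphi(x,\xi)=0 .$$ Let $A$ be a real $C^1$ vector field on $\overline\Omega$, let $q\in L^\infty(\Omega)$ (complex valued), and let $$\mathcal L_{A,q}=\sum_{j=1}^n(D_j+A_j)^2+q,\qquad D_j=-i\,\partial_{x_j}.$$ Write $\|\cdot\|$ for the norm of $L^2(\Omega)$, $(u|v)_\Gamma=\int_\Gamma u\,\bar v\,d\sigma$ for $\Gamma\subset\partial\Omega$, and $\partial\Omega_\pm=\{x\in\partial\Omega:\pm\partial_\nu\varphi(x)\ge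 0\}$. Then there are constants $C>0$ and $h_0>0$ (which may depend on $n$, $\Omega$, $\tilde\Omega$, $\varphi$, $A$ and $q$) such that for all $0<h\le h_0$ and all complex valued $u\in C^\infty(\overline\Omega)\cap H^1_0(\Omega)$ $$-h\big(\partial_\nu\varphi\,e^{\varphi/h}\partial_\nu u\,\big|\,e^{\varphi/h}\partial_\nu u\big)_{\partial\Omega_-}+\|e^{\varphi/h}u\|^2+\|e^{\varphi/h}h\nabla u\|^2\le C\Big(h^2\|e^{\varphi/h}\mathcal L_{A,q}u\|^2+h\big(\partial_\nu\varphi\,e^{\varphi/h}\partial_\nu u\,\big|\,e^{\varphi/h}\partial_\nu u\big)_{\partial\Omega_+}\Big).$$ -/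

import Mathlib

open MeasureTheory Set Filter Topology
open scoped ContDiff Gradient ENNReal

namespace Carleman

noncomputable section

/-- The Euclidean space `ℝⁿ`. -/
abbrev Rn (n : ℕ) : Type := EuclideanSpace ℝ (Fin n)

/-! ### Domains with smooth boundary, exterior normal, surface measure -/

/-- `ρ` is a smooth defining function of `Ω` in the open set `U`: there `Ω` is `{ρ < 0}`, and `ρ`
has no critical point. -/
structure IsDefiningFunction {n : ℕ} (Ω U : Set (Rn n)) (ρ : Rn n → ℝ) : Prop where
  isOpen : IsOpen U
  contDiffOn : ContDiffOn ℝ ∞ ρ U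
  gradient_ne_zero : ∀ x ∈ U, ∇ ρ x ≠ 0
  inter_eq : Ω ∩ U = {x ∈ U | ρ x < 0}

/-- The open set `Ω` has a `C^∞` boundary (and lies locally on one side of it). -/
def HasSmoothBoundary {n : ℕ} (Ω : Set (Rn n)) : Prop :=
  ∀ x ∈ frontier Ω, ∃ (U : Set (Rn n)) (ρ : Rn n → ℝ), x ∈ U ∧ IsDefiningFunction Ω U ρ

/-- `v` is the unit exterior normal of `Ω` at the boundary point `x`: the normalized gradient of
a local defining function. -/
def IsExteriorNormal {n : ℕ} (Ω : Set (Rn n)) (x v : Rn n) : Prop :=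
  ∃ (U : Set (Rn n)) (ρ : Rn n → ℝ), x ∈ U ∧ IsDefiningFunction Ω U ρ ∧
    v = ‖∇ ρ x‖⁻¹ • ∇ ρ x

open Classical in
/-- The unit exterior normal field `ν` of `Ω` (the value `0` is used off the boundary). -/
def exteriorNormal {n : ℕ} (Ω : Set (Rn n)) (x : Rn n) : Rn n :=
  if h : x ∈ frontier Ω ∧ ∃ v, IsExteriorNormal Ω x v then h.2.choose else 0

/-- On the boundary of a smooth domain, `exteriorNormal` is a unit exterior normal. -/
theorem exteriorNormal_spec {n : ℕ} {Ω : Set (Rn n)} (hΩ : HasSmoothBoundary Ω) {x : Rn n}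
    (hx : x ∈ frontier Ω) : IsExteriorNormal Ω x (exteriorNormal Ω x) := by
  have h : x ∈ frontier Ω ∧ ∃ v, IsExteriorNormal Ω x v := by
    obtain ⟨U, ρ, hxU, hρ⟩ := hΩ x hx
    exact ⟨hx, _, U, ρ, hxU, hρ, rfl⟩
  rw [exteriorNormal, dif_pos h]
  exact h.2.choose_spec

/-- Near a boundary point, the sign of `∇ρ · w` decides whether `x + t w` enters `Ω`. -/
theorem IsDefiningFunction.eventually_mem {n : ℕ} {Ω U : Set (Rn n)} {ρ : Rn n → ℝ}
    (h : IsDefiningFunction Ω U ρ) (hΩ : IsOpen Ω) {x : Rn n} (hx : x ∈ frontier Ω) (hxU : x ∈ U)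
    (w : Rn n) :
    (inner ℝ (∇ ρ x) w < 0 → ∀ᶠ t in 𝓝[>] (0 : ℝ), x + t • w ∈ Ω) ∧
    (0 < inner ℝ (∇ ρ x) w → ∀ᶠ t in 𝓝[>] (0 : ℝ), x + t • w ∉ Ω) := by
  have hxΩ : x ∉ Ω := fun h' => by
    rw [hΩ.frontier_eq] at hx; exact hx.2 h'
  have hd : DifferentiableAt ℝ ρ x :=
    (h.contDiffOn.contDiffAt (h.isOpen.mem_nhds hxU)).differentiableAt (by simp)
  have hρ0 : ρ x = 0 := by
    apply le_antisymm
    · by_contra! hc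
      have h1 : ∀ᶠ y in 𝓝 x, 0 < ρ y := hd.continuousAt.eventually (lt_mem_nhds hc)
      have h2 : ∃ᶠ y in 𝓝 x, y ∈ Ω := mem_closure_iff_frequently.1 hx.1
      obtain ⟨y, hy, hy1, hy2⟩ := (h2.and_eventually (h1.and (h.isOpen.mem_nhds hxU))).exists
      have : y ∈ {x ∈ U | ρ x < 0} := h.inter_eq ▸ ⟨hy, hy2⟩
      exact absurd this.2 (not_lt.2 hy1.le)
    · by_contra! hc
      have : x ∈ Ω ∩ U := h.inter_eq ▸ ⟨hxU, hc⟩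
      exact hxΩ this.1
  have hline : HasDerivAt (fun t : ℝ => x + t • w) w 0 := by
    simpa using ((hasDerivAt_id (0 : ℝ)).smul_const w).const_add x
  have hder : HasDerivAt (fun t : ℝ => ρ (x + t • w)) (inner ℝ (∇ ρ x) w) 0 := by
    have hg : HasFDerivAt ρ (fderiv ℝ ρ x) (x + (0 : ℝ) • w) := by simpa using hd.hasFDerivAt
    have := hg.comp_hasDerivAt (0 : ℝ) hline
    have e : inner ℝ (∇ ρ x) w = fderiv ℝ ρ x w := by
      simp [gradient]
    rw [e]; exact this
  have hU : ∀ᶠ t in 𝓝[>] (0 : ℝ), x + t • w ∈ U := by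
    have := hline.continuousAt.preimage_mem_nhds
      (show U ∈ 𝓝 (x + (0 : ℝ) • w) by simpa using h.isOpen.mem_nhds hxU)
    exact mem_nhdsWithin_of_mem_nhds this
  have hs := hder.hasDerivWithinAt (s := Ioi 0)
  rw [hasDerivWithinAt_iff_tendsto_slope' (by simp)] at hs
  constructor
  · intro hneg
    filter_upwards [hU, hs.eventually (gt_mem_nhds hneg), self_mem_nhdsWithin] with t ht1 ht2 ht3
    have ht3 : 0 < t := ht3
    simp only [slope_def_field, zero_smul, add_zero, hρ0, sub_zero] at ht2
    have : ρ (x + t • w) < 0 := by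
      by_contra! hc; exact absurd ht2 (not_lt.2 (div_nonneg hc ht3.le))
    have : x + t • w ∈ Ω ∩ U := h.inter_eq ▸ ⟨ht1, this⟩
    exact this.1
  · intro hpos
    filter_upwards [hU, hs.eventually (lt_mem_nhds hpos), self_mem_nhdsWithin] with t ht1 ht2 ht3 hΩt
    have ht3 : 0 < t := ht3
    simp only [slope_def_field, zero_smul, add_zero, hρ0, sub_zero] at ht2
    have : x + t • w ∈ {x ∈ U | ρ x < 0} := h.inter_eq ▸ ⟨hΩt, ht1⟩
    exact absurd ht2 (not_lt.2 (div_nonpos_of_nonpos_of_nonneg this.2.le ht3.le))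

/-- The unit exterior normal does not depend on the defining function. -/
theorem IsExteriorNormal.unique {n : ℕ} {Ω : Set (Rn n)} (hΩ : IsOpen Ω) {x v v' : Rn n}
    (hx : x ∈ frontier Ω) (h : IsExteriorNormal Ω x v) (h' : IsExteriorNormal Ω x v') :
    v = v' := by
  obtain ⟨U, ρ, hxU, hρ, rfl⟩ := h
  obtain ⟨U', ρ', hxU', hρ', rfl⟩ := h'
  set a := ∇ ρ x with ha
  set b := ∇ ρ' x with hb
  have ha0 : 0 < ‖a‖ := norm_pos_iff.2 (hρ.gradient_ne_zero x hxU)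
  have hb0 : 0 < ‖b‖ := norm_pos_iff.2 (hρ'.gradient_ne_zero x hxU')
  have key : ‖a‖ * ‖b‖ ≤ inner ℝ a b := by
    by_contra! hc
    set w := ‖a‖ • b - ‖b‖ • a with hw
    have h1 : inner ℝ a w < 0 := by
      rw [hw, inner_sub_right, inner_smul_right, inner_smul_right, real_inner_self_eq_norm_sq]
      nlinarith
    have h2 : 0 < inner ℝ b w := by
      rw [hw, inner_sub_right, inner_smul_right, inner_smul_right, real_inner_self_eq_norm_sq,
        real_inner_comm]
      nlinarith
    obtain ⟨t, ht, ht'⟩ := (((hρ.eventually_mem hΩ hx hxU w).1 h1).and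
      ((hρ'.eventually_mem hΩ hx hxU' w).2 h2)).exists
    exact ht' ht
  have e : inner ℝ a b = ‖a‖ * ‖b‖ := le_antisymm (real_inner_le_norm a b) key
  rw [inner_eq_norm_mul_iff_real] at e
  have : ‖a‖⁻¹ • a = ‖b‖⁻¹ • b := by
    rw [inv_smul_eq_iff₀ ha0.ne', smul_comm, eq_comm, inv_smul_eq_iff₀ hb0.ne']
    exact e.symm
  exact this

/-- The surface measure `dσ` on `∂Ω`: the `(n-1)`-dimensional Hausdorff measure (normalized to
agree with Lebesgue measure on hyperplanes) restricted to the boundary. -/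
def surfaceMeasure {n : ℕ} (Ω : Set (Rn n)) : Measure (Rn n) :=
  (Measure.euclideanHausdorffMeasure (n - 1)).restrict (frontier Ω)

/-! ### Limiting Carleman weights -/

/-- The Poisson bracket `{a, b} = ∂_ξ a · ∂_x b - ∂_x a · ∂_ξ b` of two real symbols on
`T*ℝⁿ = ℝⁿ × ℝⁿ`. -/
def poissonBracket {n : ℕ} (a b : Rn n → Rn n → ℝ) (x ξ : Rn n) : ℝ :=
  inner ℝ (∇ (fun η => a x η) ξ) (∇ (fun y => b y ξ) x) -
    inner ℝ (∇ (fun y => a y ξ) x) (∇ (fun η => b x η) ξ)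

/-- The semiclassical principal symbol `ξ² - (∇φ)² + 2i ∇φ·ξ` of `e^{φ/h} h² L_{A,q} e^{-φ/h}`. -/
def conjSymbol {n : ℕ} (φ : Rn n → ℝ) (x ξ : Rn n) : ℂ :=
  ((‖ξ‖ ^ 2 - ‖∇ φ x‖ ^ 2 : ℝ) : ℂ) + 2 * Complex.I * ((inner ℝ (∇ φ x) ξ : ℝ) : ℂ)

/-- `φ` is a smooth limiting Carleman weight on the open set `W`. -/
structure IsLimitingCarlemanWeight {n : ℕ} (W : Set (Rn n)) (φ : Rn n → ℝ) : Prop where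
  contDiffOn : ContDiffOn ℝ ∞ φ W
  gradient_ne_zero : ∀ x ∈ W, ∇ φ x ≠ 0
  bracket_eq_zero : ∀ x ∈ W, ∀ ξ : Rn n, conjSymbol φ x ξ = 0 →
    poissonBracket (fun y η => (conjSymbol φ y η).re) (fun y η => (conjSymbol φ y η).im) x ξ = 0

/-! ### The magnetic Schrödinger operator -/

/-- The partial derivative `∂_j u`. -/
def pderiv {n : ℕ} (j : Fin n) (u : Rn n → ℂ) (x : Rn n) : ℂ :=
  fderiv ℝ u x (EuclideanSpace.single j 1)

/-- The first order operator `D_j + A_j`, where `D_j = -i ∂_j`. -/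
def magneticD {n : ℕ} (A : Rn n → Rn n) (j : Fin n) (u : Rn n → ℂ) (x : Rn n) : ℂ :=
  -Complex.I * pderiv j u x + (A x j : ℂ) * u x

/-- `L_{A,q} u = ∑_j (D_j + A_j)² u + q u`. -/
def magneticSchrodinger {n : ℕ} (A : Rn n → Rn n) (q : Rn n → ℂ) (u : Rn n → ℂ) (x : Rn n) : ℂ :=
  ∑ j, magneticD A j (magneticD A j u) x + q x * u x

/-! ### The space `H¹₀` -/

/-- `u ∈ H¹₀(Ω)`: `u` is the limit in `H¹(Ω)` of functions in `C^∞_c(Ω)`. The functions `g j` are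
the `L²(Ω)` limits of the partial derivatives, i.e. the weak partial derivatives of `u`. -/
def MemH10 {n : ℕ} (Ω : Set (Rn n)) (u : Rn n → ℂ) : Prop :=
  MemLp u 2 (volume.restrict Ω) ∧
  ∃ g : Fin n → Rn n → ℂ, (∀ j, MemLp (g j) 2 (volume.restrict Ω)) ∧
  ∃ w : ℕ → Rn n → ℂ,
    (∀ k, ContDiff ℝ ∞ (w k) ∧ HasCompactSupport (w k) ∧ tsupport (w k) ⊆ Ω) ∧
    Tendsto (fun k => eLpNorm (w k - u) 2 (volume.restrict Ω)) atTop (𝓝 0) ∧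
    ∀ j, Tendsto (fun k => eLpNorm (pderiv j (w k) - g j) 2 (volume.restrict Ω)) atTop (𝓝 0)

/-! ### The terms of the estimate -/

/-- `‖u‖²`, the square of the `L²(Ω)` norm. -/
def normSq {n : ℕ} (Ω : Set (Rn n)) (u : Rn n → ℂ) : ℝ :=
  ∫ x in Ω, ‖u x‖ ^ 2

/-- `∂_ν φ` on `∂Ω` for a function `φ` that is smooth near the closure of `Ω`. -/
def normalDerivWeight {n : ℕ} (Ω : Set (Rn n)) (φ : Rn n → ℝ) (x : Rn n) : ℝ :=
  inner ℝ (∇ φ x) (exteriorNormal Ω x)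

/-- `∂_ν u` on `∂Ω` for `u ∈ C^∞(closure Ω)`; the derivative is taken within the closure of `Ω`,
as `u` is only defined there. -/
def normalDeriv {n : ℕ} (Ω : Set (Rn n)) (u : Rn n → ℂ) (x : Rn n) : ℂ :=
  fderivWithin ℝ u (closure Ω) x (exteriorNormal Ω x)

/-- `∂Ω₊ = {x ∈ ∂Ω | ∂_ν φ ≥ 0}`. -/
def boundaryPlus {n : ℕ} (Ω : Set (Rn n)) (φ : Rn n → ℝ) : Set (Rn n) :=
  {x ∈ frontier Ω | 0 ≤ normalDerivWeight Ω φ x}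

/-- `∂Ω₋ = {x ∈ ∂Ω | -∂_ν φ ≥ 0}`. -/
def boundaryMinus {n : ℕ} (Ω : Set (Rn n)) (φ : Rn n → ℝ) : Set (Rn n) :=
  {x ∈ frontier Ω | 0 ≤ -normalDerivWeight Ω φ x}

/-- `(∂_ν φ e^{φ/h} ∂_ν u | e^{φ/h} ∂_ν u)_Γ`, for a part `Γ` of `∂Ω`. -/
def boundaryForm {n : ℕ} (Ω : Set (Rn n)) (φ : Rn n → ℝ) (h : ℝ) (u : Rn n → ℂ)
    (Γ : Set (Rn n)) : ℝ :=
  ∫ x in Γ, normalDerivWeight Ω φ x * ‖(Real.exp (φ x / h) : ℂ) * normalDeriv Ω u x‖ ^ 2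
    ∂surfaceMeasure Ω

end

end Carleman

/-! For a limiting weight the bracket vanishes on the characteristic set, so `φ` alone yields no
gain with which to absorb the lower order terms of the operator. It is therefore replaced by the
convexified weight `ψ = φ + kφ²/2` with `k = h/ε`. Since `k` is proportional to `h`, one has
`e^{ψ/h} = e^{φ/h} e^{φ²/(2ε)}`, which is comparable to `e^{φ/h}` uniformly in `h`; on the other
hand convexity gains a positive term of size `hk = h²/ε`, which exceeds `h²K` for any prescribed `K`
once `ε` is small.

For real `v = e^{ψ/h}u` the conjugated Laplacian (`conjLap`) is `S + T`, where `T = 2h∇ψ·∇v` and `S`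
is the rest. In `(S + T)²` the cross term `2ST` is a divergence plus a quadratic form in `(v, ∇v)`
which contains `φ''(∇v, ∇v)`. By the bracket condition (`hess_eq`), `φ''(p, p) = -μ|p|² + 2η(p)
∇φ·p` with `μ = φ''(∇φ, ∇φ)/|∇φ|²` and `η(p) = φ''(∇φ, p)/|∇φ|²`. The second summand produces a
multiple of `T`, absorbed by `T²`. The first one is balanced against the terms in `v²` by adding
`h³Gv∇v` to the flux, with `G = -4(1+kφ)μ - 2Δψ - κk`; the price is a multiple of `vS`, absorbed by
`S²`. What remains is positive of size `hk(v² + h²|∇v|²)`, up to errors `O(h²)(v² + h²|∇v|²)`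
(`carleman_algebra`, `tr_fderiv_flux`).

On integration (`carleman_real`) only the normal flux survives at the boundary. As `v = 0` there,
`∇v` is normal and the flux equals `-2h³(1+kφ)∂_νφ(∂_νv)²`, whose sign separates `∂Ω₊` from `∂Ω₋`
(`carleman_weighted`).

The divergence theorem is used in a weak form: graph charts and a partition of unity give a finite
measure `σ` on `∂Ω` for which it holds with the true unit normal, and `σ` and the surface measure
dominate each other up to constants (`exists_boundaryMeasure`). This is enough, because the constant
of the estimate is free and the parts where `∂_νφ` is positive or negative are estimated separately.
The same theorem shows that `u ∈ C^∞ ∩ H¹₀` vanishes on the boundary (`MemH10.eq_zero_on_frontier`).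

The principal part being real, real and imaginary parts are treated separately, and `|Δu|² ≤
2|L_{A,q}u|² + b(|u|² + |∇u|²)` (`exists_lap_sq_le`). The constant `M` in front of `|Δu|²` does not
depend on `K`, so `K = Mb + 1` absorbs the last term. -/

namespace Carleman

/-! ### Divergence theorem below a graph -/

section Graph

variable {m n : ℕ}

/-- The vertical shear `(y, s) ↦ (y, s + g y)`, followed by the linear change of coordinates `J`. -/
def graphShear (J : (Rn m × ℝ) ≃L[ℝ] Rn n) (g : Rn m → ℝ) (p : Rn m × ℝ) : Rn n :=
  J (p.1, p.2 + g p.1)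

/-- The differential of `x ↦ (J⁻¹ x).2 - g (J⁻¹ x).1` at the points above `y`. -/
noncomputable def graphForm (J : (Rn m × ℝ) ≃L[ℝ] Rn n) (g : Rn m → ℝ) (y : Rn m) :
    Rn n →L[ℝ] ℝ :=
  (ContinuousLinearMap.snd ℝ (Rn m) ℝ - (fderiv ℝ g y).comp (ContinuousLinearMap.fst ℝ (Rn m) ℝ)).comp
    (J.symm : Rn n →L[ℝ] Rn m × ℝ)

theorem graphForm_apply (J : (Rn m × ℝ) ≃L[ℝ] Rn n) (g : Rn m → ℝ) (y : Rn m) (w : Rn n) :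
    graphForm J g y w = (J.symm w).2 - fderiv ℝ g y (J.symm w).1 := by
  simp [graphForm]

/-- Each vertical line is only translated, so no Jacobian appears. -/
theorem measurePreserving_graphShear {J : (Rn m × ℝ) ≃L[ℝ] Rn n} (hJ : MeasurePreserving J)
    {g : Rn m → ℝ} (hg : Continuous g) : MeasurePreserving (graphShear J g) := by
  have h1 : MeasurePreserving (fun p : Rn m × ℝ => (p.1, p.2 + g p.1)) volume volume := by
    refine (MeasurePreserving.id (volume : Measure (Rn m))).skew_product
      (g := fun y s => s + g y) ?_ ?_
    · exact (continuous_snd.add (hg.comp continuous_fst)).measurable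
    · exact Eventually.of_forall fun y => map_add_right_eq_self volume (g y)
  exact hJ.comp h1

theorem measurableEmbedding_graphShear (J : (Rn m × ℝ) ≃L[ℝ] Rn n)
    {g : Rn m → ℝ} (hg : Continuous g) : MeasurableEmbedding (graphShear J g) := by
  refine Continuous.measurableEmbedding ?_ ?_
  · unfold graphShear; fun_prop
  · rintro ⟨y, s⟩ ⟨z, t⟩ h
    have := J.injective h
    simp only [Prod.mk.injEq] at this
    obtain ⟨rfl, h2⟩ := this
    simp at h2; simp [h2]

theorem hasFDerivAt_graphShear (J : (Rn m × ℝ) ≃L[ℝ] Rn n)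
    {g : Rn m → ℝ} (hg : Differentiable ℝ g) (p : Rn m × ℝ) :
    HasFDerivAt (graphShear J g) ((J : Rn m × ℝ →L[ℝ] Rn n).comp
      ((ContinuousLinearMap.fst ℝ (Rn m) ℝ).prod (ContinuousLinearMap.snd ℝ (Rn m) ℝ +
        (fderiv ℝ g p.1).comp (ContinuousLinearMap.fst ℝ (Rn m) ℝ)))) p := by
  have h1 : HasFDerivAt (fun p : Rn m × ℝ => (p.1, p.2 + g p.1))
      ((ContinuousLinearMap.fst ℝ (Rn m) ℝ).prod (ContinuousLinearMap.snd ℝ (Rn m) ℝ +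
        (fderiv ℝ g p.1).comp (ContinuousLinearMap.fst ℝ (Rn m) ℝ))) p :=
    hasFDerivAt_fst.prodMk (hasFDerivAt_snd.add ((hg p.1).hasFDerivAt.comp p hasFDerivAt_fst))
  exact J.hasFDerivAt.comp p h1

/-- The divergence theorem (for one component) for functions supported in a graph chart. -/
theorem integral_fderiv_graph {J : (Rn m × ℝ) ≃L[ℝ] Rn n} (hJ : MeasurePreserving J)
    {g : Rn m → ℝ} (hg : ContDiff ℝ 1 g) {B : ℝ} (hgB : ∀ y, ‖fderiv ℝ g y‖ ≤ B)
    {Ω U K : Set (Rn n)} (hΩ : IsOpen Ω) (hU : ∀ x ∈ U, x ∈ Ω ↔ (J.symm x).2 < g (J.symm x).1)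
    (hK : IsCompact K) (hKU : K ⊆ U) {f : Rn n → ℝ} (hf0 : ∀ x ∉ K, f x = 0)
    (hfc : ContinuousOn f (closure Ω)) (hfd : ContDiffOn ℝ 1 f Ω)
    (hfi : IntegrableOn (fderiv ℝ f) Ω) (hUo : IsOpen U) (w : Rn n) :
    ∫ x in Ω, fderiv ℝ f x w = ∫ y, f (J (y, g y)) * graphForm J g y w := by
  set Θ := graphShear J g with hΘ
  have hgc : Continuous g := hg.continuous
  have hgd : Differentiable ℝ g := hg.differentiable (by simp)
  have hΘc : Continuous Θ := by rw [hΘ]; unfold graphShear; fun_prop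
  have hmp : MeasurePreserving Θ := measurePreserving_graphShear hJ hgc
  have hme : MeasurableEmbedding Θ := measurableEmbedding_graphShear J hgc
  set H : Set (Rn m × ℝ) := {p | p.2 < 0} with hH
  have hHo : IsOpen H := isOpen_lt continuous_snd continuous_const
  have hKc : IsOpen Kᶜ := hK.isClosed.isOpen_compl
  have hUΘ : ∀ p, Θ p ∈ U → (Θ p ∈ Ω ↔ p ∈ H) := by
    intro p hp
    rw [hU _ hp]
    simp [hΘ, graphShear, hH]
  have hzero : ∀ x ∉ K, f =ᶠ[𝓝 x] fun _ => 0 := fun x hx => by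
    filter_upwards [hKc.mem_nhds hx] with y hy using hf0 y hy
  have hfd0 : ∀ x ∉ K, fderiv ℝ f x = 0 := fun x hx => by
    rw [(hzero x hx).fderiv_eq]; simp
  -- Over the half space `f ∘ Θ` is smooth even outside the chart: either the point lies in `K ⊆ U`,
  -- hence in `Ω`, or `f` vanishes near it because `K` is closed.
  have hcd : ∀ p ∈ H, ContDiffAt ℝ 1 f (Θ p) := by
    intro p hp
    by_cases hpK : Θ p ∈ K
    · exact hfd.contDiffAt (hΩ.mem_nhds ((hUΘ p (hKU hpK)).2 hp))
    · exact contDiffAt_const.congr_of_eventuallyEq (hzero _ hpK)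
  have hind : ∀ p, Ω.indicator (fderiv ℝ f) (Θ p) = H.indicator (fun q => fderiv ℝ f (Θ q)) p := by
    intro p
    by_cases hpK : Θ p ∈ K
    · have := hUΘ p (hKU hpK)
      by_cases hp : p ∈ H
      · rw [indicator_of_mem hp, indicator_of_mem (this.2 hp)]
      · rw [indicator_of_notMem hp, indicator_of_notMem (fun h => hp (this.1 h))]
    · simp [indicator, hfd0 _ hpK]
  have hint : IntegrableOn (fun q => fderiv ℝ f (Θ q)) H := by
    have := (hmp.integrable_comp_emb hme).2
      (IntegrableOn.integrable_indicator (ε' := Rn n →L[ℝ] ℝ) hfi hΩ.measurableSet)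
    exact (integrable_indicator_iff (ε' := Rn n →L[ℝ] ℝ) hHo.measurableSet).1
      (this.congr (Eventually.of_forall hind))
  -- transfer to the half space
  have step1 : ∫ x in Ω, fderiv ℝ f x w = ∫ p in H, fderiv ℝ f (Θ p) w := by
    rw [← integral_indicator hΩ.measurableSet, ← integral_indicator hHo.measurableSet,
      ← hmp.integral_comp hme]
    congr 1; ext p
    have e1 : Ω.indicator (fun x => fderiv ℝ f x w) (Θ p) = Ω.indicator (fderiv ℝ f) (Θ p) w := by
      by_cases h : Θ p ∈ Ω <;> simp [h]
    have e2 : H.indicator (fun q => fderiv ℝ f (Θ q) w) p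
        = H.indicator (fun q => fderiv ℝ f (Θ q)) p w := by
      by_cases h : p ∈ H <;> simp [h]
    rw [e1, e2, hind]
  set G := f ∘ Θ with hG
  have hdG : ∀ p ∈ H, HasFDerivAt G ((fderiv ℝ f (Θ p)).comp ((J : Rn m × ℝ →L[ℝ] Rn n).comp
      ((ContinuousLinearMap.fst ℝ (Rn m) ℝ).prod (ContinuousLinearMap.snd ℝ (Rn m) ℝ +
        (fderiv ℝ g p.1).comp (ContinuousLinearMap.fst ℝ (Rn m) ℝ))))) p := fun p hp =>
    (((hcd p hp).differentiableAt (by simp)).hasFDerivAt).comp p (hasFDerivAt_graphShear J hgd p)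
  set w1 := (J.symm w).1 with hw1
  set w2 := (J.symm w).2 with hw2
  have hJw : J (w1, w2) = w := by simp [hw1, hw2]
  have hfg : Continuous fun y => fderiv ℝ g y := hg.continuous_fderiv (by simp)
  -- The direction `w` is the sum of a vector tangent to the translated graph, along which the
  -- derivative of `f` is a `y`-derivative of `f ∘ Θ`, and of `graphForm J g p.1 w` times the
  -- vertical direction.
  have split : ∀ p : Rn m × ℝ, fderiv ℝ f (Θ p) w = fderiv ℝ f (Θ p) (J (w1, fderiv ℝ g p.1 w1)) +
      fderiv ℝ f (Θ p) (J (0, 1)) * graphForm J g p.1 w := by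
    intro p
    have : w = J (w1, fderiv ℝ g p.1 w1) + (w2 - fderiv ℝ g p.1 w1) • J (0, 1) := by
      rw [← map_smul, ← map_add]
      conv_lhs => rw [← hJw]
      simp
    conv_lhs => rw [this]
    rw [map_add, map_smul, graphForm_apply, smul_eq_mul]; ring
  have apply_int : ∀ (c : Rn m × ℝ → Rn n), Continuous c → (∃ C, ∀ p, ‖c p‖ ≤ C) →
      IntegrableOn (fun p => fderiv ℝ f (Θ p) (c p)) H := by
    rintro c hc ⟨C, hC⟩
    refine (hint.norm.mul_const C).mono' ?_ (Eventually.of_forall fun p => ?_)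
    · exact (ContinuousLinearMap.id ℝ (Rn n →L[ℝ] ℝ)).aestronglyMeasurable_comp₂
        hint.aestronglyMeasurable hc.aestronglyMeasurable
    · exact ((fderiv ℝ f (Θ p)).le_opNorm _).trans (by gcongr; exact hC p)
  have int1 : IntegrableOn (fun p : Rn m × ℝ =>
      fderiv ℝ f (Θ p) (J (w1, fderiv ℝ g p.1 w1))) H := by
    refine apply_int _ (by fun_prop) ⟨‖(J : Rn m × ℝ →L[ℝ] Rn n)‖ * max ‖w1‖ (B * ‖w1‖), fun p => ?_⟩
    refine ((J : Rn m × ℝ →L[ℝ] Rn n).le_opNorm _).trans ?_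
    gcongr
    rw [Prod.norm_def]
    exact max_le_max le_rfl (((fderiv ℝ g p.1).le_opNorm _).trans
      (by gcongr; exact hgB _))
  have int2' : IntegrableOn (fun p : Rn m × ℝ => fderiv ℝ f (Θ p) (J (0, 1))) H :=
    apply_int _ continuous_const ⟨_, fun p => le_rfl⟩
  have int2 : IntegrableOn (fun p : Rn m × ℝ =>
      fderiv ℝ f (Θ p) (J (0, 1)) * graphForm J g p.1 w) H := by
    have := apply_int (fun p => graphForm J g p.1 w • J (0, 1))
      (by simp only [graphForm_apply]; fun_prop)
      ⟨(‖w2‖ + B * ‖w1‖) * ‖J (0, 1)‖, fun p => ?_⟩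
    · refine this.congr_fun (fun p _ => ?_) hHo.measurableSet
      simp [mul_comm]
    · rw [norm_smul]
      gcongr
      rw [graphForm_apply]
      refine (norm_sub_le _ _).trans ?_
      gcongr
      exact ((fderiv ℝ g p.1).le_opNorm _).trans (by gcongr; exact hgB _)
  rw [step1, setIntegral_congr_fun hHo.measurableSet (fun p _ => split p), integral_add int1 int2]
  have hHprod : H = univ ×ˢ Iio (0 : ℝ) := by ext p; simp [hH]
  have hvol : (volume : Measure (Rn m × ℝ)).restrict H
      = (volume : Measure (Rn m)).prod (volume.restrict (Iio (0 : ℝ))) := by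
    rw [hHprod, Measure.volume_eq_prod, ← Measure.prod_restrict, Measure.restrict_univ]
  have hcomp : ∀ s, HasCompactSupport fun y => G (y, s) := by
    intro s
    have hKV : IsCompact ((fun x => (J.symm x).1) '' K) :=
      hK.image (by fun_prop)
    refine HasCompactSupport.intro hKV fun y hy => hf0 _ fun hyK => hy ⟨_, hyK, ?_⟩
    simp [hΘ, graphShear]
  -- On each slice `s < 0` the function `y ↦ f (Θ (y, s))` is `C¹` with compact support, so its
  -- derivatives have integral zero.
  have z1 : ∫ p in H, fderiv ℝ f (Θ p) (J (w1, fderiv ℝ g p.1 w1)) = 0 := by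
    unfold IntegrableOn at int1
    rw [hvol] at int1 ⊢
    rw [integral_prod_symm _ int1]
    refine setIntegral_eq_zero_of_forall_eq_zero fun s hs => ?_
    have hcds : ContDiff ℝ 1 fun y => G (y, s) := by
      rw [contDiff_iff_contDiffAt]
      intro y
      have : ContDiffAt ℝ 1 (fun y => Θ (y, s)) y := by
        have : ContDiff ℝ 1 (fun y => Θ (y, s)) := by
          simp only [hΘ, graphShear]; fun_prop
        exact this.contDiffAt
      exact ContDiffAt.comp (g := f) y (hcd (y, s) hs) this
    have e : ∀ y, fderiv ℝ f (Θ (y, s)) (J (w1, fderiv ℝ g y w1))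
        = fderiv ℝ (fun y => G (y, s)) y w1 := by
      intro y
      have h1 : HasFDerivAt (fun y : Rn m => (y, s)) (ContinuousLinearMap.inl ℝ (Rn m) ℝ) y :=
        hasFDerivAt_prodMk_left y s
      have := (HasFDerivAt.comp y (hdG (y, s) hs) h1).fderiv
      rw [show (fun y => G (y, s)) = G ∘ (fun y => (y, s)) from rfl, this]
      simp
    simp_rw [e]
    have hd := (hcds.continuous_fderiv (by simp)).clm_apply (continuous_const (y := w1))
    have hcs : HasCompactSupport fun y => fderiv ℝ (fun y => G (y, s)) y w1 :=
      (hcomp s).fderiv_apply (𝕜 := ℝ) w1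
    have := integral_mul_fderiv_eq_neg_fderiv_mul_of_integrable (μ := (volume : Measure (Rn m)))
      (f := fun _ => (1 : ℝ)) (g := fun y => G (y, s)) (v := w1) (by simp)
      (by simpa using hd.integrable_of_hasCompactSupport hcs)
      (by simpa using hcds.continuous.integrable_of_hasCompactSupport (hcomp s))
      (by simp) (fun y _ => (hcds.differentiable (by simp)) y)
    simpa using this
  rw [z1, zero_add]
  unfold IntegrableOn at int2 int2'
  rw [hvol] at int2 int2' ⊢
  rw [integral_prod _ int2]
  have hae := int2'.prod_right_ae
  refine integral_congr_ae ?_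
  filter_upwards [hae] with y hy
  rw [integral_mul_const, ← integral_Iic_eq_integral_Iio]
  congr 1
  have hy' : IntegrableOn (fun s => fderiv ℝ f (Θ (y, s)) (J (0, 1))) (Iic 0) := by
    rw [integrableOn_Iic_iff_integrableOn_Iio]; exact hy
  have hline : Continuous fun s => Θ (y, s) := hΘc.comp (by fun_prop)
  -- `f` is differentiable only inside `Ω`; the fundamental theorem of calculus on `(-∞, 0]` needs
  -- in addition continuity at the endpoint, inherited from continuity on the closure.
  have hcw : ContinuousWithinAt (fun s => G (y, s)) (Iic 0) 0 := by
    by_cases h0 : Θ (y, 0) ∈ K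
    · have hev : ∀ᶠ s in 𝓝[Iio 0] (0 : ℝ), Θ (y, s) ∈ Ω := by
        have : ∀ᶠ s in 𝓝[Iio 0] (0 : ℝ), Θ (y, s) ∈ U :=
          mem_nhdsWithin_of_mem_nhds (hline.continuousAt.preimage_mem_nhds (hUo.mem_nhds (hKU h0)))
        filter_upwards [this, self_mem_nhdsWithin] with s hs hs'
        exact (hUΘ _ hs).2 hs'
      have ht : Tendsto (fun s => Θ (y, s)) (𝓝[<] (0 : ℝ)) (𝓝[Ω] (Θ (y, 0))) :=
        tendsto_nhdsWithin_iff.2 ⟨hline.continuousAt.tendsto.mono_left nhdsWithin_le_nhds, hev⟩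
      have hcl : Θ (y, 0) ∈ closure Ω := mem_closure_of_tendsto
        (hline.continuousAt.tendsto.mono_left nhdsWithin_le_nhds) hev
      have : ContinuousWithinAt (fun s => G (y, s)) (Iio 0) 0 :=
        ((hfc _ hcl).tendsto.mono_left (nhdsWithin_mono _ subset_closure)).comp ht
      rw [← Iio_insert (a := (0 : ℝ)), continuousWithinAt_insert_self]
      exact this
    · have h1 : ContinuousAt f (Θ (y, 0)) :=
        (continuousAt_const (y := (0 : ℝ))).congr (hzero _ h0).symm
      exact (ContinuousAt.comp (f := fun s => Θ (y, s)) (x := 0) h1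
        hline.continuousAt).continuousWithinAt
  have hbot : Tendsto (fun s => G (y, s)) atBot (𝓝 0) := by
    obtain ⟨R, hR⟩ := (hK.image (J.symm.continuous.snd)).isBounded.exists_norm_le
    refine tendsto_const_nhds.congr' ?_
    filter_upwards [eventually_lt_atBot (-R - |g y|)] with s hs
    refine (hf0 _ fun hsK => ?_).symm
    have h1 := hR _ ⟨_, hsK, rfl⟩
    simp only [hΘ, graphShear, ContinuousLinearEquiv.symm_apply_apply, Real.norm_eq_abs] at h1
    have := neg_abs_le (s + g y)
    linarith [le_abs_self (g y)]
  have := integral_Iic_of_hasDerivAt_of_tendsto hcw (f' := fun s => fderiv ℝ f (Θ (y, s)) (J (0, 1)))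
    (fun s hs => ?_) hy' hbot
  · rw [this]; simp [hG, hΘ, graphShear]
  · have h1 : HasDerivAt (fun s : ℝ => (y, s)) ((0, 1) : Rn m × ℝ) s :=
      (hasDerivAt_const s y).prodMk (hasDerivAt_id s)
    exact ((hdG (y, s) hs).comp_hasDerivAt s h1).congr_deriv (by simp)

end Graph

/-! ### Smooth domains as regions below graphs -/

section Chart

variable {m n : ℕ}

/-- The splitting `ℝᵐ × ℝ ≃ ℝᵐ⁺¹` which uses the last factor as the `i`-th coordinate. -/
noncomputable def insertNthEquiv (i : Fin (m + 1)) : (Rn m × ℝ) ≃L[ℝ] Rn (m + 1) :=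
  LinearEquiv.toContinuousLinearEquiv
    { toFun := fun p => WithLp.toLp 2 (i.insertNth p.2 p.1.ofLp : Fin (m + 1) → ℝ)
      invFun := fun x => (WithLp.toLp 2 (i.removeNth x.ofLp), x i)
      map_add' := fun p q => by
        ext j
        refine Fin.succAboveCases i ?_ (fun j => ?_) j <;> simp
      map_smul' := fun c p => by
        ext j
        refine Fin.succAboveCases i ?_ (fun j => ?_) j <;> simp
      left_inv := fun p => by simp
      right_inv := fun x => by simp }

theorem insertNthEquiv_apply (i : Fin (m + 1)) (p : Rn m × ℝ) :
    insertNthEquiv i p = WithLp.toLp 2 (i.insertNth p.2 p.1.ofLp : Fin (m + 1) → ℝ) := rfl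

theorem measurePreserving_insertNthEquiv (i : Fin (m + 1)) :
    MeasurePreserving (insertNthEquiv (m := m) i) := by
  have h1 : MeasurePreserving (Prod.map id WithLp.ofLp : ℝ × Rn m → ℝ × (Fin m → ℝ)) :=
    (MeasurePreserving.id (volume : Measure ℝ)).prod (PiLp.volume_preserving_ofLp (Fin m))
  have h2 := (volume_preserving_piFinSuccAbove (fun _ : Fin (m + 1) => ℝ) i).symm
  have h3 : MeasurePreserving (Prod.swap : Rn m × ℝ → ℝ × Rn m) := Measure.measurePreserving_swap
  exact (PiLp.volume_preserving_toLp (Fin (m + 1))).comp (h2.comp (h1.comp h3))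

theorem insertNthEquiv_zero_one (i : Fin (m + 1)) :
    insertNthEquiv (m := m) i (0, 1) = EuclideanSpace.single i 1 := by
  rw [insertNthEquiv_apply]
  ext j
  refine Fin.succAboveCases i ?_ (fun j => ?_) j <;> simp [Fin.succAbove_ne]

/-- A nonzero linear form is positive on the vertical direction of a suitable volume preserving
splitting. -/
theorem exists_splitting_pos {ℓ : Rn (m + 1) →L[ℝ] ℝ} (hℓ : ℓ ≠ 0) :
    ∃ J : (Rn m × ℝ) ≃L[ℝ] Rn (m + 1), MeasurePreserving J ∧ 0 < ℓ (J (0, 1)) := by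
  obtain ⟨i, hi⟩ : ∃ i, ℓ (EuclideanSpace.single i 1) ≠ 0 := by
    by_contra! h
    refine hℓ (ContinuousLinearMap.coe_injective
      ((EuclideanSpace.basisFun (Fin (m + 1)) ℝ).toBasis.ext fun i => ?_))
    simpa using h i
  rcases lt_or_gt_of_ne hi with h | h
  · refine ⟨((ContinuousLinearEquiv.refl ℝ (Rn m)).prodCongr (ContinuousLinearEquiv.neg ℝ)).trans
      (insertNthEquiv i), ?_, ?_⟩
    · have : MeasurePreserving (Prod.map id Neg.neg : Rn m × ℝ → Rn m × ℝ) :=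
        (MeasurePreserving.id volume).prod (Measure.measurePreserving_neg volume)
      exact (measurePreserving_insertNthEquiv i).comp this
    · have : ((ContinuousLinearEquiv.refl ℝ (Rn m)).prodCongr (ContinuousLinearEquiv.neg ℝ)).trans
        (insertNthEquiv i) ((0 : Rn m), (1 : ℝ)) = - insertNthEquiv i ((0 : Rn m), (1 : ℝ)) := by
        rw [← map_neg]; simp
      rw [this, insertNthEquiv_zero_one, map_neg]
      linarith
  · exact ⟨insertNthEquiv i, measurePreserving_insertNthEquiv i, by rwa [insertNthEquiv_zero_one]⟩

/-- In the linear coordinates `J`, the part of `Ω` in `U` is the region below the graph of `g`. -/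
structure IsGraphChart (Ω U : Set (Rn n)) (J : (Rn m × ℝ) ≃L[ℝ] Rn n) (g : Rn m → ℝ) : Prop where
  isOpen : IsOpen U
  isBounded : Bornology.IsBounded U
  measurePreserving : MeasurePreserving J
  contDiff : ContDiff ℝ 1 g
  hasCompactSupport : HasCompactSupport g
  mem_iff : ∀ x ∈ U, x ∈ Ω ↔ (J.symm x).2 < g (J.symm x).1
  graphForm_eq : ∀ x ∈ U, x ∈ frontier Ω → ∀ w, graphForm J g (J.symm x).1 w =
    ‖graphForm J g (J.symm x).1‖ * inner ℝ (exteriorNormal Ω x) w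

theorem IsDefiningFunction.eq_zero_of_mem_frontier {Ω U : Set (Rn n)} {ρ : Rn n → ℝ}
    (h : IsDefiningFunction Ω U ρ) (hΩ : IsOpen Ω) {x : Rn n} (hx : x ∈ frontier Ω) (hxU : x ∈ U) :
    ρ x = 0 := by
  have hxΩ : x ∉ Ω := fun h' => by
    rw [hΩ.frontier_eq] at hx; exact hx.2 h'
  have hc : ContinuousAt ρ x := h.contDiffOn.continuousOn.continuousAt (h.isOpen.mem_nhds hxU)
  apply le_antisymm
  · by_contra! hc'
    have h1 : ∀ᶠ y in 𝓝 x, 0 < ρ y := hc.eventually (lt_mem_nhds hc')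
    have h2 : ∃ᶠ y in 𝓝 x, y ∈ Ω := mem_closure_iff_frequently.1 hx.1
    obtain ⟨y, hy, hy1, hy2⟩ := (h2.and_eventually (h1.and (h.isOpen.mem_nhds hxU))).exists
    have : y ∈ {x ∈ U | ρ x < 0} := h.inter_eq ▸ ⟨hy, hy2⟩
    exact absurd this.2 (not_lt.2 hy1.le)
  · by_contra! hc'
    have : x ∈ Ω ∩ U := h.inter_eq ▸ ⟨hxU, hc'⟩
    exact hxΩ this.1

/-- `exteriorNormal` is an arbitrary choice; uniqueness of the normal lets it be computed from
whichever local defining function is at hand. -/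
theorem exteriorNormal_eq {Ω U : Set (Rn n)} {ρ : Rn n → ℝ} (hΩ : IsOpen Ω)
    (h : IsDefiningFunction Ω U ρ) {x : Rn n} (hx : x ∈ frontier Ω) (hxU : x ∈ U) :
    exteriorNormal Ω x = ‖∇ ρ x‖⁻¹ • ∇ ρ x := by
  have hn : IsExteriorNormal Ω x (‖∇ ρ x‖⁻¹ • ∇ ρ x) := ⟨U, ρ, hxU, h, rfl⟩
  have h' : x ∈ frontier Ω ∧ ∃ v, IsExteriorNormal Ω x v := ⟨hx, _, hn⟩
  rw [exteriorNormal, dif_pos h']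
  exact h'.2.choose_spec.unique hΩ hx hn

/-- The implicit function theorem, in a coordinate direction along which `ρ` increases. Since `ρ` is
strictly increasing on vertical segments and zero on the graph, `ρ < 0` means lying below it. -/
theorem exists_isGraphChart {Ω : Set (Rn (m + 1))} (hΩ : IsOpen Ω) (hΩs : HasSmoothBoundary Ω)
    {x₀ : Rn (m + 1)} (hx₀ : x₀ ∈ frontier Ω) :
    ∃ (U : Set (Rn (m + 1))) (J : (Rn m × ℝ) ≃L[ℝ] Rn (m + 1)) (g : Rn m → ℝ),
      x₀ ∈ U ∧ IsGraphChart Ω U J g := by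
  obtain ⟨U₀, ρ, hxU, hρ⟩ := hΩs x₀ hx₀
  have hgr : fderiv ℝ ρ x₀ ≠ 0 := fun h => hρ.gradient_ne_zero x₀ hxU (by simp [gradient, h])
  obtain ⟨J, hJ, hpos⟩ := exists_splitting_pos hgr
  set F : Rn m × ℝ → ℝ := fun p => ρ (J p) with hF
  set p₀ := J.symm x₀ with hp₀
  have hJp₀ : J p₀ = x₀ := by simp [hp₀]
  set O : Set (Rn m × ℝ) := J ⁻¹' U₀ with hO
  have hOo : IsOpen O := hρ.isOpen.preimage J.continuous
  have hp₀O : p₀ ∈ O := by simpa [hO, hJp₀] using hxU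
  have hρd : ∀ p ∈ O, DifferentiableAt ℝ ρ (J p) := fun p hp =>
    (hρ.contDiffOn.contDiffAt (hρ.isOpen.mem_nhds hp)).differentiableAt (by simp)
  have hFd : ∀ p ∈ O, HasFDerivAt F ((fderiv ℝ ρ (J p)).comp (J : Rn m × ℝ →L[ℝ] Rn (m + 1))) p :=
    fun p hp => (hρd p hp).hasFDerivAt.comp p J.hasFDerivAt
  have hFc : ContDiffAt ℝ 1 F p₀ := by
    have : ContDiffAt ℝ 1 ρ (J p₀) :=
      ((hρ.contDiffOn.contDiffAt (hρ.isOpen.mem_nhds hp₀O))).of_le (by exact_mod_cast le_top)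
    exact this.comp p₀ J.contDiff.contDiffAt
  have hF0 : F p₀ = 0 := by
    simp only [hF, hJp₀]; exact hρ.eq_zero_of_mem_frontier hΩ hx₀ hxU
  have hd0 : 0 < fderiv ℝ F p₀ (0, 1) := by
    rw [(hFd p₀ hp₀O).fderiv]; simpa [hJp₀] using hpos
  have hinv : (fderiv ℝ F p₀ ∘L .inr ℝ (Rn m) ℝ).IsInvertible := by
    refine ⟨ContinuousLinearEquiv.unitsEquivAut ℝ (Units.mk0 _ hd0.ne'), ?_⟩
    ext
    simp
  set g₀ := hFc.implicitFunction (by simp) hinv with hg₀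
  have hg₀y : g₀ p₀.1 = p₀.2 := hFc.implicitFunction_apply_self (by simp) hinv
  have hg₀c : ContDiffAt ℝ 1 g₀ p₀.1 := hFc.contDiffAt_implicitFunction (by simp) hinv
  have ev1 : ∀ᶠ p in 𝓝 p₀, p ∈ O ∧ 0 < fderiv ℝ F p (0, 1) := by
    have hc : ContinuousAt (fun p => fderiv ℝ F p (0, 1)) p₀ :=
      (hFc.continuousAt_fderiv (by simp)).clm_apply continuousAt_const
    exact Filter.Eventually.and (hOo.mem_nhds hp₀O) (hc.eventually (lt_mem_nhds hd0))
  obtain ⟨r, hr, hr1⟩ := Metric.eventually_nhds_iff_ball.1 ev1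
  have ev2 : ∀ᶠ y in 𝓝 p₀.1, ContDiffAt ℝ 1 g₀ y ∧ F (y, g₀ y) = 0 ∧ g₀ y ∈ Metric.ball p₀.2 r := by
    refine (hg₀c.eventually (by simp)).and (Filter.Eventually.and ?_ ?_)
    · filter_upwards [hFc.eventually_apply_implicitFunction (by simp) hinv] with y hy
      rw [hy, hF0]
    · exact hg₀c.continuousAt.preimage_mem_nhds (by rw [hg₀y]; exact Metric.ball_mem_nhds _ hr)
  obtain ⟨r', hr', hr'1⟩ := Metric.eventually_nhds_iff_ball.1 ev2
  set δ := min r r' with hδ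
  have hδ0 : 0 < δ := lt_min hr hr'
  have hmono : ∀ y ∈ Metric.ball p₀.1 r, StrictMonoOn (fun t => F (y, t)) (Metric.ball p₀.2 r) := by
    intro y hy
    have hmem : ∀ t ∈ Metric.ball p₀.2 r, (y, t) ∈ Metric.ball p₀ r := fun t ht => by
      rw [← ball_prod_same (x := p₀.1) (y := p₀.2)]; exact ⟨hy, ht⟩
    have hder : ∀ t ∈ Metric.ball p₀.2 r,
        HasDerivAt (fun t => F (y, t)) (fderiv ℝ F (y, t) (0, 1)) t := by
      intro t ht
      have h1 : HasDerivAt (fun s : ℝ => (y, s)) ((0, 1) : Rn m × ℝ) t :=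
        (hasDerivAt_const t y).prodMk (hasDerivAt_id t)
      exact (hFd _ (hr1 _ (hmem t ht)).1).differentiableAt.hasFDerivAt.comp_hasDerivAt t h1
    refine strictMonoOn_of_deriv_pos (convex_ball _ _)
      (fun t ht => (hder t ht).continuousAt.continuousWithinAt) fun t ht => ?_
    rw [Metric.isOpen_ball.interior_eq] at ht
    rw [(hder t ht).deriv]
    exact (hr1 _ (hmem t ht)).2
  -- The implicit function is controlled only on the ball of radius `r'`. The cutoff vanishes beyond
  -- `δ/2 < r'`, which makes the product `C¹` everywhere, and equals `1` on the ball of radius `δ/4`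
  -- to which the chart is restricted.
  let χ : ContDiffBump p₀.1 := ⟨δ / 4, δ / 2, by positivity, by linarith⟩
  set g : Rn m → ℝ := fun y => χ y * g₀ y with hg
  have hχ1 : ∀ y ∈ Metric.ball p₀.1 (δ / 4), g y = g₀ y := fun y hy => by
    simp [hg, χ.one_of_mem_closedBall (Metric.ball_subset_closedBall hy)]
  have hgc : ContDiff ℝ 1 g := by
    rw [contDiff_iff_contDiffAt]
    intro y
    by_cases hy : y ∈ tsupport χ
    · rw [χ.tsupport_eq, Metric.mem_closedBall] at hy
      refine χ.contDiff.contDiffAt.mul (hr'1 y ?_).1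
      have : χ.rOut = δ / 2 := rfl
      rw [Metric.mem_ball]
      linarith [min_le_right r r']
    · refine (contDiffAt_const (c := (0 : ℝ))).congr_of_eventuallyEq ?_
      filter_upwards [notMem_tsupport_iff_eventuallyEq.1 hy] with z hz
      simp [hg, hz]
  set B : Set (Rn m × ℝ) := Metric.ball p₀.1 (δ / 4) ×ˢ Metric.ball p₀.2 r with hB
  have hBr : ∀ p ∈ B, p.1 ∈ Metric.ball p₀.1 r := fun p hp =>
    Metric.ball_subset_ball (by linarith [min_le_left r r']) hp.1
  have hBr' : ∀ p ∈ B, p.1 ∈ Metric.ball p₀.1 r' := fun p hp =>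
    Metric.ball_subset_ball (by linarith [min_le_right r r']) hp.1
  have hBO : ∀ p ∈ B, p ∈ O := fun p hp => (hr1 p (by
    rw [← ball_prod_same (x := p₀.1) (y := p₀.2)]; exact ⟨hBr p hp, hp.2⟩)).1
  have hlt : ∀ p ∈ B, F p < 0 ↔ p.2 < g p.1 := by
    intro p hp
    obtain ⟨-, h0, hmem⟩ := hr'1 p.1 (hBr' p hp)
    rw [hχ1 p.1 hp.1, ← (hmono p.1 (hBr p hp)).lt_iff_lt hp.2 hmem]
    simp only [h0]
  refine ⟨J.symm ⁻¹' B, J, g, ?_, ?_, ?_, hJ, hgc, ?_, ?_, ?_⟩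
  · exact ⟨Metric.mem_ball_self (by positivity), Metric.mem_ball_self hr⟩
  · exact (Metric.isOpen_ball.prod Metric.isOpen_ball).preimage J.symm.continuous
  · have : J.symm ⁻¹' B = J '' B := (J.toEquiv.image_eq_preimage_symm B).symm
    rw [this]
    exact J.lipschitz.isBounded_image (Metric.isBounded_ball.prod Metric.isBounded_ball)
  · exact χ.hasCompactSupport.mul_right
  · intro x hx
    rw [← hlt _ hx]
    have hxU₀ : x ∈ U₀ := by simpa [hO] using hBO _ hx
    have : x ∈ Ω ↔ x ∈ Ω ∩ U₀ := by simp [hxU₀]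
    rw [this, hρ.inter_eq]
    simp [hF, hxU₀]
  · intro x hx hxΩ w
    set p := J.symm x with hp
    have hJp : J p = x := by simp [hp]
    have hxU₀ : x ∈ U₀ := by simpa [hO] using hBO _ hx
    have hρ0 := hρ.eq_zero_of_mem_frontier hΩ hxΩ hxU₀
    have hFp : F p = 0 := by simp only [hF, hJp, hρ0]
    obtain ⟨hcy, h0, hmem⟩ := hr'1 p.1 (hBr' p hx)
    have hp2 : p.2 = g p.1 := by
      rw [hχ1 p.1 hx.1]
      refine (hmono p.1 (hBr p hx)).injOn hx.2 hmem ?_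
      simp only [h0]; exact hFp
    have hgd : HasFDerivAt g (fderiv ℝ g p.1) p.1 := (hgc.differentiable (by simp) p.1).hasFDerivAt
    -- Differentiating `F (y, g y) = 0` shows that `dF` kills the tangent space of the graph. Hence
    -- `dF` is `d` times the graph form with `d > 0`, and the two define the same oriented unit
    -- normal.
    have hzero : (fderiv ℝ F p).comp ((ContinuousLinearMap.id ℝ (Rn m)).prod (fderiv ℝ g p.1)) = 0 := by
      have h1 : HasFDerivAt (fun y => (y, g y))
          ((ContinuousLinearMap.id ℝ (Rn m)).prod (fderiv ℝ g p.1)) p.1 :=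
        (hasFDerivAt_id p.1).prodMk hgd
      have h2 : HasFDerivAt F (fderiv ℝ F p) (p.1, g p.1) := by
        rw [← hp2]; exact (hFd p (hBO p hx)).differentiableAt.hasFDerivAt
      have h3 := h2.comp p.1 h1
      refine h3.unique ((hasFDerivAt_const (0 : ℝ) p.1).congr_of_eventuallyEq ?_)
      filter_upwards [Metric.isOpen_ball.mem_nhds hx.1] with y hy
      simp only [Function.comp, hχ1 y hy]
      refine (hr'1 y ?_).2.1
      exact Metric.ball_subset_ball (by linarith [min_le_right r r']) hy
    set d := fderiv ℝ F p (0, 1) with hd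
    have hdpos : 0 < d := (hr1 p (by
      rw [← ball_prod_same (x := p₀.1) (y := p₀.2)]; exact ⟨hBr p hx, hx.2⟩)).2
    have key : ∀ w, inner ℝ (∇ ρ x) w = d * graphForm J g p.1 w := by
      intro w
      have e1 : inner ℝ (∇ ρ x) w = fderiv ℝ F p (J.symm w) := by
        rw [(hFd p (hBO p hx)).fderiv]
        simp [gradient, hJp]
      have e2 : J.symm w = ((J.symm w).1, fderiv ℝ g p.1 (J.symm w).1) +
          ((J.symm w).2 - fderiv ℝ g p.1 (J.symm w).1) • ((0 : Rn m), (1 : ℝ)) := by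
        ext <;> simp
      have e3 := congrArg (fun L => L (J.symm w).1) hzero
      simp only [ContinuousLinearMap.comp_apply, ContinuousLinearMap.prod_apply,
        ContinuousLinearMap.id_apply, zero_apply] at e3
      rw [e1, e2, map_add, map_smul, e3, graphForm_apply, smul_eq_mul]; ring
    have hν := exteriorNormal_eq hΩ hρ hxΩ hxU₀
    have hG0 : 0 < ‖∇ ρ x‖ := norm_pos_iff.2 (hρ.gradient_ne_zero x hxU₀)
    have hL : graphForm J g p.1 = (d⁻¹ * ‖∇ ρ x‖) • innerSL ℝ (exteriorNormal Ω x) := by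
      ext w
      simp only [hν, smul_apply, innerSL_apply_apply, smul_eq_mul,
        real_inner_smul_left, key]
      field_simp
    have hν1 : ‖exteriorNormal Ω x‖ = 1 := by
      rw [hν, norm_smul, norm_inv, norm_norm, inv_mul_cancel₀ hG0.ne']
    have hnorm : ‖graphForm J g p.1‖ = d⁻¹ * ‖∇ ρ x‖ := by
      rw [hL, norm_smul, innerSL_apply_norm, hν1, mul_one, Real.norm_of_nonneg (by positivity)]
    rw [hnorm, hL]
    simp

end Chart

/-! ### Calculus up to the boundary -/

section Closure

variable {n : ℕ} {Ω : Set (Rn n)}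

/-- At a boundary point the tangent cone contains the open half space `∇ρ·w < 0`, which spans.
Derivatives within the closure are therefore unique and extend those in `Ω` continuously. -/
theorem uniqueDiffOn_closure (hΩ : IsOpen Ω) (hΩs : HasSmoothBoundary Ω) :
    UniqueDiffOn ℝ (closure Ω) := by
  intro x hx
  by_cases hxΩ : x ∈ Ω
  · exact uniqueDiffWithinAt_of_mem_nhds (mem_of_superset (hΩ.mem_nhds hxΩ) subset_closure)
  have hxf : x ∈ frontier Ω := by rw [hΩ.frontier_eq]; exact ⟨hx, hxΩ⟩
  obtain ⟨U, ρ, hxU, hρ⟩ := hΩs x hxf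
  have hcone : {w | inner ℝ (∇ ρ x) w < 0} ⊆ tangentConeAt ℝ (closure Ω) x := by
    intro w hw
    refine mem_tangentConeAt_of_add_smul_mem (l := 𝓝[>] (0 : ℝ)) (c := id) ?_ ?_
    · exact tendsto_id'.2 (nhdsWithin_mono _ fun t (ht : 0 < t) => ht.ne')
    · exact ((hρ.eventually_mem hΩ hxf hxU w).1 hw).mono fun t ht => subset_closure ht
  refine ⟨?_, subset_closure hx⟩
  have hopen : IsOpen {w | inner ℝ (∇ ρ x) w < 0} :=
    isOpen_lt (by fun_prop) continuous_const
  have : Submodule.span ℝ (tangentConeAt ℝ (closure Ω) x) = ⊤ := by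
    refine Submodule.eq_top_of_nonempty_interior' _ ⟨-∇ ρ x, ?_⟩
    refine (hopen.subset_interior_iff.2 (hcone.trans Submodule.subset_span)) ?_
    simp only [mem_ofPred_eq, inner_neg_right, real_inner_self_eq_norm_sq, Left.neg_neg_iff]
    have := norm_pos_iff.2 (hρ.gradient_ne_zero x hxU)
    positivity
  rw [this]
  exact dense_univ

theorem norm_exteriorNormal (hΩ : IsOpen Ω) (hΩs : HasSmoothBoundary Ω) {x : Rn n}
    (hx : x ∈ frontier Ω) : ‖exteriorNormal Ω x‖ = 1 := by
  obtain ⟨U, ρ, hxU, hρ⟩ := hΩs x hx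
  have := norm_pos_iff.2 (hρ.gradient_ne_zero x hxU)
  rw [exteriorNormal_eq hΩ hρ hx hxU, norm_smul, norm_inv, norm_norm, inv_mul_cancel₀ this.ne']

theorem continuousOn_exteriorNormal (hΩ : IsOpen Ω) (hΩs : HasSmoothBoundary Ω) :
    ContinuousOn (exteriorNormal Ω) (frontier Ω) := by
  intro x hx
  obtain ⟨U, ρ, hxU, hρ⟩ := hΩs x hx
  have h1 : ContinuousAt (fun y => ∇ ρ y) x := by
    have : ContinuousAt (fderiv ℝ ρ) x :=
      (hρ.contDiffOn.contDiffAt (hρ.isOpen.mem_nhds hxU)).continuousAt_fderiv (by simp)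
    exact (InnerProductSpace.toDual ℝ (Rn n)).symm.continuous.continuousAt.comp this
  have h2 : ContinuousAt (fun y => ‖∇ ρ y‖⁻¹ • ∇ ρ y) x :=
    (h1.norm.inv₀ (norm_ne_zero_iff.2 (hρ.gradient_ne_zero x hxU))).smul h1
  refine h2.continuousWithinAt.congr_of_eventuallyEq ?_ (exteriorNormal_eq hΩ hρ hx hxU)
  filter_upwards [self_mem_nhdsWithin, mem_nhdsWithin_of_mem_nhds (hρ.isOpen.mem_nhds hxU)]
    with y hy hyU using exteriorNormal_eq hΩ hρ hy hyU

theorem fderivWithin_closure_eq {F : Type*} [NormedAddCommGroup F] [NormedSpace ℝ F]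
    (hΩ : IsOpen Ω) (f : Rn n → F) {x : Rn n} (hx : x ∈ Ω) :
    fderivWithin ℝ f (closure Ω) x = fderiv ℝ f x :=
  fderivWithin_of_mem_nhds (mem_of_superset (hΩ.mem_nhds hx) subset_closure)

theorem integrableOn_of_continuousOn_closure {F : Type*} [NormedAddCommGroup F]
    (hΩ : IsOpen Ω) (hΩb : Bornology.IsBounded Ω) {f g : Rn n → F}
    (hf : ContinuousOn f (closure Ω)) (hfg : ∀ x ∈ Ω, g x = f x) : IntegrableOn g Ω :=
  ((hf.integrableOn_compact hΩb.isCompact_closure).mono_set subset_closure).congr_fun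
    (fun x hx => (hfg x hx).symm) hΩ.measurableSet

theorem integrableOn_fderiv_apply (hΩ : IsOpen Ω) (hΩb : Bornology.IsBounded Ω)
    (hΩs : HasSmoothBoundary Ω) {f : Rn n → ℝ} (hf : ContDiffOn ℝ 1 f (closure Ω)) (w : Rn n) :
    IntegrableOn (fun x => fderiv ℝ f x w) Ω :=
  integrableOn_of_continuousOn_closure hΩ hΩb
    ((hf.continuousOn_fderivWithin (uniqueDiffOn_closure hΩ hΩs) (by simp)).clm_apply
      (continuousOn_const (c := w)))
    fun x hx => by rw [fderivWithin_closure_eq hΩ f hx]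

theorem integrableOn_fderiv (hΩ : IsOpen Ω) (hΩb : Bornology.IsBounded Ω)
    (hΩs : HasSmoothBoundary Ω) {f : Rn n → ℝ} (hf : ContDiffOn ℝ 1 f (closure Ω)) :
    IntegrableOn (fderiv ℝ f) Ω :=
  integrableOn_of_continuousOn_closure hΩ hΩb
    (hf.continuousOn_fderivWithin (uniqueDiffOn_closure hΩ hΩs) (by simp))
    fun x hx => by rw [fderivWithin_closure_eq hΩ f hx]

end Closure

/-! ### Hausdorff measure under Lipschitz and antilipschitz maps -/

section Hausdorff

open Measure

theorem euclideanHausdorffMeasure_image_le {X Y : Type*} [EMetricSpace X] [MeasurableSpace X]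
    [BorelSpace X] [EMetricSpace Y] [MeasurableSpace Y] [BorelSpace Y] {K : NNReal} {f : X → Y}
    (hf : LipschitzWith K f) (d : ℕ) (s : Set X) :
    euclideanHausdorffMeasure d (f '' s) ≤ (K : ℝ≥0∞) ^ d * euclideanHausdorffMeasure d s := by
  simp only [euclideanHausdorffMeasure_def, Measure.smul_apply, ENNReal.smul_def, smul_eq_mul]
  rw [mul_left_comm]
  gcongr
  simpa using hf.hausdorffMeasure_image_le (d := d) (by positivity) s

theorem le_euclideanHausdorffMeasure_image {X Y : Type*} [EMetricSpace X] [MeasurableSpace X]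
    [BorelSpace X] [EMetricSpace Y] [MeasurableSpace Y] [BorelSpace Y] {K : NNReal} {f : X → Y}
    (hf : AntilipschitzWith K f) (d : ℕ) (s : Set X) :
    euclideanHausdorffMeasure d s ≤ (K : ℝ≥0∞) ^ d * euclideanHausdorffMeasure d (f '' s) := by
  simp only [euclideanHausdorffMeasure_def, Measure.smul_apply, ENNReal.smul_def, smul_eq_mul]
  rw [mul_left_comm]
  gcongr
  simpa using hf.le_hausdorffMeasure_image (d := d) (by positivity) s

end Hausdorff

/-! ### Boundary measures in one chart and their comparison with the surface measure -/

section ChartMeasure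

variable {m n : ℕ}

/-- The parametrization of the graph of `g`. -/
def graphMap (J : (Rn m × ℝ) ≃L[ℝ] Rn n) (g : Rn m → ℝ) (y : Rn m) : Rn n := J (y, g y)

/-- The surface measure of the graph of `g` up to a constant, with the weight `χ`. -/
noncomputable def graphMeasure (J : (Rn m × ℝ) ≃L[ℝ] Rn n) (g : Rn m → ℝ) (χ : Rn n → ℝ) :
    Measure (Rn n) :=
  ((volume : Measure (Rn m)).withDensity
    fun y => ENNReal.ofReal (χ (graphMap J g y) * ‖graphForm J g y‖)).map (graphMap J g)

namespace IsGraphChart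

variable {Ω U : Set (Rn n)} {J : (Rn m × ℝ) ≃L[ℝ] Rn n} {g : Rn m → ℝ}

theorem continuous_graphMap (h : IsGraphChart Ω U J g) : Continuous (graphMap J g) := by
  have := h.contDiff.continuous
  unfold graphMap; fun_prop

theorem continuous_graphForm (h : IsGraphChart Ω U J g) : Continuous (graphForm J g) := by
  have := h.contDiff.continuous_fderiv (by simp)
  unfold graphForm; fun_prop

/-- The base point is recovered from its image as the first component of `J⁻¹`, which is a Lipschitz
map. -/
theorem antilipschitz_graphMap (J : (Rn m × ℝ) ≃L[ℝ] Rn n) (g : Rn m → ℝ) :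
    AntilipschitzWith ‖(J.symm : Rn n →L[ℝ] Rn m × ℝ)‖₊ (graphMap J g) := by
  refine AntilipschitzWith.of_le_mul_dist fun y z => ?_
  have h1 : dist y z ≤ dist (y, g y) (z, g z) := by rw [Prod.dist_eq]; exact le_max_left _ _
  refine h1.trans ?_
  have := (J.symm : Rn n →L[ℝ] Rn m × ℝ).lipschitz.dist_le_mul (graphMap J g y) (graphMap J g z)
  simpa [graphMap] using this

theorem measurableEmbedding_graphMap (h : IsGraphChart Ω U J g) :
    MeasurableEmbedding (graphMap J g) :=
  h.continuous_graphMap.measurableEmbedding (antilipschitz_graphMap J g).injective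

theorem exists_lipschitz_graphMap (h : IsGraphChart Ω U J g) :
    ∃ K, LipschitzWith K (graphMap J g) := by
  obtain ⟨K, hK⟩ := h.contDiff.lipschitzWith_of_hasCompactSupport h.hasCompactSupport (by simp)
  exact ⟨_, J.lipschitz.comp (LipschitzWith.id.prodMk hK)⟩

/-- A point strictly above the graph has a neighbourhood missing `Ω`, and a point on the graph is
approached from below by points of `Ω`. -/
theorem mem_frontier_iff (h : IsGraphChart Ω U J g) (hΩ : IsOpen Ω) {x : Rn n} (hx : x ∈ U) :
    x ∈ frontier Ω ↔ (J.symm x).2 = g (J.symm x).1 := by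
  rw [hΩ.frontier_eq, Set.mem_sdiff, h.mem_iff x hx, not_lt]
  constructor
  · rintro ⟨h1, h2⟩
    refine le_antisymm ?_ h2
    by_contra! h3
    have ho : IsOpen {z : Rn n | g (J.symm z).1 < (J.symm z).2} :=
      isOpen_lt (h.contDiff.continuous.comp (by fun_prop)) (by fun_prop)
    obtain ⟨z, ⟨hz1, hz2⟩, hz3⟩ := mem_closure_iff.1 h1 _ (ho.inter h.isOpen) ⟨h3, hx⟩
    exact lt_asymm hz1 ((h.mem_iff z hz2).1 hz3)
  · intro h1
    refine ⟨?_, h1.ge⟩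
    have hline : ContinuousAt (fun t : ℝ => x + t • J (0, -1)) 0 := by fun_prop
    have hU : ∀ᶠ t in 𝓝[>] (0 : ℝ), x + t • J (0, -1) ∈ U :=
      mem_nhdsWithin_of_mem_nhds (hline.preimage_mem_nhds (by simpa using h.isOpen.mem_nhds hx))
    have ht : Tendsto (fun t : ℝ => x + t • J (0, -1)) (𝓝[>] 0) (𝓝 x) := by
      simpa using hline.tendsto.mono_left nhdsWithin_le_nhds
    refine mem_closure_of_tendsto ht ?_
    filter_upwards [hU, self_mem_nhdsWithin] with t ht ht0
    rw [h.mem_iff _ ht]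
    have ht0 : 0 < t := ht0
    simp [h1, ht0]

theorem graphMap_symm (h : IsGraphChart Ω U J g) (hΩ : IsOpen Ω) {x : Rn n} (hx : x ∈ U)
    (hxf : x ∈ frontier Ω) : graphMap J g (J.symm x).1 = x := by
  rw [graphMap, ← (h.mem_frontier_iff hΩ hx).1 hxf]
  simp

theorem graphMap_mem_frontier (h : IsGraphChart Ω U J g) (hΩ : IsOpen Ω) {y : Rn m}
    (hy : graphMap J g y ∈ U) : graphMap J g y ∈ frontier Ω := by
  rw [h.mem_frontier_iff hΩ hy]; simp [graphMap]

/-- On the base, Hausdorff measure is Lebesgue measure, and the inverse of the parametrization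
increases it at most by a constant factor. -/
theorem volume_preimage_le (h : IsGraphChart Ω U J g) (hΩ : IsOpen Ω) (s : Set (Rn n)) :
    volume (graphMap J g ⁻¹' (s ∩ U)) ≤ (‖(J.symm : Rn n →L[ℝ] Rn m × ℝ)‖₊ : ℝ≥0∞) ^ m *
      Measure.euclideanHausdorffMeasure m (s ∩ frontier Ω) := by
  rw [← EuclideanSpace.euclideanHausdorffMeasure_eq_volume]
  refine (le_euclideanHausdorffMeasure_image (antilipschitz_graphMap J g) m _).trans ?_
  gcongr
  rintro _ ⟨y, hy, rfl⟩
  exact ⟨hy.1, h.graphMap_mem_frontier hΩ hy.2⟩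

variable {χ : Rn n → ℝ}

theorem continuous_density (h : IsGraphChart Ω U J g) (hχ : Continuous χ) :
    Continuous fun y => χ (graphMap J g y) * ‖graphForm J g y‖ :=
  (hχ.comp h.continuous_graphMap).mul h.continuous_graphForm.norm

theorem exists_norm_graphForm_le (h : IsGraphChart Ω U J g) :
    ∃ B : ℝ, 0 ≤ B ∧ (∀ y, ‖fderiv ℝ g y‖ ≤ B) ∧ ∀ y, ‖graphForm J g y‖ ≤ B := by
  obtain ⟨B, hB⟩ := (h.hasCompactSupport.fderiv ℝ).exists_bound_of_continuous
    (h.contDiff.continuous_fderiv (by simp))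
  have hB0 : 0 ≤ B := (norm_nonneg _).trans (hB 0)
  set S := ContinuousLinearMap.snd ℝ (Rn m) ℝ
  set F := ContinuousLinearMap.fst ℝ (Rn m) ℝ
  set I := (J.symm : Rn n →L[ℝ] Rn m × ℝ)
  refine ⟨max B ((‖S‖ + B * ‖F‖) * ‖I‖), hB0.trans (le_max_left _ _),
    fun y => (hB y).trans (le_max_left _ _), fun y => le_trans ?_ (le_max_right _ _)⟩
  refine (ContinuousLinearMap.opNorm_comp_le _ _).trans ?_
  gcongr
  refine (norm_sub_le _ _).trans ?_
  gcongr
  exact (ContinuousLinearMap.opNorm_comp_le _ _).trans (by gcongr; exact hB y)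

/-- The graph form takes the value `1` on the fixed vector `J (0, 1)`, whatever the slope of the
graph. -/
theorem exists_le_norm_graphForm (J : (Rn m × ℝ) ≃L[ℝ] Rn n) (g : Rn m → ℝ) :
    ∃ c : ℝ, 0 < c ∧ ∀ y, c ≤ ‖graphForm J g y‖ := by
  have hJ0 : J (0, 1) ≠ 0 := by simp
  refine ⟨‖J (0, 1)‖⁻¹, inv_pos.2 (norm_pos_iff.2 hJ0), fun y => ?_⟩
  have := (graphForm J g y).le_opNorm (J (0, 1))
  rw [graphForm_apply] at this
  simp only [ContinuousLinearEquiv.symm_apply_apply, map_zero, sub_zero, norm_one] at this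
  rwa [inv_le_iff_one_le_mul₀ (norm_pos_iff.2 hJ0)]

/-- The density is bounded and, since `χ` vanishes off `U`, it charges only points of the graph that
belong to the boundary. -/
theorem graphMeasure_le (h : IsGraphChart Ω U J g) (hΩ : IsOpen Ω) (hχ1 : ∀ x, χ x ≤ 1)
    (hχU : ∀ x ∉ U, χ x = 0) :
    ∃ C : ℝ≥0∞, C ≠ ⊤ ∧ ∀ s, MeasurableSet s →
      graphMeasure J g χ s ≤ C * Measure.euclideanHausdorffMeasure m (s ∩ frontier Ω) := by
  obtain ⟨B, hB0, -, hB⟩ := h.exists_norm_graphForm_le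
  refine ⟨ENNReal.ofReal B * (‖(J.symm : Rn n →L[ℝ] Rn m × ℝ)‖₊ : ℝ≥0∞) ^ m,
    ENNReal.mul_ne_top ENNReal.ofReal_ne_top (ENNReal.pow_ne_top ENNReal.coe_ne_top), fun s hs => ?_⟩
  have hsm : MeasurableSet (graphMap J g ⁻¹' s) := h.continuous_graphMap.measurable hs
  have hUm : MeasurableSet (graphMap J g ⁻¹' U) :=
    h.continuous_graphMap.measurable h.isOpen.measurableSet
  rw [graphMeasure, h.measurableEmbedding_graphMap.map_apply, withDensity_apply _ hsm, mul_assoc]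
  refine le_trans ?_ (mul_le_mul_right (h.volume_preimage_le hΩ s) _)
  calc ∫⁻ y in graphMap J g ⁻¹' s, ENNReal.ofReal (χ (graphMap J g y) * ‖graphForm J g y‖)
      ≤ ∫⁻ y in graphMap J g ⁻¹' s,
          (graphMap J g ⁻¹' U).indicator (fun _ => ENNReal.ofReal B) y := by
        refine lintegral_mono fun y => ?_
        by_cases hy : graphMap J g y ∈ U
        · rw [indicator_of_mem (by exact hy)]
          refine ENNReal.ofReal_le_ofReal ?_
          calc χ (graphMap J g y) * ‖graphForm J g y‖ ≤ 1 * B :=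
                mul_le_mul (hχ1 _) (hB y) (norm_nonneg _) zero_le_one
            _ = B := one_mul B
        · simp [hχU _ hy]
    _ = ENNReal.ofReal B * volume (graphMap J g ⁻¹' (s ∩ U)) := by
        rw [lintegral_indicator_const hUm, Measure.restrict_apply hUm, preimage_inter, inter_comm]

/-- The converse comparison needs a density bounded away from zero, hence the restriction to `t ≤
χ`; such points lie in `U`, so they are covered by the parametrization, which is Lipschitz. -/
theorem le_graphMeasure (h : IsGraphChart Ω U J g) (hΩ : IsOpen Ω) (hχc : Continuous χ)
    (hχU : ∀ x ∉ U, χ x = 0) {t : ℝ} (ht : 0 < t) :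
    ∃ C : ℝ≥0∞, C ≠ ⊤ ∧ ∀ s, MeasurableSet s →
      Measure.euclideanHausdorffMeasure m (s ∩ frontier Ω ∩ {x | t ≤ χ x})
        ≤ C * graphMeasure J g χ s := by
  obtain ⟨K, hK⟩ := h.exists_lipschitz_graphMap
  obtain ⟨c, hc, hcl⟩ := exists_le_norm_graphForm J g
  refine ⟨(K : ℝ≥0∞) ^ m * ENNReal.ofReal ((t * c)⁻¹), ENNReal.mul_ne_top
    (ENNReal.pow_ne_top ENNReal.coe_ne_top) ENNReal.ofReal_ne_top, fun s hs => ?_⟩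
  set A := graphMap J g ⁻¹' (s ∩ {x | t ≤ χ x}) with hA
  have htm : MeasurableSet {x | t ≤ χ x} := (isClosed_le continuous_const hχc).measurableSet
  have hAm : MeasurableSet A := h.continuous_graphMap.measurable (hs.inter htm)
  have hsm : MeasurableSet (graphMap J g ⁻¹' s) := h.continuous_graphMap.measurable hs
  have hsub : s ∩ frontier Ω ∩ {x | t ≤ χ x} ⊆ graphMap J g '' A := by
    rintro x ⟨⟨hx1, hx2⟩, hx3⟩
    have hxU : x ∈ U := by
      by_contra hxU
      have : t ≤ χ x := hx3
      rw [hχU x hxU] at this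
      linarith
    have e := h.graphMap_symm hΩ hxU hx2
    exact ⟨(J.symm x).1, by rw [hA, mem_preimage, e]; exact ⟨hx1, hx3⟩, e⟩
  refine (measure_mono hsub).trans ((euclideanHausdorffMeasure_image_le hK m A).trans ?_)
  rw [EuclideanSpace.euclideanHausdorffMeasure_eq_volume, mul_assoc]
  gcongr
  rw [graphMeasure, h.measurableEmbedding_graphMap.map_apply, withDensity_apply _ hsm]
  have h1 : ENNReal.ofReal (t * c) * volume A ≤
      ∫⁻ y in graphMap J g ⁻¹' s, ENNReal.ofReal (χ (graphMap J g y) * ‖graphForm J g y‖) := by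
    rw [← setLIntegral_const]
    refine (setLIntegral_mono (by
      exact ((h.continuous_density hχc).measurable.ennreal_ofReal)) fun y hy => ?_).trans
      (lintegral_mono_set (preimage_mono inter_subset_left))
    refine ENNReal.ofReal_le_ofReal ?_
    have : t ≤ χ (graphMap J g y) := hy.2
    exact mul_le_mul this (hcl y) hc.le (ht.le.trans this)
  have htc : 0 < t * c := mul_pos ht hc
  calc volume A = ENNReal.ofReal ((t * c)⁻¹) * (ENNReal.ofReal (t * c) * volume A) := by
        rw [← mul_assoc, ← ENNReal.ofReal_mul (by positivity), inv_mul_cancel₀ htc.ne']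
        simp
    _ ≤ _ := by gcongr

theorem isFiniteMeasure_graphMeasure (h : IsGraphChart Ω U J g) (hχ1 : ∀ x, χ x ≤ 1)
    (hχU : ∀ x ∉ U, χ x = 0) : IsFiniteMeasure (graphMeasure J g χ) := by
  obtain ⟨B, hB0, -, hB⟩ := h.exists_norm_graphForm_le
  refine ⟨?_⟩
  have hUm : MeasurableSet (graphMap J g ⁻¹' U) :=
    h.continuous_graphMap.measurable h.isOpen.measurableSet
  have hUb : Bornology.IsBounded (graphMap J g ⁻¹' U) := by
    refine ((LipschitzWith.prod_fst.comp J.symm.lipschitz).isBounded_image h.isBounded).subset ?_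
    intro y hy
    exact ⟨_, hy, by simp [graphMap]⟩
  rw [graphMeasure, h.measurableEmbedding_graphMap.map_apply, preimage_univ,
    withDensity_apply _ MeasurableSet.univ, Measure.restrict_univ]
  calc ∫⁻ y, ENNReal.ofReal (χ (graphMap J g y) * ‖graphForm J g y‖)
      ≤ ∫⁻ y, (graphMap J g ⁻¹' U).indicator (fun _ => ENNReal.ofReal B) y := by
        refine lintegral_mono fun y => ?_
        by_cases hy : graphMap J g y ∈ U
        · rw [indicator_of_mem (by exact hy)]
          refine ENNReal.ofReal_le_ofReal ?_
          calc χ (graphMap J g y) * ‖graphForm J g y‖ ≤ 1 * B :=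
                mul_le_mul (hχ1 _) (hB y) (norm_nonneg _) zero_le_one
            _ = B := one_mul B
        · simp [hχU _ hy]
    _ = ENNReal.ofReal B * volume (graphMap J g ⁻¹' U) := lintegral_indicator_const hUm _
    _ < ⊤ := ENNReal.mul_lt_top ENNReal.ofReal_lt_top hUb.measure_lt_top

/-- On the boundary the graph form is `‖graphForm‖` times pairing with the unit normal. Its norm is
exactly the factor built into `graphMeasure`. -/
theorem integral_fderiv_mul (h : IsGraphChart Ω U J g) (hΩ : IsOpen Ω)
    (hΩb : Bornology.IsBounded Ω) (hΩs : HasSmoothBoundary Ω) (hχ : ContDiff ℝ 1 χ)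
    (hχ0 : ∀ x, 0 ≤ χ x) (hχU : tsupport χ ⊆ U) {f : Rn n → ℝ}
    (hf : ContDiffOn ℝ 1 f (closure Ω)) (w : Rn n) :
    ∫ x in Ω, fderiv ℝ (fun x => χ x * f x) x w =
      ∫ x, f x * inner ℝ (exteriorNormal Ω x) w ∂graphMeasure J g χ := by
  obtain ⟨B, hB0, hB, -⟩ := h.exists_norm_graphForm_le
  have hχf : ContDiffOn ℝ 1 (fun x => χ x * f x) (closure Ω) := hχ.contDiffOn.mul hf
  have hK : IsCompact (tsupport χ) :=
    Metric.isCompact_of_isClosed_isBounded (isClosed_tsupport χ) (h.isBounded.subset hχU)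
  rw [integral_fderiv_graph h.measurePreserving h.contDiff hB hΩ h.mem_iff hK hχU
    (fun x hx => by simp [image_eq_zero_of_notMem_tsupport hx]) hχf.continuousOn
    (hχf.mono subset_closure) (integrableOn_fderiv hΩ hΩb hΩs hχf) h.isOpen w, graphMeasure,
    h.measurableEmbedding_graphMap.integral_map, integral_withDensity_eq_integral_toReal_smul
      (h.continuous_density hχ.continuous).measurable.ennreal_ofReal (by simp)]
  congr 1; ext y
  rw [ENNReal.toReal_ofReal (mul_nonneg (hχ0 _) (norm_nonneg _)), smul_eq_mul]
  change χ (graphMap J g y) * f (graphMap J g y) * _ = _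
  by_cases hy : graphMap J g y ∈ U
  · have := h.graphForm_eq _ hy (h.graphMap_mem_frontier hΩ hy) w
    simp only [graphMap, ContinuousLinearEquiv.symm_apply_apply] at this ⊢
    rw [this]; ring
  · have : χ (graphMap J g y) = 0 := image_eq_zero_of_notMem_tsupport fun h' => hy (hχU h')
    simp [this]

end IsGraphChart

end ChartMeasure

/-! ### A global boundary measure for the divergence theorem -/

section BoundaryMeasure

variable {m n : ℕ}

theorem integral_fderiv_eq_zero {f : Rn n → ℝ} (hf : ContDiff ℝ 1 f) (hc : HasCompactSupport f)
    (w : Rn n) : ∫ x, fderiv ℝ f x w = 0 := by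
  have hd := (hf.continuous_fderiv (by simp)).clm_apply (continuous_const (y := w))
  have := integral_mul_fderiv_eq_neg_fderiv_mul_of_integrable (μ := (volume : Measure (Rn n)))
    (f := fun _ => (1 : ℝ)) (g := f) (v := w) (by simp)
    (by simpa using hd.integrable_of_hasCompactSupport (hc.fderiv_apply (𝕜 := ℝ) w))
    (by simpa using hf.continuous.integrable_of_hasCompactSupport hc)
    (by simp) (fun y _ => (hf.differentiable (by simp)) y)
  simpa using this

/-- Such a function vanishes near every point outside its support, so it is `C¹` with compact
support on the whole space. -/
theorem setIntegral_fderiv_eq_zero {Ω : Set (Rn n)} (hΩ : IsOpen Ω) (hΩb : Bornology.IsBounded Ω)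
    {f : Rn n → ℝ} (hf : ContDiffOn ℝ 1 f Ω) (hc : tsupport f ⊆ Ω) (w : Rn n) :
    ∫ x in Ω, fderiv ℝ f x w = 0 := by
  have hcd : ContDiff ℝ 1 f := by
    rw [contDiff_iff_contDiffAt]
    intro x
    by_cases hx : x ∈ tsupport f
    · exact hf.contDiffAt (hΩ.mem_nhds (hc hx))
    · exact (contDiffAt_const (c := (0 : ℝ))).congr_of_eventuallyEq
        (notMem_tsupport_iff_eventuallyEq.1 hx)
  have hcs : HasCompactSupport f :=
    Metric.isCompact_of_isClosed_isBounded (isClosed_tsupport f) (hΩb.subset hc)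
  rw [setIntegral_eq_integral_of_forall_compl_eq_zero, integral_fderiv_eq_zero hcd hcs]
  intro x hx
  have : fderiv ℝ f x = 0 := by
    by_contra h
    exact hx (hc (support_fderiv_subset ℝ h))
  simp [this]

/-- A finite smooth partition of unity on `closure Ω`, subordinate to `Ω` and a finite family of
open sets covering the boundary. -/
theorem exists_smooth_partition {ι : Type} [Fintype ι] {Ω : Set (Rn n)} (hΩ : IsOpen Ω)
    {U : ι → Set (Rn n)} (hU : ∀ i, IsOpen (U i)) (hcov : frontier Ω ⊆ ⋃ i, U i) :
    ∃ χ : Option ι → Rn n → ℝ, (∀ i, ContDiff ℝ ∞ (χ i)) ∧ (∀ i x, 0 ≤ χ i x) ∧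
      (∀ i x, χ i x ≤ 1) ∧ tsupport (χ none) ⊆ Ω ∧ (∀ i, tsupport (χ (some i)) ⊆ U i) ∧
      ∀ x ∈ closure Ω, ∑ i, χ i x = 1 := by
  have hcov' : closure Ω ⊆ ⋃ i : Option ι, Option.elim i Ω U := by
    intro x hx
    by_cases hxΩ : x ∈ Ω
    · exact mem_iUnion.2 ⟨none, hxΩ⟩
    · have : x ∈ frontier Ω := by rw [hΩ.frontier_eq]; exact ⟨hx, hxΩ⟩
      obtain ⟨i, hi⟩ := mem_iUnion.1 (hcov this)
      exact mem_iUnion.2 ⟨some i, hi⟩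
  have ho : ∀ i : Option ι, IsOpen (Option.elim i Ω U) := by
    rintro (_ | i)
    · exact hΩ
    · exact hU i
  obtain ⟨f, hf⟩ := SmoothPartitionOfUnity.exists_isSubordinate (modelWithCornersSelf ℝ (Rn n))
    isClosed_closure _ ho hcov'
  refine ⟨fun i => f i, fun i => (f i).contMDiff.contDiff, fun i x => f.nonneg i x,
    fun i x => f.le_one i x, hf none, fun i => hf (some i), fun x hx => ?_⟩
  rw [← finsum_eq_sum_of_fintype]
  exact f.sum_eq_one hx

/-- In a chart the part of `V` on the boundary has a nonempty open set of base points. Its positive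
volume is at most a constant times the surface measure. -/
theorem surfaceMeasure_pos {Ω : Set (Rn (m + 1))} (hΩ : IsOpen Ω) (hΩs : HasSmoothBoundary Ω)
    {x : Rn (m + 1)} (hx : x ∈ frontier Ω) {V : Set (Rn (m + 1))} (hV : IsOpen V) (hxV : x ∈ V) :
    0 < surfaceMeasure Ω V := by
  obtain ⟨U, J, g, hxU, h⟩ := exists_isGraphChart hΩ hΩs hx
  have h1 := h.volume_preimage_le hΩ V
  have hopen : IsOpen (graphMap J g ⁻¹' (V ∩ U)) := (hV.inter h.isOpen).preimage h.continuous_graphMap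
  have hpos : 0 < volume (graphMap J g ⁻¹' (V ∩ U)) := by
    refine hopen.measure_pos _ ⟨(J.symm x).1, ?_⟩
    rw [mem_preimage, h.graphMap_symm hΩ hxU hx]
    exact ⟨hxV, hxU⟩
  rw [surfaceMeasure, Measure.restrict_apply hV.measurableSet, Nat.add_sub_cancel]
  by_contra h0
  rw [nonpos_iff_eq_zero.1 (not_lt.1 h0), mul_zero] at h1
  exact absurd hpos (not_lt.2 h1)

theorem continuousOn_integrable_of_frontier {Ω : Set (Rn n)} (hΩb : Bornology.IsBounded Ω)
    {σ : Measure (Rn n)} [IsFiniteMeasure σ] (hσ : σ (frontier Ω)ᶜ = 0) {f : Rn n → ℝ}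
    (hf : ContinuousOn f (frontier Ω)) : Integrable f σ := by
  have : IntegrableOn f (frontier Ω) σ := hf.integrableOn_compact
    (Metric.isCompact_of_isClosed_isBounded isClosed_frontier
      (hΩb.closure.subset frontier_subset_closure))
  rw [IntegrableOn, Measure.restrict_eq_self_of_ae_mem] at this
  · exact this
  · exact hσ

/-- The divergence theorem on a bounded smooth domain, for a measure on the boundary which is
comparable to the surface measure. -/
theorem exists_boundaryMeasure {Ω : Set (Rn (m + 1))} (hΩ : IsOpen Ω)
    (hΩb : Bornology.IsBounded Ω) (hΩs : HasSmoothBoundary Ω) :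
    ∃ σ : Measure (Rn (m + 1)), IsFiniteMeasure σ ∧ ∃ C : ℝ≥0∞, C ≠ ⊤ ∧
      σ ≤ C • surfaceMeasure Ω ∧ surfaceMeasure Ω ≤ C • σ ∧
      ∀ f : Rn (m + 1) → ℝ, ContDiffOn ℝ 1 f (closure Ω) → ∀ w,
        ∫ x in Ω, fderiv ℝ f x w = ∫ x, f x * inner ℝ (exteriorNormal Ω x) w ∂σ := by
  have hcpt : IsCompact (frontier Ω) := Metric.isCompact_of_isClosed_isBounded isClosed_frontier
    (hΩb.closure.subset frontier_subset_closure)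
  choose U J g hxU hch using fun x : frontier Ω => exists_isGraphChart hΩ hΩs x.2
  obtain ⟨t, ht⟩ := hcpt.elim_nhds_subcover' (fun x hx => U ⟨x, hx⟩)
    (fun x hx => (hch ⟨x, hx⟩).isOpen.mem_nhds (hxU ⟨x, hx⟩))
  have htch : ∀ i : t, IsGraphChart Ω (U i) (J i) (g i) := fun i => hch i
  obtain ⟨N, ⟨e⟩⟩ : ∃ N, Nonempty (t ≃ Fin N) := ⟨_, ⟨Fintype.equivFin t⟩⟩
  obtain ⟨χ, hχs, hχ0, hχ1, hχn, hχU, hsum⟩ := exists_smooth_partition (ι := Fin N) hΩ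
    (U := fun k => U (e.symm k)) (fun k => (htch _).isOpen) (by
      intro x hx
      obtain ⟨i, hi, hxi⟩ := mem_iUnion₂.1 (ht hx)
      exact mem_iUnion.2 ⟨e ⟨i, hi⟩, by simpa using hxi⟩)
  have hch' : ∀ k : Fin N, IsGraphChart Ω (U (e.symm k)) (J (e.symm k)) (g (e.symm k)) :=
    fun k => htch _
  have hχU0 : ∀ k : Fin N, ∀ x ∉ U (e.symm k), χ (some k) x = 0 := fun k x hx =>
    image_eq_zero_of_notMem_tsupport fun h => hx (hχU k h)
  set μ : Fin N → Measure (Rn (m + 1)) := fun k =>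
    graphMeasure (J (e.symm k)) (g (e.symm k)) (χ (some k)) with hμ
  have hμf : ∀ k, IsFiniteMeasure (μ k) := fun k =>
    (hch' k).isFiniteMeasure_graphMeasure (hχ1 _) (hχU0 k)
  choose C₁ hC₁ hle₁ using fun k => (hch' k).graphMeasure_le hΩ (hχ1 (some k)) (hχU0 k)
  -- On the boundary the interior cutoff is zero and the other `N` sum to `1`, so at each point one
  -- of them is at least `1/(N+1)`: otherwise the sum would be at most `N/(N+1) < 1`.
  have hN : (0 : ℝ) < 1 / (N + 1) := by positivity
  choose C₂ hC₂ hle₂ using fun k =>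
    (hch' k).le_graphMeasure hΩ (hχs (some k)).continuous (hχU0 k) hN
  set D := ∑ k, (C₁ k + C₂ k) with hD
  have hsurf : ∀ s, MeasurableSet s → surfaceMeasure Ω s
      = Measure.euclideanHausdorffMeasure m (s ∩ frontier Ω) := fun s hs => by
    rw [surfaceMeasure, Measure.restrict_apply hs, Nat.add_sub_cancel]
  have hσ1 : ∑ k, μ k ≤ (∑ k, C₁ k) • surfaceMeasure Ω := by
    refine Measure.le_iff.2 fun s hs => ?_
    rw [Measure.finsetSum_apply, Measure.smul_apply, smul_eq_mul, Finset.sum_mul]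
    refine Finset.sum_le_sum fun k _ => ?_
    rw [hsurf s hs]
    exact hle₁ k s hs
  have hσ2 : surfaceMeasure Ω ≤ (∑ k, C₂ k) • ∑ k, μ k := by
    refine Measure.le_iff.2 fun s hs => ?_
    rw [hsurf s hs, Measure.smul_apply, smul_eq_mul, Finset.sum_mul]
    have hsub : s ∩ frontier Ω ⊆ ⋃ k ∈ (Finset.univ : Finset (Fin N)),
        s ∩ frontier Ω ∩ {x | 1 / ((N : ℝ) + 1) ≤ χ (some k) x} := by
      rintro x ⟨hxs, hx⟩
      by_contra hcon
      simp only [Finset.mem_univ, iUnion_true, mem_iUnion, mem_inter_iff, not_exists, hxs, hx,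
        true_and, mem_ofPred_eq, not_le] at hcon
      have h1 := hsum x (frontier_subset_closure hx)
      have h0 : χ none x = 0 := image_eq_zero_of_notMem_tsupport fun h => by
        rw [hΩ.frontier_eq] at hx; exact hx.2 (hχn h)
      rw [Fintype.sum_option, h0, zero_add] at h1
      have h2 : ∑ k : Fin N, χ (some k) x ≤ ∑ k : Fin N, 1 / ((N : ℝ) + 1) :=
        Finset.sum_le_sum fun k _ => (hcon k).le
      rw [Finset.sum_const, Finset.card_univ, Fintype.card_fin, nsmul_eq_mul, h1,
        mul_one_div, le_div_iff₀ (by positivity)] at h2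
      linarith
    refine (measure_mono hsub).trans ((measure_biUnion_finset_le _ _).trans ?_)
    refine Finset.sum_le_sum fun k _ => (hle₂ k s hs).trans ?_
    refine mul_le_mul_right ?_ _
    rw [Measure.finsetSum_apply]
    exact Finset.single_le_sum (f := fun k => μ k s) (fun _ _ => zero_le) (Finset.mem_univ k)
  refine ⟨∑ k, μ k, inferInstance, D, ?_, hσ1.trans ?_, hσ2.trans ?_, ?_⟩
  · exact ENNReal.sum_ne_top.2 fun k _ => ENNReal.add_ne_top.2 ⟨hC₁ k, hC₂ k⟩
  · refine Measure.le_iff.2 fun s hs => ?_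
    simp only [Measure.smul_apply, smul_eq_mul]
    gcongr
    rw [hD, Finset.sum_add_distrib]; exact le_self_add
  · refine Measure.le_iff.2 fun s hs => ?_
    simp only [Measure.smul_apply, smul_eq_mul]
    gcongr
    rw [hD, Finset.sum_add_distrib]; exact le_add_self
  intro f hf w
  have hχ1' : ∀ i, ContDiff ℝ 1 (χ i) := fun i => (hχs i).of_le (by exact_mod_cast le_top)
  have hprod : ∀ i, ContDiffOn ℝ 1 (fun x => χ i x * f x) (closure Ω) := fun i =>
    (hχ1' i).contDiffOn.mul hf
  have hfsum : ∀ x ∈ Ω, fderiv ℝ f x w = ∑ i, fderiv ℝ (fun x => χ i x * f x) x w := by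
    intro x hx
    have h1 : f =ᶠ[𝓝 x] fun x => ∑ i, χ i x * f x := by
      filter_upwards [hΩ.mem_nhds hx] with y hy
      rw [← Finset.sum_mul, hsum y (subset_closure hy), one_mul]
    rw [h1.fderiv_eq, fderiv_fun_sum, _root_.sum_apply]
    intro i _
    exact ((hprod i).contDiffAt (mem_of_superset (hΩ.mem_nhds hx)
      subset_closure)).differentiableAt (by simp)
  rw [setIntegral_congr_fun hΩ.measurableSet hfsum,
    integral_finsetSum _ fun i _ => integrableOn_fderiv_apply hΩ hΩb hΩs (hprod i) w,
    Fintype.sum_option]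
  -- The interior piece is compactly supported in `Ω` and contributes nothing; each other piece
  -- gives the boundary integral of its own chart.
  rw [setIntegral_fderiv_eq_zero hΩ hΩb ((hprod none).mono subset_closure)
    ((tsupport_mul_subset_left).trans hχn), zero_add, integral_finsetSum_measure]
  · refine Finset.sum_congr rfl fun k _ => ?_
    exact (hch' k).integral_fderiv_mul hΩ hΩb hΩs (hχ1' _) (hχ0 _) (hχU k) hf w
  · intro k _
    refine continuousOn_integrable_of_frontier hΩb ?_ ?_
    · have h1 : μ k (frontier Ω)ᶜ ≤ C₁ k * _ := hle₁ k _ isClosed_frontier.measurableSet.compl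
      simpa using h1
    · exact (hf.continuousOn.mono frontier_subset_closure).mul
        ((continuousOn_exteriorNormal hΩ hΩs).inner continuousOn_const)

end BoundaryMeasure

/-! ### Zero boundary values of smooth functions in `H¹₀` -/

section Trace

variable {m n : ℕ}

theorem tendsto_integral_mul_of_L2 {α : Type*} [MeasurableSpace α] {μ : Measure α}
    {f : α → ℝ} {F : ℕ → α → ℝ} {η : α → ℝ} (hη : MemLp η 2 μ) (hf : MemLp f 2 μ)
    (hF : ∀ k, MemLp (F k) 2 μ) (h : Tendsto (fun k => eLpNorm (F k - f) 2 μ) atTop (𝓝 0)) :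
    Tendsto (fun k => ∫ x, η x * F k x ∂μ) atTop (𝓝 (∫ x, η x * f x ∂μ)) := by
  refine tendsto_integral_of_L1' _ (hη.1.mul hf.1)
    (Eventually.of_forall fun k => hη.integrable_mul (hF k)) ?_
  have h1 : Tendsto (fun k => eLpNorm η 2 μ * eLpNorm (F k - f) 2 μ) atTop (𝓝 0) := by
    simpa using ENNReal.Tendsto.const_mul h (Or.inr hη.2.ne)
  refine tendsto_of_tendsto_of_tendsto_of_le_of_le tendsto_const_nhds h1 (fun _ => zero_le) fun k => ?_
  have e : (fun x => η x * F k x) - (fun x => η x * f x) = η • (F k - f) := by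
    ext x; simp [mul_sub]
  change eLpNorm ((fun x => η x * F k x) - (fun x => η x * f x)) 1 μ ≤ _
  rw [e]
  exact eLpNorm_smul_le_mul_eLpNorm (r := 1) ((hF k).sub hf).1 hη.1

theorem memLp_of_continuousOn_closure {F : Type*} [NormedAddCommGroup F] {Ω : Set (Rn n)}
    (hΩ : IsOpen Ω) (hΩb : Bornology.IsBounded Ω) {f g : Rn n → F} (hf : ContinuousOn f (closure Ω))
    (hfg : ∀ x ∈ Ω, g x = f x) : MemLp g 2 (volume.restrict Ω) := by
  have := isFiniteMeasure_restrict (μ := volume).2 hΩb.measure_lt_top.ne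
  obtain ⟨C, hC⟩ := hΩb.isCompact_closure.exists_bound_of_continuousOn hf
  refine MemLp.of_bound (C := C) (integrableOn_of_continuousOn_closure hΩ hΩb hf hfg).1 ?_
  filter_upwards [ae_restrict_mem hΩ.measurableSet] with x hx
  rw [hfg x hx]
  exact hC x (subset_closure hx)

/-- A real function in `C¹(closure Ω)` which is an `H¹` limit of test functions vanishes on the
boundary. -/
theorem eq_zero_on_frontier_of_tendsto {Ω : Set (Rn (m + 1))} (hΩ : IsOpen Ω)
    (hΩb : Bornology.IsBounded Ω) (hΩs : HasSmoothBoundary Ω) {u : Rn (m + 1) → ℝ}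
    (hu : ContDiffOn ℝ 1 u (closure Ω)) {w : ℕ → Rn (m + 1) → ℝ}
    (hw : ∀ k, ContDiff ℝ 1 (w k) ∧ tsupport (w k) ⊆ Ω)
    (hwu : Tendsto (fun k => eLpNorm (w k - u) 2 (volume.restrict Ω)) atTop (𝓝 0))
    (hwg : ∀ j : Fin (m + 1), ∃ g : Rn (m + 1) → ℝ, MemLp g 2 (volume.restrict Ω) ∧
      Tendsto (fun k => eLpNorm ((fun x => fderiv ℝ (w k) x (EuclideanSpace.single j 1)) - g) 2
        (volume.restrict Ω)) atTop (𝓝 0)) :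
    ∀ x ∈ frontier Ω, u x = 0 := by
  obtain ⟨σ, hσf, C, hC, hσ1, hσ2, hdiv⟩ := exists_boundaryMeasure hΩ hΩb hΩs
  have hUD := uniqueDiffOn_closure hΩ hΩs
  set e : Fin (m + 1) → Rn (m + 1) := fun j => EuclideanSpace.single j 1 with he
  have hmemu : MemLp u 2 (volume.restrict Ω) :=
    memLp_of_continuousOn_closure hΩ hΩb hu.continuousOn fun _ _ => rfl
  have hmemdu : ∀ v, MemLp (fun x => fderiv ℝ u x v) 2 (volume.restrict Ω) := fun v =>
    memLp_of_continuousOn_closure hΩ hΩb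
      ((hu.continuousOn_fderivWithin hUD (by simp)).clm_apply (continuousOn_const (c := v)))
      fun x hx => by rw [fderivWithin_closure_eq hΩ u hx]
  have hmemc : ∀ η : Rn (m + 1) → ℝ, Continuous η → MemLp η 2 (volume.restrict Ω) := fun η hη =>
    memLp_of_continuousOn_closure hΩ hΩb hη.continuousOn fun _ _ => rfl
  -- the product rule
  have hprod : ∀ (η f : Rn (m + 1) → ℝ), ContDiff ℝ 1 η → ContDiffOn ℝ 1 f (closure Ω) → ∀ v,
      ∫ x in Ω, fderiv ℝ (fun x => η x * f x) x v =
        (∫ x in Ω, η x * fderiv ℝ f x v) + ∫ x in Ω, fderiv ℝ η x v * f x := by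
    intro η f hη hf v
    rw [← integral_add]
    · refine setIntegral_congr_fun hΩ.measurableSet fun x hx => ?_
      have hfx : DifferentiableAt ℝ f x := (hf.contDiffAt (mem_of_superset (hΩ.mem_nhds hx)
        subset_closure)).differentiableAt (by simp)
      rw [fderiv_fun_mul (hη.differentiable (by simp) x) hfx]
      simp [mul_comm]
    · refine integrableOn_of_continuousOn_closure hΩ hΩb (hη.continuous.continuousOn.mul
        ((hf.continuousOn_fderivWithin hUD (by simp)).clm_apply (continuousOn_const (c := v))))
        fun x hx => by simp only [Pi.mul_apply, fderivWithin_closure_eq hΩ f hx]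
    · exact integrableOn_of_continuousOn_closure hΩ hΩb
        (((hη.continuous_fderiv (by simp)).clm_apply
          (continuous_const (y := v))).continuousOn.mul hf.continuousOn) fun _ _ => rfl
  -- integration by parts against the weak derivative
  have weak : ∀ j, ∃ g : Rn (m + 1) → ℝ, MemLp g 2 (volume.restrict Ω) ∧
      ∀ η : Rn (m + 1) → ℝ, ContDiff ℝ 1 η →
        (∫ x in Ω, η x * g x) + ∫ x in Ω, fderiv ℝ η x (e j) * u x = 0 := by
    intro j
    obtain ⟨g, hg, hgt⟩ := hwg j
    refine ⟨g, hg, fun η hη => ?_⟩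
    have hηd : Continuous fun x => fderiv ℝ η x (e j) :=
      (hη.continuous_fderiv (by simp)).clm_apply continuous_const
    have t1 := tendsto_integral_mul_of_L2 (hmemc η hη.continuous) hg
      (fun k => hmemc _ (((hw k).1.continuous_fderiv (by simp)).clm_apply continuous_const)) hgt
    have t2 := tendsto_integral_mul_of_L2 (hmemc _ hηd) hmemu
      (fun k => hmemc _ (hw k).1.continuous) hwu
    refine tendsto_nhds_unique (t1.add t2) (tendsto_const_nhds.congr fun k => ?_)
    rw [← hprod η (w k) hη (hw k).1.contDiffOn (e j), setIntegral_fderiv_eq_zero hΩ hΩb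
      (hη.mul (hw k).1).contDiffOn (tsupport_mul_subset_right.trans (hw k).2)]
  -- The approximants have no boundary term, so the limit has none either, even against test
  -- functions `η` that do not vanish on the boundary.
  have hae : ∀ j, ∀ η : Rn (m + 1) → ℝ, ContDiff ℝ 1 η →
      ∫ x in Ω, fderiv ℝ (fun x => η x * u x) x (e j) = 0 := by
    intro j η hη
    obtain ⟨g, hg, hgη⟩ := weak j
    -- Test functions supported in `Ω` identify the weak derivative `g` with the classical one.
    have hgu : ∀ᵐ x ∂(volume.restrict Ω), g x - fderiv ℝ u x (e j) = 0 := by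
      rw [ae_restrict_iff' hΩ.measurableSet]
      have hfin := isFiniteMeasure_restrict (μ := volume).2 hΩb.measure_lt_top.ne
      have hint : IntegrableOn (fun x => g x - fderiv ℝ u x (e j)) Ω :=
        (hg.sub (hmemdu (e j))).integrable (by norm_num)
      refine hΩ.ae_eq_zero_of_integral_contDiff_smul_eq_zero hint.locallyIntegrableOn ?_
      intro θ hθ hθc hθΩ
      have hθ1 : ContDiff ℝ 1 θ := hθ.of_le (by exact_mod_cast le_top)
      have h1 := hgη θ hθ1
      have h2 := hprod θ u hθ1 hu (e j)
      rw [setIntegral_fderiv_eq_zero hΩ hΩb ((hθ1.contDiffOn.mul hu).mono subset_closure)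
        (tsupport_mul_subset_left.trans hθΩ)] at h2
      rw [← setIntegral_eq_integral_of_forall_compl_eq_zero (s := Ω) fun x hx => by
        simp [image_eq_zero_of_notMem_tsupport fun h => hx (hθΩ h)]]
      simp only [smul_eq_mul, mul_sub]
      have h3 := integral_sub ((hmemc θ hθ1.continuous).integrable_mul hg)
        ((hmemc θ hθ1.continuous).integrable_mul (hmemdu (e j)))
      simp only [Pi.mul_apply] at h3
      linarith
    rw [hprod η u hη hu, ← hgη η hη]
    congr 1
    refine integral_congr_ae ?_
    filter_upwards [hgu] with x hx
    rw [sub_eq_zero.1 hx]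
  have hσc : σ (frontier Ω)ᶜ = 0 := by
    have : surfaceMeasure Ω (frontier Ω)ᶜ = 0 := by
      rw [surfaceMeasure, Measure.restrict_apply isClosed_frontier.measurableSet.compl]
      simp
    have h2 := hσ1 (frontier Ω)ᶜ
    simpa [this] using h2
  have hcν := continuousOn_exteriorNormal hΩ hΩs
  have hcont : ∀ j, ContinuousOn (fun x => u x * inner ℝ (exteriorNormal Ω x) (e j)) (frontier Ω) :=
    fun j => (hu.continuousOn.mono frontier_subset_closure).mul (hcν.inner continuousOn_const)
  -- The divergence theorem turns the previous identity into `∫ η u ν_j dσ = 0` for all test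
  -- functions `η`.
  have hzero : ∀ j, ∀ᵐ x ∂σ, u x * inner ℝ (exteriorNormal Ω x) (e j) = 0 := by
    intro j
    refine ae_eq_zero_of_integral_contDiff_smul_eq_zero
      (continuousOn_integrable_of_frontier hΩb hσc (hcont j)).locallyIntegrable fun η hη hηc => ?_
    have hη1 : ContDiff ℝ 1 η := hη.of_le (by exact_mod_cast le_top)
    have := hdiv _ (hη1.contDiffOn.mul hu) (e j)
    rw [hae j η hη1] at this
    rw [this]
    congr 1; ext x; simp [mul_assoc]
  intro x hx
  -- Some component of the unit normal is nonzero, so `u ν_j ≠ 0` on a relatively open piece of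
  -- boundary. That piece is `σ`-null but has positive surface measure.
  by_contra hux
  have hν : exteriorNormal Ω x ≠ 0 := norm_ne_zero_iff.1 (by rw [norm_exteriorNormal hΩ hΩs hx]; simp)
  obtain ⟨j, hj⟩ : ∃ j, inner ℝ (exteriorNormal Ω x) (e j) ≠ 0 := by
    by_contra! h
    refine hν ?_
    ext j
    simpa [he, EuclideanSpace.inner_single_right] using h j
  have hev : ∀ᶠ y in 𝓝[frontier Ω] x, u y * inner ℝ (exteriorNormal Ω y) (e j) ≠ 0 :=
    (hcont j x hx).eventually_ne (mul_ne_zero hux hj)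
  obtain ⟨V, hV, hxV, hVs⟩ := mem_nhdsWithin.1 hev
  have hpos := surfaceMeasure_pos hΩ hΩs hx hV hxV
  have hσV : σ V = 0 := by
    refine measure_mono_null (t := {y | ¬ u y * inner ℝ (exteriorNormal Ω y) (e j) = 0} ∪
      (frontier Ω)ᶜ) ?_ (measure_union_null (hzero j) hσc)
    intro y hy
    by_cases hyf : y ∈ frontier Ω
    · exact Or.inl (hVs ⟨hy, hyf⟩)
    · exact Or.inr hyf
  have := hσ2 V
  rw [Measure.smul_apply, hσV, smul_zero] at this
  exact absurd hpos (not_lt.2 this)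

/-- Real and imaginary part are norm-decreasing linear maps, so they carry the approximating
sequence to real ones. -/
theorem MemH10.eq_zero_on_frontier {Ω : Set (Rn (m + 1))} (hΩ : IsOpen Ω)
    (hΩb : Bornology.IsBounded Ω) (hΩs : HasSmoothBoundary Ω) {u : Rn (m + 1) → ℂ}
    (hu : ContDiffOn ℝ ∞ u (closure Ω)) (hu0 : MemH10 Ω u) : ∀ x ∈ frontier Ω, u x = 0 := by
  obtain ⟨hum, g, hg, w, hw, hwu, hwg⟩ := hu0
  have key : ∀ ℓ : ℂ →L[ℝ] ℝ, (∀ z, ‖ℓ z‖ ≤ ‖z‖) → ∀ x ∈ frontier Ω, ℓ (u x) = 0 := by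
    intro ℓ hℓ
    have hsq : ∀ F : ℕ → Rn (m + 1) → ℂ,
        Tendsto (fun k => eLpNorm (F k) 2 (volume.restrict Ω)) atTop (𝓝 0) →
        Tendsto (fun k => eLpNorm (fun x => ℓ (F k x)) 2 (volume.restrict Ω)) atTop (𝓝 0) :=
      fun F hF => tendsto_of_tendsto_of_tendsto_of_le_of_le tendsto_const_nhds hF
        (fun _ => zero_le) fun k => eLpNorm_mono fun x => hℓ _
    have h1le : (1 : WithTop ℕ∞) ≤ ((⊤ : ℕ∞) : WithTop ℕ∞) := by exact_mod_cast le_top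
    refine eq_zero_on_frontier_of_tendsto hΩ hΩb hΩs (u := fun x => ℓ (u x))
      (w := fun k x => ℓ (w k x)) (ℓ.contDiff.comp_contDiffOn (hu.of_le h1le))
      (fun k => ⟨ℓ.contDiff.comp ((hw k).1.of_le h1le), ?_⟩) ?_ fun j =>
        ⟨fun x => ℓ (g j x), ?_, ?_⟩
    · exact (tsupport_comp_subset (map_zero ℓ) _).trans (hw k).2.2
    · have := hsq _ hwu
      simpa [Pi.sub_def] using this
    · exact ℓ.comp_memLp' (hg j)
    · have := hsq _ (hwg j)
      convert this using 3 with k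
      ext x
      have hd : HasFDerivAt (w k) (fderiv ℝ (w k) x) x :=
        ((hw k).1.differentiable (by simp) x).hasFDerivAt
      have : fderiv ℝ (fun x => ℓ (w k x)) x = ℓ.comp (fderiv ℝ (w k) x) :=
        (ℓ.hasFDerivAt.comp x hd).fderiv
      simp [this, pderiv]
  intro x hx
  exact Complex.ext (key Complex.reCLM (fun z => Complex.abs_re_le_norm z) x hx)
    (key Complex.imCLM (fun z => Complex.abs_im_le_norm z) x hx)

/-- The gradient of a function vanishing on the boundary is normal to the boundary. -/
theorem fderivWithin_closure_apply_of_eq_zero {F : Type*} [NormedAddCommGroup F] [NormedSpace ℝ F]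
    {Ω : Set (Rn (m + 1))} (hΩ : IsOpen Ω) (hΩs : HasSmoothBoundary Ω) {u : Rn (m + 1) → F}
    (hu : DifferentiableOn ℝ u (closure Ω)) (hu0 : ∀ x ∈ frontier Ω, u x = 0) {x : Rn (m + 1)}
    (hx : x ∈ frontier Ω) (w : Rn (m + 1)) :
    fderivWithin ℝ u (closure Ω) x w =
      inner ℝ (exteriorNormal Ω x) w • fderivWithin ℝ u (closure Ω) x (exteriorNormal Ω x) := by
  obtain ⟨U, J, g, hxU, h⟩ := exists_isGraphChart hΩ hΩs hx
  set y := (J.symm x).1 with hy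
  have hγy : graphMap J g y = x := h.graphMap_symm hΩ hxU hx
  set L := fderivWithin ℝ u (closure Ω) x with hL
  have hgd : HasFDerivAt g (fderiv ℝ g y) y := (h.contDiff.differentiable (by simp) y).hasFDerivAt
  have hγ : HasFDerivAt (graphMap J g) ((J : Rn m × ℝ →L[ℝ] Rn (m + 1)).comp
      ((ContinuousLinearMap.id ℝ (Rn m)).prod (fderiv ℝ g y))) y :=
    J.hasFDerivAt.comp y ((hasFDerivAt_id y).prodMk hgd)
  have hev : ∀ᶠ z in 𝓝 y, graphMap J g z ∈ U :=
    h.continuous_graphMap.continuousAt.preimage_mem_nhds (by rw [hγy]; exact h.isOpen.mem_nhds hxU)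
  have hud : HasFDerivWithinAt u L (frontier Ω) (graphMap J g y) := by
    rw [hγy]
    exact (hu x (frontier_subset_closure hx)).hasFDerivWithinAt.mono frontier_subset_closure
  have hcomp := hud.comp_of_tendsto (s := {z | graphMap J g z ∈ U}) y (hγ.hasFDerivWithinAt)
    (tendsto_nhdsWithin_iff.2 ⟨h.continuous_graphMap.continuousAt.continuousWithinAt,
      by filter_upwards [self_mem_nhdsWithin] with z hz using h.graphMap_mem_frontier hΩ hz⟩)
  have hcomp' := hcomp.hasFDerivAt hev
  -- Since `u` vanishes along the graph, `L` kills its tangent space and factors through the normal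
  -- form; evaluation at the normal itself fixes the factor.
  have hz : L.comp ((J : Rn m × ℝ →L[ℝ] Rn (m + 1)).comp
      ((ContinuousLinearMap.id ℝ (Rn m)).prod (fderiv ℝ g y))) = 0 := by
    refine hcomp'.unique ((hasFDerivAt_const (0 : F) y).congr_of_eventuallyEq ?_)
    filter_upwards [hev] with z hz using hu0 _ (h.graphMap_mem_frontier hΩ hz)
  have hν1 : ‖exteriorNormal Ω x‖ = 1 := norm_exteriorNormal hΩ hΩs hx
  have key : ∀ v, L v = (‖graphForm J g y‖ * inner ℝ (exteriorNormal Ω x) v) • L (J (0, 1)) := by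
    intro v
    have e1 : v = J ((J.symm v).1, fderiv ℝ g y (J.symm v).1) +
        (graphForm J g y v) • J (0, 1) := by
      rw [← map_smul, ← map_add, graphForm_apply]
      conv_lhs => rw [← J.apply_symm_apply v]
      congr 1
      ext <;> simp
    have e2 := congrArg (fun L => L (J.symm v).1) hz
    simp only [ContinuousLinearMap.comp_apply, ContinuousLinearMap.prod_apply,
      ContinuousLinearMap.id_apply, zero_apply, ContinuousLinearEquiv.coe_coe] at e2
    conv_lhs => rw [e1]
    rw [map_add, map_smul, e2, zero_add, h.graphForm_eq x hxU hx]
  rw [key w, key (exteriorNormal Ω x), smul_smul, real_inner_self_eq_norm_sq, hν1]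
  congr 1; ring

end Trace

/-! ### The Hessian of a limiting Carleman weight -/

section Gradient

variable {n : ℕ}

theorem two_le_infty : (2 : WithTop ℕ∞) ≤ ((⊤ : ℕ∞) : WithTop ℕ∞) :=
  WithTop.coe_le_coe.2 le_top

theorem inner_gradient (f : Rn n → ℝ) (x w : Rn n) : inner ℝ (∇ f x) w = fderiv ℝ f x w := by
  simp [gradient]

theorem hasFDerivAt_gradient {f : Rn n → ℝ} {x : Rn n} (hf : ContDiffAt ℝ 2 f x) :
    HasFDerivAt (gradient f) (fderiv ℝ (gradient f) x) x := by
  have h1 : DifferentiableAt ℝ (fderiv ℝ f) x :=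
    (hf.fderiv_right (m := 1) (by norm_num)).differentiableAt (by simp)
  have h2 : DifferentiableAt ℝ (fun y => (InnerProductSpace.toDual ℝ (Rn n)).symm (fderiv ℝ f y)) x :=
    (InnerProductSpace.toDual ℝ (Rn n)).symm.toContinuousLinearEquiv.differentiableAt.comp x h1
  exact h2.hasFDerivAt

theorem inner_fderiv_gradient {f : Rn n → ℝ} {x : Rn n} (hf : ContDiffAt ℝ 2 f x) (p q : Rn n) :
    inner ℝ (fderiv ℝ (gradient f) x p) q = fderiv ℝ (fderiv ℝ f) x p q := by
  have h1 : HasFDerivAt (fderiv ℝ f) (fderiv ℝ (fderiv ℝ f) x) x :=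
    ((hf.fderiv_right (m := 1) (by norm_num)).differentiableAt (by simp)).hasFDerivAt
  have h2 : HasFDerivAt (fun y => inner ℝ (gradient f y) q)
      ((innerSL ℝ q).comp (fderiv ℝ (gradient f) x)) x := by
    have := ((innerSL ℝ q).hasFDerivAt (x := gradient f x)).comp x (hasFDerivAt_gradient hf)
    refine this.congr_of_eventuallyEq (Eventually.of_forall fun y => ?_)
    simp
  have h3 : HasFDerivAt (fun y => inner ℝ (gradient f y) q)
      ((ContinuousLinearMap.apply ℝ ℝ q).comp (fderiv ℝ (fderiv ℝ f) x)) x := by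
    have := ((ContinuousLinearMap.apply ℝ ℝ q).hasFDerivAt (x := fderiv ℝ f x)).comp x h1
    refine this.congr_of_eventuallyEq (Eventually.of_forall fun y => ?_)
    exact inner_gradient f y q
  have := congrArg (fun L => L p) (h2.unique h3)
  simpa [real_inner_comm] using this

theorem inner_fderiv_gradient_symm {f : Rn n → ℝ} {x : Rn n} (hf : ContDiffAt ℝ 2 f x)
    (p q : Rn n) :
    inner ℝ (fderiv ℝ (gradient f) x p) q = inner ℝ p (fderiv ℝ (gradient f) x q) := by
  rw [real_inner_comm _ p, inner_fderiv_gradient hf, inner_fderiv_gradient hf]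
  exact (hf.isSymmSndFDerivAt (by simp)).eq p q

theorem gradient_normSq (ξ : Rn n) (c : ℝ) : ∇ (fun η : Rn n => ‖η‖ ^ 2 - c) ξ = (2 : ℝ) • ξ := by
  refine ext_inner_right ℝ fun w => ?_
  have h : HasFDerivAt (fun η : Rn n => ‖η‖ ^ 2 - c) (2 • innerSL ℝ ξ) ξ := by
    simpa using ((hasFDerivAt_id ξ).norm_sq).sub_const c
  rw [inner_gradient, h.fderiv, real_inner_smul_left]
  simp

theorem gradient_inner_const (v ξ : Rn n) (c : ℝ) :
    ∇ (fun η : Rn n => c * inner ℝ v η) ξ = c • v := by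
  refine ext_inner_right ℝ fun w => ?_
  have h : HasFDerivAt (fun η : Rn n => c * inner ℝ v η) (c • innerSL ℝ v) ξ :=
    ((innerSL ℝ v).hasFDerivAt).const_mul c
  rw [inner_gradient, h.fderiv, real_inner_smul_left]
  simp

/-- The Hessian of `φ`. -/
noncomputable def hess (φ : Rn n → ℝ) (x : Rn n) : Rn n →L[ℝ] Rn n := fderiv ℝ (gradient φ) x

/-- The bracket condition in terms of the Hessian. -/
theorem poissonBracket_conjSymbol {φ : Rn n → ℝ} {x : Rn n} (hφ : ContDiffAt ℝ 2 φ x) (ξ : Rn n) :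
    poissonBracket (fun y η => (conjSymbol φ y η).re) (fun y η => (conjSymbol φ y η).im) x ξ =
      4 * (inner ℝ (hess φ x ξ) ξ + inner ℝ (hess φ x (∇ φ x)) (∇ φ x)) := by
  have hre : ∀ y η, (conjSymbol φ y η).re = ‖η‖ ^ 2 - ‖∇ φ y‖ ^ 2 := fun y η => by
    simp only [conjSymbol, Complex.add_re, Complex.ofReal_re, Complex.mul_re, Complex.mul_im,
      Complex.re_ofNat, Complex.im_ofNat, Complex.I_re, Complex.I_im, Complex.ofReal_im]
    ring
  have him : ∀ y η, (conjSymbol φ y η).im = 2 * inner ℝ (∇ φ y) η := fun y η => by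
    simp only [conjSymbol, Complex.add_im, Complex.ofReal_re, Complex.mul_re, Complex.mul_im,
      Complex.re_ofNat, Complex.im_ofNat, Complex.I_re, Complex.I_im, Complex.ofReal_im]
    ring
  have hΦ := hasFDerivAt_gradient hφ
  have e1 : ∇ (fun y => 2 * inner ℝ (∇ φ y) ξ) x = (2 : ℝ) • hess φ x ξ := by
    refine ext_inner_right ℝ fun w => ?_
    have h : HasFDerivAt (fun y => 2 * inner ℝ (∇ φ y) ξ)
        ((2 : ℝ) • (innerSL ℝ ξ).comp (hess φ x)) x := by
      have := (((innerSL ℝ ξ).hasFDerivAt (x := gradient φ x)).comp x hΦ).const_mul 2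
      refine this.congr_of_eventuallyEq (Eventually.of_forall fun y => ?_)
      simp
    rw [inner_gradient, h.fderiv, real_inner_smul_left]
    simp only [smul_apply, ContinuousLinearMap.comp_apply, innerSL_apply_apply, smul_eq_mul]
    rw [real_inner_comm, hess, inner_fderiv_gradient_symm hφ, real_inner_comm]
  have e2 : ∇ (fun y => ‖ξ‖ ^ 2 - ‖∇ φ y‖ ^ 2) x = (-2 : ℝ) • hess φ x (∇ φ x) := by
    refine ext_inner_right ℝ fun w => ?_
    have h : HasFDerivAt (fun y => ‖ξ‖ ^ 2 - ‖∇ φ y‖ ^ 2)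
        (-(2 • (innerSL ℝ (∇ φ x)).comp (hess φ x))) x := (hΦ.norm_sq).const_sub _
    rw [inner_gradient, h.fderiv, real_inner_smul_left]
    simp only [neg_apply, smul_apply, ContinuousLinearMap.comp_apply, innerSL_apply_apply,
      nsmul_eq_mul, hess]
    rw [← inner_fderiv_gradient_symm hφ]
    simp
  simp only [poissonBracket, hre, him]
  rw [gradient_normSq, gradient_inner_const, e1, e2]
  simp only [real_inner_smul_left, real_inner_smul_right]
  rw [real_inner_comm ξ]
  ring

/-- For a limiting Carleman weight the Hessian is determined by its value on `∇φ`. -/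
theorem IsLimitingCarlemanWeight.hess_eq {W : Set (Rn n)} (hW : IsOpen W) {φ : Rn n → ℝ}
    (hφ : IsLimitingCarlemanWeight W φ) {x : Rn n} (hx : x ∈ W) (p : Rn n) :
    inner ℝ (hess φ x p) p =
      -(inner ℝ (hess φ x (∇ φ x)) (∇ φ x) / ‖∇ φ x‖ ^ 2) * ‖p‖ ^ 2 +
        2 * (inner ℝ (hess φ x (∇ φ x)) p / ‖∇ φ x‖ ^ 2) * inner ℝ (∇ φ x) p := by
  have hc : ContDiffAt ℝ 2 φ x :=
    (hφ.contDiffOn.contDiffAt (hW.mem_nhds hx)).of_le two_le_infty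
  set Φ := ∇ φ x with hΦ
  set H := hess φ x with hH
  have hΦ0 : 0 < ‖Φ‖ := norm_pos_iff.2 (hφ.gradient_ne_zero x hx)
  have hsymm : ∀ p q, inner ℝ (H p) q = inner ℝ p (H q) := inner_fderiv_gradient_symm hc
  set β := inner ℝ Φ p with hβ
  set q := p - (β / ‖Φ‖ ^ 2) • Φ with hq
  have hp : p = (β / ‖Φ‖ ^ 2) • Φ + q := by rw [hq]; abel
  have hqΦ : inner ℝ Φ q = 0 := by
    rw [hq, inner_sub_right, inner_smul_right, real_inner_self_eq_norm_sq, ← hβ]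
    field_simp
    ring
  -- The characteristic covectors are those orthogonal to `∇φ` and of the same length. Rescaling `q`
  -- to that length makes the bracket condition applicable, and homogeneity scales the result back.
  have hqq : inner ℝ (H q) q = -(inner ℝ (H Φ) Φ / ‖Φ‖ ^ 2) * ‖q‖ ^ 2 := by
    by_cases hq0 : q = 0
    · simp [hq0]
    have hqn : 0 < ‖q‖ := norm_pos_iff.2 hq0
    set ξ := (‖Φ‖ / ‖q‖) • q with hξ
    have hξn : ‖ξ‖ = ‖Φ‖ := by
      rw [hξ, norm_smul, Real.norm_of_nonneg (by positivity)]
      field_simp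
    have hξΦ : inner ℝ Φ ξ = 0 := by rw [hξ, inner_smul_right, hqΦ, mul_zero]
    have h0 : conjSymbol φ x ξ = 0 := by
      simp only [conjSymbol, ← hΦ, hξΦ, hξn]
      simp
    have h1 := hφ.bracket_eq_zero x hx ξ h0
    rw [poissonBracket_conjSymbol hc, ← hΦ, ← hH, hξ, map_smul, real_inner_smul_left,
      real_inner_smul_right] at h1
    field_simp at h1 ⊢
    nlinarith
  have hpp : ‖p‖ ^ 2 = β ^ 2 / ‖Φ‖ ^ 2 + ‖q‖ ^ 2 := by
    rw [← real_inner_self_eq_norm_sq p]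
    conv_lhs => rw [hp]
    rw [inner_add_left, inner_add_right, inner_add_right, real_inner_smul_left,
      real_inner_smul_left, real_inner_smul_right, real_inner_smul_right, hqΦ,
      real_inner_comm Φ q, hqΦ, real_inner_self_eq_norm_sq, real_inner_self_eq_norm_sq]
    field_simp
    ring
  have hΦp : inner ℝ (H Φ) p = β / ‖Φ‖ ^ 2 * inner ℝ (H Φ) Φ + inner ℝ (H Φ) q := by
    conv_lhs => rw [hp]
    rw [inner_add_right, real_inner_smul_right]
  have hHp : inner ℝ (H p) p = (β / ‖Φ‖ ^ 2) ^ 2 * inner ℝ (H Φ) Φ +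
      2 * (β / ‖Φ‖ ^ 2) * inner ℝ (H Φ) q + inner ℝ (H q) q := by
    conv_lhs => rw [hp]
    rw [map_add, map_smul, inner_add_left, inner_add_right, inner_add_right, real_inner_smul_left,
      real_inner_smul_left, real_inner_smul_right, real_inner_smul_right, hsymm q Φ,
      real_inner_comm (H Φ) q]
    ring
  rw [hHp, hqq, hpp, hΦp]
  field_simp
  ring

end Gradient

/-! ### The pointwise energy identity -/

section Pointwise

variable {n : ℕ}

set_option maxHeartbeats 800000 in
/-- The algebraic core of the Carleman estimate: the square of the conjugated operator, minus the
divergence of the boundary flux, is bounded below. -/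
theorem carleman_algebra {h k a κ v l m β N R D DP G GP μ η q B K : ℝ} (hh : 0 ≤ h) (hk : 0 ≤ k)
    (hκ : 0 < κ) (hκm : κ ≤ m) (hκ1 : κ ≤ 1) (hN : 0 ≤ N) (ha : 1 / 4 ≤ a ^ 2)
    (hq : q = -μ * N + 2 * η * β) (hG : G = -4 * a * μ - 2 * D - κ * k) (hB : 1 ≤ B)
    (hGB : |G| ≤ B) (hDB : |D| ≤ B) (hDP : |DP| ≤ B) (hGP : GP ^ 2 ≤ B ^ 2 * N)
    (hη : η ^ 2 ≤ B ^ 2 * N) (hK : h * (6 * B ^ 2 + K) ≤ k * (3 / 4 * κ ^ 2)) :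
    (-4 * h ^ 3 * (a * q + k * β ^ 2 + R) + h ^ 3 * (GP * v + G * N)) +
        (-4 * h ^ 3 * (a * β) + h ^ 3 * G * v) * l +
        (4 * h ^ 3 * R - 2 * h * (2 * (a ^ 2 * (a * (μ * m) + k * m ^ 2)) * v ^ 2 +
          a ^ 2 * m * (2 * v * (a * β))) + 2 * h ^ 2 * (DP * v ^ 2 + 2 * D * v * (a * β))) +
        (2 * h ^ 3 * N - 2 * h * (a ^ 2 * m) * v ^ 2 + 2 * h ^ 2 * D * v ^ 2) * D +
        h ^ 2 * K * (v ^ 2 + h ^ 2 * N) ≤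
      (-h ^ 2 * l - a ^ 2 * m * v + h * D * v + 2 * h * (a * β)) ^ 2 := by
  -- Intended values: `a = 1 + kφ`, `m = |∇φ|²`, `l = Δv`, `N = |∇v|²`, `β = ∇φ·∇v`, `q = φ''(∇v,
  -- ∇v)`, `R = ∇ψ·v''∇v`, `D = Δψ`, `DP = ∇D·∇ψ`, `GP = ∇G·∇v`, with `μ`, `η` as in `hess_eq`. The
  -- term `hDv` is kept in `S`, so that `T` is a pure first derivative.
  set S := -h ^ 2 * l - a ^ 2 * m * v + h * D * v with hS
  set T := 2 * h * (a * β) with hT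
  have hm : 0 < m := hκ.trans_le hκm
  have b1 : -(4 * h ^ 4 * (B ^ 2 * N)) ≤ T ^ 2 + 4 * h ^ 2 * η * T := by
    have : h ^ 4 * η ^ 2 ≤ h ^ 4 * (B ^ 2 * N) := by gcongr
    linarith only [sq_nonneg (T + 2 * h ^ 2 * η), this]
  have b2 : -(h ^ 2 * v ^ 2 * (B ^ 2 / 4)) ≤ S ^ 2 + h * G * v * S := by
    have h0 : G ^ 2 ≤ B ^ 2 := sq_le_sq' (abs_le.1 hGB).1 (abs_le.1 hGB).2
    have : (h * v) ^ 2 * G ^ 2 ≤ (h * v) ^ 2 * B ^ 2 :=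
      mul_le_mul_of_nonneg_left h0 (sq_nonneg _)
    linarith only [sq_nonneg (S + h * G * v / 2), this]
  -- The gain in `v²`. The convexity contributes `4hk a²m²v²`, of which `κ ≤ m` and `a² ≥ 1/4` leave
  -- a fixed share after `G` has diverted the amount `κk` to the gradient term.
  have b3 : k * h * (3 / 4 * κ ^ 2) * v ^ 2 ≤ 4 * h * k * a ^ 2 * m ^ 2 * v ^ 2 -
      κ * k * h * a ^ 2 * m * v ^ 2 := by
    have e : 4 * h * k * a ^ 2 * m ^ 2 * v ^ 2 - κ * k * h * a ^ 2 * m * v ^ 2 =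
      k * h * (a ^ 2 * (m * (4 * m - κ))) * v ^ 2 := by ring
    rw [e]
    have : 3 * κ ^ 2 ≤ m * (4 * m - κ) := by nlinarith only [hκ, hκm]
    have : 3 / 4 * κ ^ 2 ≤ a ^ 2 * (m * (4 * m - κ)) := by
      linarith only [mul_le_mul ha this (by positivity) (sq_nonneg a)]
    gcongr
  have b4 : |G * D + 2 * (DP + D ^ 2)| ≤ 5 * B ^ 2 := by
    have h1 : |G * D| ≤ B * B := by
      rw [abs_mul]; exact mul_le_mul hGB hDB (abs_nonneg _) (by linarith)
    have h2 : |D ^ 2| ≤ B * B := by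
      rw [sq, abs_mul]; exact mul_le_mul hDB hDB (abs_nonneg _) (by linarith)
    have hBB : B ≤ B * B := by nlinarith only [hB]
    rw [abs_le] at h1 h2 hDP ⊢
    constructor <;> linarith [h1.1, h1.2, h2.1, h2.2, hDP.1, hDP.2, sq B]
  have b5 : h ^ 2 * ((G * D + 2 * (DP + D ^ 2)) * v ^ 2) ≤ h ^ 2 * (5 * B ^ 2 * v ^ 2) := by
    gcongr
    exact (le_abs_self _).trans b4
  have b6 : h ^ 3 * GP * v ≤ h ^ 2 * ((h ^ 2 * (B ^ 2 * N) + v ^ 2) / 2) := by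
    have h1 : h ^ 2 * GP ^ 2 ≤ h ^ 2 * (B ^ 2 * N) := by gcongr
    have h2 : h * GP * v ≤ (h ^ 2 * GP ^ 2 + v ^ 2) / 2 := by nlinarith [sq_nonneg (h * GP - v)]
    calc h ^ 3 * GP * v = h ^ 2 * (h * GP * v) := by ring
      _ ≤ _ := by gcongr; linarith
  -- The errors add up to at most `5B² + B²/4 + 1/2` for `h²v²` and `4B² + B²/2` for `h⁴N`. As `B ≥
  -- 1`, both are below `6B²`.
  have b7 : h * (h * (6 * B ^ 2 + K)) * (v ^ 2 + h ^ 2 * N) ≤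
      h * (k * (3 / 4 * κ ^ 2)) * (v ^ 2 + h ^ 2 * N) := by gcongr
  have b8 : h * (k * (3 / 4 * κ ^ 2)) * (h ^ 2 * N) ≤ κ * k * h ^ 3 * N := by
    have : 3 / 4 * κ ^ 2 ≤ κ := by nlinarith only [hκ, hκ1]
    calc h * (k * (3 / 4 * κ ^ 2)) * (h ^ 2 * N) ≤ h * (k * κ) * (h ^ 2 * N) := by gcongr
      _ = _ := by ring
  have hB2 : 1 ≤ B ^ 2 := by nlinarith only [hB]
  have b9 : 0 ≤ h ^ 2 * v ^ 2 * (B ^ 2 - 1) := by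
    have : 0 ≤ B ^ 2 - 1 := by linarith
    positivity
  have b10 : 0 ≤ h ^ 4 * N * B ^ 2 := by positivity
  have b11 : 0 ≤ h ^ 3 * k * β ^ 2 := by positivity
  -- The choice of `G` cancels the terms `a³μm v²` and `a²mD v²`, as well as the terms `aμN` and
  -- `DN`. Outside the two brackets with `S` and `T`, what is left of order `h` in `v²` and of order
  -- `h³` in `N` carries a factor `k`.
  have id : (S + T) ^ 2 - ((-4 * h ^ 3 * (a * q + k * β ^ 2 + R) + h ^ 3 * (GP * v + G * N)) +
        (-4 * h ^ 3 * (a * β) + h ^ 3 * G * v) * l +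
        (4 * h ^ 3 * R - 2 * h * (2 * (a ^ 2 * (a * (μ * m) + k * m ^ 2)) * v ^ 2 +
          a ^ 2 * m * (2 * v * (a * β))) + 2 * h ^ 2 * (DP * v ^ 2 + 2 * D * v * (a * β))) +
        (2 * h ^ 3 * N - 2 * h * (a ^ 2 * m) * v ^ 2 + 2 * h ^ 2 * D * v ^ 2) * D) =
      (S ^ 2 + h * G * v * S) + (T ^ 2 + 4 * h ^ 2 * η * T) + 4 * (h ^ 3 * k * β ^ 2) +
        (4 * h * k * a ^ 2 * m ^ 2 * v ^ 2 - κ * k * h * a ^ 2 * m * v ^ 2) + κ * k * h ^ 3 * N -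
        h ^ 2 * ((G * D + 2 * (DP + D ^ 2)) * v ^ 2) - h ^ 3 * GP * v := by
    rw [hS, hT, hq, hG]; ring
  have b12 : 0 ≤ h ^ 2 * v ^ 2 * B ^ 2 := by positivity
  rw [← le_sub_iff_add_le', id]
  linarith only [b1, b2, b3, b5, b6, b7, b8, b9, b10, b11, b12]

/-- The trace of an endomorphism of `ℝⁿ`. -/
noncomputable def tr (L : Rn n →L[ℝ] Rn n) : ℝ :=
  ∑ j, inner ℝ (L (EuclideanSpace.single j 1)) (EuclideanSpace.single j 1)

theorem tr_add (L M : Rn n →L[ℝ] Rn n) : tr (L + M) = tr L + tr M := by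
  simp [tr, inner_add_left, Finset.sum_add_distrib]

theorem tr_smul (c : ℝ) (L : Rn n →L[ℝ] Rn n) : tr (c • L) = c * tr L := by
  simp [tr, Finset.mul_sum, real_inner_smul_left]

theorem tr_smulRight (ℓ : Rn n →L[ℝ] ℝ) (w : Rn n) : tr (ℓ.smulRight w) = ℓ w := by
  have : w = ∑ j, w j • EuclideanSpace.single j (1 : ℝ) := by
    simpa using ((EuclideanSpace.basisFun (Fin n) ℝ).sum_repr w).symm
  conv_rhs => rw [this]
  simp [tr, mul_comm, EuclideanSpace.inner_single_right]

theorem continuous_tr : Continuous (tr : (Rn n →L[ℝ] Rn n) → ℝ) := by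
  unfold tr; fun_prop

/-- The divergence of `s p + r Ψ`. -/
theorem tr_fderiv_smul_add_smul {s r : Rn n → ℝ} {p Ψ : Rn n → Rn n} {x : Rn n}
    {s' r' : Rn n →L[ℝ] ℝ} {p' Ψ' : Rn n →L[ℝ] Rn n} (hs : HasFDerivAt s s' x)
    (hr : HasFDerivAt r r' x) (hp : HasFDerivAt p p' x) (hΨ : HasFDerivAt Ψ Ψ' x) :
    tr (fderiv ℝ (fun y => s y • p y + r y • Ψ y) x) =
      s' (p x) + s x * tr p' + r' (Ψ x) + r x * tr Ψ' := by
  have := (hs.smul hp).add (hr.smul hΨ)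
  have h2 : fderiv ℝ (fun y => s y • p y + r y • Ψ y) x = _ := this.fderiv
  rw [h2, tr_add, tr_add, tr_add, tr_smul, tr_smul, tr_smulRight, tr_smulRight]
  ring

/-- The Laplacian of `f`. -/
noncomputable def lap (f : Rn n → ℝ) (x : Rn n) : ℝ := tr (hess f x)

/-- `⟨φ''∇φ, ∇φ⟩ / |∇φ|²`. -/
noncomputable def hessQuot (φ : Rn n → ℝ) (x : Rn n) : ℝ :=
  inner ℝ (hess φ x (∇ φ x)) (∇ φ x) / ‖∇ φ x‖ ^ 2

/-- The Laplacian of the convexified weight `φ + k φ² / 2`. -/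
noncomputable def convLap (φ : Rn n → ℝ) (k : ℝ) (x : Rn n) : ℝ :=
  lap φ x + k * (φ x * lap φ x + ‖∇ φ x‖ ^ 2)

/-- The multiplier of the energy identity. -/
noncomputable def multiplier (φ : Rn n → ℝ) (κ k : ℝ) (x : Rn n) : ℝ :=
  (-4 * hessQuot φ x - 2 * lap φ x) +
    k * (-4 * (φ x * hessQuot φ x) - 2 * (φ x * lap φ x + ‖∇ φ x‖ ^ 2) - κ)

/-- The conjugated operator `e^{ψ/h} (-h²Δ) e^{-ψ/h}` for `ψ = φ + k φ² / 2`. -/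
noncomputable def conjLap (φ : Rn n → ℝ) (k h : ℝ) (v : Rn n → ℝ) (x : Rn n) : ℝ :=
  -h ^ 2 * lap v x - (1 + k * φ x) ^ 2 * ‖∇ φ x‖ ^ 2 * v x + h * convLap φ k x * v x +
    2 * h * ((1 + k * φ x) * inner ℝ (∇ φ x) (∇ v x))

/-- The flux in the energy identity; `p` stands for the gradient of `v`. -/
noncomputable def flux (φ : Rn n → ℝ) (κ k h : ℝ) (v : Rn n → ℝ) (p : Rn n → Rn n) (x : Rn n) :
    Rn n :=
  (-4 * h ^ 3 * ((1 + k * φ x) * inner ℝ (∇ φ x) (p x)) + h ^ 3 * multiplier φ κ k x * v x) • p x +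
    (2 * h ^ 3 * ‖p x‖ ^ 2 - 2 * h * ((1 + k * φ x) ^ 2 * ‖∇ φ x‖ ^ 2) * v x ^ 2 +
      2 * h ^ 2 * convLap φ k x * v x ^ 2) • ((1 + k * φ x) • ∇ φ x)

/-- The product rule. The coefficients `-4` and `2` in the flux are such that the two occurrences of
`∇ψ·v''∇v` cancel, by symmetry of `v''`. -/
theorem tr_fderiv_flux {φ v : Rn n → ℝ} {κ k h : ℝ} {x : Rn n} (hφ : ContDiffAt ℝ 2 φ x)
    (hv : ContDiffAt ℝ 2 v x) (hD : DifferentiableAt ℝ (convLap φ k) x)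
    (hG : DifferentiableAt ℝ (multiplier φ κ k) x) :
    tr (fderiv ℝ (flux φ κ k h v (gradient v)) x) =
      (-4 * h ^ 3 * ((1 + k * φ x) * inner ℝ (hess φ x (∇ v x)) (∇ v x) +
          k * inner ℝ (∇ φ x) (∇ v x) ^ 2 +
          (1 + k * φ x) * inner ℝ (∇ φ x) (hess v x (∇ v x))) +
        h ^ 3 * (fderiv ℝ (multiplier φ κ k) x (∇ v x) * v x +
          multiplier φ κ k x * ‖∇ v x‖ ^ 2)) +
      (-4 * h ^ 3 * ((1 + k * φ x) * inner ℝ (∇ φ x) (∇ v x)) +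
        h ^ 3 * multiplier φ κ k x * v x) * lap v x +
      (4 * h ^ 3 * ((1 + k * φ x) * inner ℝ (∇ φ x) (hess v x (∇ v x))) -
        2 * h * (2 * ((1 + k * φ x) ^ 2 * ((1 + k * φ x) *
          inner ℝ (hess φ x (∇ φ x)) (∇ φ x) + k * (‖∇ φ x‖ ^ 2) ^ 2)) * v x ^ 2 +
          (1 + k * φ x) ^ 2 * ‖∇ φ x‖ ^ 2 * (2 * v x * ((1 + k * φ x) *
            inner ℝ (∇ φ x) (∇ v x)))) +
        2 * h ^ 2 * (fderiv ℝ (convLap φ k) x ((1 + k * φ x) • ∇ φ x) * v x ^ 2 +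
          2 * convLap φ k x * v x * ((1 + k * φ x) * inner ℝ (∇ φ x) (∇ v x)))) +
      (2 * h ^ 3 * ‖∇ v x‖ ^ 2 - 2 * h * ((1 + k * φ x) ^ 2 * ‖∇ φ x‖ ^ 2) * v x ^ 2 +
        2 * h ^ 2 * convLap φ k x * v x ^ 2) * convLap φ k x := by
  have dφ : HasFDerivAt φ (fderiv ℝ φ x) x := (hφ.differentiableAt (by simp)).hasFDerivAt
  have dv : HasFDerivAt v (fderiv ℝ v x) x := (hv.differentiableAt (by simp)).hasFDerivAt
  have dΦ : HasFDerivAt (gradient φ) (hess φ x) x := hasFDerivAt_gradient hφ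
  have dp : HasFDerivAt (gradient v) (hess v x) x := hasFDerivAt_gradient hv
  have dD := hD.hasFDerivAt
  have dG := hG.hasFDerivAt
  have da : HasFDerivAt (fun y => 1 + k * φ y) (k • fderiv ℝ φ x) x :=
    (dφ.const_mul k).const_add 1
  have ds := ((da.mul (dΦ.inner ℝ dp)).const_mul (-4 * h ^ 3)).add ((dG.const_mul (h ^ 3)).mul dv)
  have dr := ((dp.norm_sq.const_mul (2 * h ^ 3)).sub
    ((((da.pow 2).mul dΦ.norm_sq).const_mul (2 * h)).mul (dv.pow 2))).add
    ((dD.const_mul (2 * h ^ 2)).mul (dv.pow 2))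
  have key := tr_fderiv_smul_add_smul ds dr dp (da.smul dΦ)
  refine Eq.trans ?_ (key.trans ?_)
  · rfl
  have hsv := inner_fderiv_gradient_symm hv
  have htr : tr ((1 + k * φ x) • hess φ x + (k • fderiv ℝ φ x).smulRight (∇ φ x)) =
      convLap φ k x := by
    rw [tr_add, tr_smul, tr_smulRight, smul_apply, ← inner_gradient,
      real_inner_self_eq_norm_sq, convLap, lap, smul_eq_mul]
    ring
  rw [htr]
  have hsv' : ∀ p q, inner ℝ (hess v x p) q = inner ℝ p (hess v x q) := hsv
  simp only [Pi.add_apply, Pi.sub_apply, Pi.mul_apply, Pi.smul_apply', add_apply, sub_apply, smul_apply, ContinuousLinearMap.comp_apply,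
    ContinuousLinearMap.prod_apply, fderivInnerCLM_apply, innerSL_apply_apply, smul_eq_mul,
    map_smul, ← inner_gradient, real_inner_self_eq_norm_sq,
    nsmul_eq_mul, lap]
  rw [← hsv' (∇ v x) (∇ φ x), real_inner_comm (∇ φ x) (∇ v x),
    real_inner_comm (∇ φ x) (hess v x (∇ v x)), real_inner_comm (∇ φ x) (hess φ x (∇ φ x))]
  push_cast
  ring

end Pointwise

/-! ### Uniform bounds for the coefficients, and the pointwise inequality -/

section Bounds

variable {n : ℕ} {W : Set (Rn n)} {φ : Rn n → ℝ}

theorem contDiffOn_gradient (hW : IsOpen W) (hφ : ContDiffOn ℝ ∞ φ W) :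
    ContDiffOn ℝ ∞ (gradient φ) W := by
  have h1 : ContDiffOn ℝ ∞ (fderiv ℝ φ) W := hφ.fderiv_of_isOpen hW (by simp)
  exact (InnerProductSpace.toDual ℝ (Rn n)).symm.toContinuousLinearEquiv.contDiff.comp_contDiffOn h1

theorem contDiffOn_hess (hW : IsOpen W) (hφ : ContDiffOn ℝ ∞ φ W) :
    ContDiffOn ℝ ∞ (hess φ) W :=
  (contDiffOn_gradient hW hφ).fderiv_of_isOpen hW (by simp)

theorem contDiffOn_lap (hW : IsOpen W) (hφ : ContDiffOn ℝ ∞ φ W) : ContDiffOn ℝ ∞ (lap φ) W := by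
  have h1 : ContDiff ℝ ∞ (tr : (Rn n →L[ℝ] Rn n) → ℝ) := by
    exact ContDiff.sum fun j _ => (ContinuousLinearMap.contDiff
      (ContinuousLinearMap.apply ℝ (Rn n) (EuclideanSpace.single j (1 : ℝ)))).inner ℝ contDiff_const
  exact h1.comp_contDiffOn (contDiffOn_hess hW hφ)

theorem IsLimitingCarlemanWeight.contDiffOn_hessQuot (hW : IsOpen W)
    (hφ : IsLimitingCarlemanWeight W φ) : ContDiffOn ℝ ∞ (hessQuot φ) W := by
  have hΦ := contDiffOn_gradient hW hφ.contDiffOn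
  refine (((contDiffOn_hess hW hφ.contDiffOn).clm_apply hΦ).inner ℝ hΦ).div (hΦ.norm_sq ℝ) ?_
  intro x hx
  have := hφ.gradient_ne_zero x hx
  positivity

/-- The part of `multiplier` that multiplies `k`. -/
noncomputable def multiplierSlope (φ : Rn n → ℝ) (κ : ℝ) (x : Rn n) : ℝ :=
  -4 * (φ x * hessQuot φ x) - 2 * (φ x * lap φ x + ‖∇ φ x‖ ^ 2) - κ

theorem contDiffOn_convLap_slope (hW : IsOpen W) (hφ : ContDiffOn ℝ ∞ φ W) :
    ContDiffOn ℝ ∞ (fun x => φ x * lap φ x + ‖∇ φ x‖ ^ 2) W :=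
  (hφ.mul (contDiffOn_lap hW hφ)).add ((contDiffOn_gradient hW hφ).norm_sq ℝ)

theorem IsLimitingCarlemanWeight.contDiffOn_multiplier_zero (hW : IsOpen W)
    (hφ : IsLimitingCarlemanWeight W φ) :
    ContDiffOn ℝ ∞ (fun x => -4 * hessQuot φ x - 2 * lap φ x) W :=
  (contDiffOn_const.mul (hφ.contDiffOn_hessQuot hW)).sub
    (contDiffOn_const.mul (contDiffOn_lap hW hφ.contDiffOn))

theorem IsLimitingCarlemanWeight.contDiffOn_multiplierSlope (hW : IsOpen W)
    (hφ : IsLimitingCarlemanWeight W φ) (κ : ℝ) : ContDiffOn ℝ ∞ (multiplierSlope φ κ) W :=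
  ((contDiffOn_const.mul (hφ.contDiffOn.mul (hφ.contDiffOn_hessQuot hW))).sub
    (contDiffOn_const.mul (contDiffOn_convLap_slope hW hφ.contDiffOn))).sub contDiffOn_const

/-- A function affine in a parameter from `[0, 1]`, with smooth coefficients, is bounded in `C¹` of
a compact set uniformly in the parameter. -/
theorem exists_C1_bound_affine (hW : IsOpen W) {S : Set (Rn n)} (hS : IsCompact S) (hSW : S ⊆ W)
    {f g : Rn n → ℝ} (hf : ContDiffOn ℝ ∞ f W) (hg : ContDiffOn ℝ ∞ g W) :
    ∃ M : ℝ, ∀ k : ℝ, 0 ≤ k → k ≤ 1 → ∀ x ∈ S, DifferentiableAt ℝ (fun y => f y + k * g y) x ∧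
      |f x + k * g x| ≤ M ∧ ‖fderiv ℝ (fun y => f y + k * g y) x‖ ≤ M := by
  obtain ⟨M1, h1⟩ := hS.exists_bound_of_continuousOn (hf.continuousOn.mono hSW)
  obtain ⟨M2, h2⟩ := hS.exists_bound_of_continuousOn (hg.continuousOn.mono hSW)
  obtain ⟨M3, h3⟩ := hS.exists_bound_of_continuousOn
    ((hf.fderiv_of_isOpen (m := ∞) hW (by simp)).continuousOn.mono hSW)
  obtain ⟨M4, h4⟩ := hS.exists_bound_of_continuousOn
    ((hg.fderiv_of_isOpen (m := ∞) hW (by simp)).continuousOn.mono hSW)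
  refine ⟨max (M1 + M2) (M3 + M4), fun k hk0 hk1 x hx => ?_⟩
  have df : HasFDerivAt f (fderiv ℝ f x) x :=
    ((hf.contDiffAt (hW.mem_nhds (hSW hx))).differentiableAt (by simp)).hasFDerivAt
  have dg : HasFDerivAt g (fderiv ℝ g x) x :=
    ((hg.contDiffAt (hW.mem_nhds (hSW hx))).differentiableAt (by simp)).hasFDerivAt
  have dfg : HasFDerivAt (fun y => f y + k * g y) (fderiv ℝ f x + k • fderiv ℝ g x) x :=
    df.add (dg.const_mul k)
  refine ⟨dfg.differentiableAt, le_max_of_le_left ?_, le_max_of_le_right ?_⟩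
  · have a1 := h1 x hx
    have a2 := h2 x hx
    rw [Real.norm_eq_abs] at a1 a2
    calc |f x + k * g x| ≤ |f x| + |k * g x| := abs_add_le _ _
      _ = |f x| + k * |g x| := by rw [abs_mul, abs_of_nonneg hk0]
      _ ≤ _ := by nlinarith [abs_nonneg (g x)]
  · rw [dfg.fderiv]
    have a3 := h3 x hx
    have a4 := h4 x hx
    calc ‖fderiv ℝ f x + k • fderiv ℝ g x‖ ≤ ‖fderiv ℝ f x‖ + ‖k • fderiv ℝ g x‖ := norm_add_le _ _
      _ = ‖fderiv ℝ f x‖ + k * ‖fderiv ℝ g x‖ := by rw [norm_smul, Real.norm_of_nonneg hk0]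
      _ ≤ _ := by nlinarith [norm_nonneg (fderiv ℝ g x)]

/-- The pointwise Carleman inequality, for a constant `B` that bounds the coefficients. -/
theorem IsLimitingCarlemanWeight.tr_fderiv_flux_add_le (hW : IsOpen W)
    (hφ : IsLimitingCarlemanWeight W φ) {x : Rn n} (hx : x ∈ W) {κ k h B K : ℝ} (hh : 0 ≤ h)
    (hk : 0 ≤ k) (hκ : 0 < κ) (hκm : κ ≤ ‖∇ φ x‖ ^ 2) (hκ1 : κ ≤ 1)
    (ha : 1 / 4 ≤ (1 + k * φ x) ^ 2) (hB : 1 ≤ B) (hG : DifferentiableAt ℝ (multiplier φ κ k) x)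
    (hD : DifferentiableAt ℝ (convLap φ k) x) (hGB : |multiplier φ κ k x| ≤ B)
    (hDB : |convLap φ k x| ≤ B)
    (hDP : |fderiv ℝ (convLap φ k) x ((1 + k * φ x) • ∇ φ x)| ≤ B)
    (hGP : ‖fderiv ℝ (multiplier φ κ k) x‖ ≤ B)
    (hη : ‖hess φ x (∇ φ x)‖ / ‖∇ φ x‖ ^ 2 ≤ B)
    (hK : h * (6 * B ^ 2 + K) ≤ k * (3 / 4 * κ ^ 2)) {v : Rn n → ℝ} (hv : ContDiffAt ℝ 2 v x) :
    tr (fderiv ℝ (flux φ κ k h v (gradient v)) x) +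
      h ^ 2 * K * (v x ^ 2 + h ^ 2 * ‖∇ v x‖ ^ 2) ≤ conjLap φ k h v x ^ 2 := by
  have hφ2 : ContDiffAt ℝ 2 φ x :=
    (hφ.contDiffOn.contDiffAt (hW.mem_nhds hx)).of_le two_le_infty
  have hm : 0 < ‖∇ φ x‖ ^ 2 := hκ.trans_le hκm
  have hη' : (inner ℝ (hess φ x (∇ φ x)) (∇ v x) / ‖∇ φ x‖ ^ 2) ^ 2 ≤ B ^ 2 * ‖∇ v x‖ ^ 2 := by
    rw [← mul_pow]
    refine sq_le_sq' ?_ ?_ <;> [refine neg_le_of_abs_le ?_; refine le_of_abs_le ?_] <;>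
    · rw [abs_div, abs_of_pos hm]
      calc _ ≤ ‖hess φ x (∇ φ x)‖ * ‖∇ v x‖ / ‖∇ φ x‖ ^ 2 := by
            gcongr; exact abs_real_inner_le_norm _ _
        _ = ‖hess φ x (∇ φ x)‖ / ‖∇ φ x‖ ^ 2 * ‖∇ v x‖ := by ring
        _ ≤ _ := by gcongr
  have hGP' : (fderiv ℝ (multiplier φ κ k) x (∇ v x)) ^ 2 ≤ B ^ 2 * ‖∇ v x‖ ^ 2 := by
    rw [← mul_pow]
    have h1 : |fderiv ℝ (multiplier φ κ k) x (∇ v x)| ≤ B * ‖∇ v x‖ :=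
      ((fderiv ℝ (multiplier φ κ k) x).le_opNorm _).trans (by gcongr)
    exact sq_le_sq' (neg_le_of_abs_le h1) (le_of_abs_le h1)
  have hq := hφ.hess_eq hW hx (∇ v x)
  have key := carleman_algebra (v := v x) (l := lap v x)
    (R := (1 + k * φ x) * inner ℝ (∇ φ x) (hess v x (∇ v x))) hh hk hκ hκm hκ1
    (sq_nonneg ‖∇ v x‖) ha hq (show multiplier φ κ k x = -4 * (1 + k * φ x) *
      (inner ℝ (hess φ x (∇ φ x)) (∇ φ x) / ‖∇ φ x‖ ^ 2) - 2 * convLap φ k x - κ * k by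
        rw [multiplier, convLap, hessQuot]; ring) hB hGB hDB hDP hGP' hη' hK
  rw [tr_fderiv_flux hφ2 hv hD hG]
  refine le_trans (le_of_eq ?_) (key.trans (le_of_eq ?_))
  · rw [div_mul_cancel₀ _ hm.ne']
  · rw [conjLap]

end Bounds

/-! ### The integrated estimate for real functions -/

section Integrated

variable {m : ℕ} {Ω : Set (Rn (m + 1))}

/-- `σ` is a measure for which the divergence theorem holds on `Ω`. -/
def IsDivergenceMeasure (Ω : Set (Rn (m + 1))) (σ : Measure (Rn (m + 1))) : Prop :=
  ∀ f : Rn (m + 1) → ℝ, ContDiffOn ℝ 1 f (closure Ω) → ∀ w,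
    ∫ x in Ω, fderiv ℝ f x w = ∫ x, f x * inner ℝ (exteriorNormal Ω x) w ∂σ

theorem IsDivergenceMeasure.integral_tr_fderiv (hΩ : IsOpen Ω) (hΩb : Bornology.IsBounded Ω)
    (hΩs : HasSmoothBoundary Ω) {σ : Measure (Rn (m + 1))} [IsFiniteMeasure σ]
    (hσ0 : σ (frontier Ω)ᶜ = 0) (hσ : IsDivergenceMeasure Ω σ) {F : Rn (m + 1) → Rn (m + 1)}
    (hF : ContDiffOn ℝ 1 F (closure Ω)) :
    ∫ x in Ω, tr (fderiv ℝ F x) = ∫ x, inner ℝ (F x) (exteriorNormal Ω x) ∂σ := by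
  set f : Fin (m + 1) → Rn (m + 1) → ℝ := fun j x => inner ℝ (F x) (EuclideanSpace.single j 1)
    with hf
  have hfc : ∀ j, ContDiffOn ℝ 1 (f j) (closure Ω) := fun j => hF.inner ℝ contDiffOn_const
  have h1 : ∀ x ∈ Ω, tr (fderiv ℝ F x) =
      ∑ j, fderiv ℝ (f j) x (EuclideanSpace.single j 1) := by
    intro x hx
    have hd : DifferentiableAt ℝ F x :=
      (hF.contDiffAt (mem_of_superset (hΩ.mem_nhds hx) subset_closure)).differentiableAt (by simp)
    refine Finset.sum_congr rfl fun j _ => ?_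
    rw [hf]
    rw [fderiv_inner_apply ℝ hd (differentiableAt_const _)]
    simp
  rw [setIntegral_congr_fun hΩ.measurableSet h1,
    integral_finsetSum _ fun j _ => integrableOn_fderiv_apply hΩ hΩb hΩs (hfc j) _]
  have hint : ∀ j : Fin (m + 1), Integrable (fun x => f j x *
      inner ℝ (exteriorNormal Ω x) (EuclideanSpace.single j 1)) σ := fun j =>
    continuousOn_integrable_of_frontier hΩb hσ0 (((hfc j).continuousOn.mono frontier_subset_closure).mul
      ((continuousOn_exteriorNormal hΩ hΩs).inner continuousOn_const))
  simp_rw [hσ _ (hfc _) _]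
  rw [← integral_finsetSum _ fun j _ => hint j]
  congr 1
  ext x
  simp [hf, PiLp.inner_apply, mul_comm]

/-- The gradient of `v` on the closure of `Ω`. -/
noncomputable def gradClosure (Ω : Set (Rn (m + 1))) (v : Rn (m + 1) → ℝ) (x : Rn (m + 1)) :
    Rn (m + 1) :=
  (InnerProductSpace.toDual ℝ (Rn (m + 1))).symm (fderivWithin ℝ v (closure Ω) x)

theorem inner_gradClosure (v : Rn (m + 1) → ℝ) (x w : Rn (m + 1)) :
    inner ℝ (gradClosure Ω v x) w = fderivWithin ℝ v (closure Ω) x w := by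
  simp [gradClosure]

theorem gradClosure_eq (hΩ : IsOpen Ω) (v : Rn (m + 1) → ℝ) {x : Rn (m + 1)} (hx : x ∈ Ω) :
    gradClosure Ω v x = ∇ v x := by
  rw [gradClosure, fderivWithin_closure_eq hΩ v hx, gradient]

theorem contDiffOn_gradClosure (hΩ : IsOpen Ω) (hΩs : HasSmoothBoundary Ω)
    {v : Rn (m + 1) → ℝ} (hv : ContDiffOn ℝ ∞ v (closure Ω)) :
    ContDiffOn ℝ ∞ (gradClosure Ω v) (closure Ω) := by
  have h1 : ContDiffOn ℝ ∞ (fderivWithin ℝ v (closure Ω)) (closure Ω) :=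
    hv.fderivWithin (uniqueDiffOn_closure hΩ hΩs) (by simp)
  exact (InnerProductSpace.toDual ℝ (Rn (m + 1))).symm.toContinuousLinearEquiv.contDiff.comp_contDiffOn h1

theorem hess_eq_fderivWithin_gradClosure (hΩ : IsOpen Ω) (v : Rn (m + 1) → ℝ) {x : Rn (m + 1)}
    (hx : x ∈ Ω) : hess v x = fderivWithin ℝ (gradClosure Ω v) (closure Ω) x := by
  rw [fderivWithin_closure_eq hΩ _ hx, hess]
  refine Filter.EventuallyEq.fderiv_eq ?_
  filter_upwards [hΩ.mem_nhds hx] with y hy using (gradClosure_eq hΩ v hy).symm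

theorem gradClosure_of_eq_zero (hΩ : IsOpen Ω) (hΩs : HasSmoothBoundary Ω)
    {v : Rn (m + 1) → ℝ} (hv : ContDiffOn ℝ ∞ v (closure Ω)) (hv0 : ∀ x ∈ frontier Ω, v x = 0)
    {x : Rn (m + 1)} (hx : x ∈ frontier Ω) :
    gradClosure Ω v x =
      fderivWithin ℝ v (closure Ω) x (exteriorNormal Ω x) • exteriorNormal Ω x := by
  refine ext_inner_right ℝ fun w => ?_
  rw [inner_gradClosure, real_inner_smul_left,
    fderivWithin_closure_apply_of_eq_zero hΩ hΩs (hv.differentiableOn (by simp)) hv0 hx w,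
    smul_eq_mul, mul_comm]

/-- Where `v = 0` only the terms quadratic in the gradient survive. The gradient is `∂_νv ν`, so
they combine with coefficient `-4 + 2 = -2`. -/
theorem inner_flux_exteriorNormal (hΩ : IsOpen Ω) (hΩs : HasSmoothBoundary Ω)
    {v : Rn (m + 1) → ℝ} (hv : ContDiffOn ℝ ∞ v (closure Ω)) (hv0 : ∀ x ∈ frontier Ω, v x = 0)
    {x : Rn (m + 1)} (hx : x ∈ frontier Ω) (φ : Rn (m + 1) → ℝ) (κ k h : ℝ) :
    inner ℝ (flux φ κ k h v (gradClosure Ω v) x) (exteriorNormal Ω x) =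
      -(2 * h ^ 3 * ((1 + k * φ x) * normalDerivWeight Ω φ x *
        fderivWithin ℝ v (closure Ω) x (exteriorNormal Ω x) ^ 2)) := by
  have hn := norm_exteriorNormal hΩ hΩs hx
  rw [flux, gradClosure_of_eq_zero hΩ hΩs hv hv0 hx, hv0 x hx, normalDerivWeight]
  simp only [inner_add_left, real_inner_smul_left, real_inner_smul_right, norm_smul, hn,
    real_inner_self_eq_norm_sq, Real.norm_eq_abs, mul_one, sq_abs]
  ring

variable {W : Set (Rn (m + 1))} {φ : Rn (m + 1) → ℝ}

theorem contDiffOn_flux (hΩ : IsOpen Ω) (hΩs : HasSmoothBoundary Ω) (hW : IsOpen W)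
    (hΩW : closure Ω ⊆ W) (hφ : IsLimitingCarlemanWeight W φ) {v : Rn (m + 1) → ℝ}
    (hv : ContDiffOn ℝ ∞ v (closure Ω)) (κ k h : ℝ) :
    ContDiffOn ℝ 1 (flux φ κ k h v (gradClosure Ω v)) (closure Ω) := by
  have c0 : ContDiffOn ℝ ∞ φ (closure Ω) := hφ.contDiffOn.mono hΩW
  have c1 : ContDiffOn ℝ ∞ (gradient φ) (closure Ω) := (contDiffOn_gradient hW hφ.contDiffOn).mono hΩW
  have c2 : ContDiffOn ℝ ∞ (convLap φ k) (closure Ω) :=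
    ((contDiffOn_lap hW hφ.contDiffOn).add
      (contDiffOn_const.mul (contDiffOn_convLap_slope hW hφ.contDiffOn))).mono hΩW
  have c3 : ContDiffOn ℝ ∞ (multiplier φ κ k) (closure Ω) :=
    ((hφ.contDiffOn_multiplier_zero hW).add
      (contDiffOn_const.mul (hφ.contDiffOn_multiplierSlope hW κ))).mono hΩW
  have c4 := contDiffOn_gradClosure hΩ hΩs hv
  have c5 : ContDiffOn ℝ ∞ (fun x => 1 + k * φ x) (closure Ω) :=
    contDiffOn_const.add (contDiffOn_const.mul c0)
  have c6 : ContDiffOn ℝ ∞ (fun x => (1 + k * φ x) • ∇ φ x) (closure Ω) := c5.smul c1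
  have c7 := ((contDiffOn_const (c := -4 * h ^ 3)).mul (c5.mul (c1.inner ℝ c4))).add
    (((contDiffOn_const (c := h ^ 3)).mul c3).mul hv)
  have c8 := (((contDiffOn_const (c := 2 * h ^ 3)).mul (c4.norm_sq ℝ)).sub
    (((contDiffOn_const (c := 2 * h)).mul ((c5.pow 2).mul (c1.norm_sq ℝ))).mul (hv.pow 2))).add
    (((contDiffOn_const (c := 2 * h ^ 2)).mul c2).mul (hv.pow 2))
  have : ContDiffOn ℝ ∞ (flux φ κ k h v (gradClosure Ω v)) (closure Ω) :=
    (c7.smul c4).add (c8.smul c6)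
  exact this.of_le (by exact_mod_cast le_top)

/-- Second derivatives of `v` are replaced by derivatives within the closure, which are continuous
up to the boundary and hence bounded. -/
theorem integrableOn_conjLap_sq (hΩ : IsOpen Ω) (hΩb : Bornology.IsBounded Ω)
    (hΩs : HasSmoothBoundary Ω) (hW : IsOpen W)
    (hΩW : closure Ω ⊆ W) (hφ : ContDiffOn ℝ ∞ φ W) {v : Rn (m + 1) → ℝ}
    (hv : ContDiffOn ℝ ∞ v (closure Ω)) (k h : ℝ) :
    IntegrableOn (fun x => conjLap φ k h v x ^ 2) Ω := by
  have c0 : ContinuousOn φ (closure Ω) := hφ.continuousOn.mono hΩW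
  have c1 : ContinuousOn (gradient φ) (closure Ω) := (contDiffOn_gradient hW hφ).continuousOn.mono hΩW
  have c2 : ContinuousOn (convLap φ k) (closure Ω) :=
    ((contDiffOn_lap hW hφ).add
      (contDiffOn_const.mul (contDiffOn_convLap_slope hW hφ))).continuousOn.mono hΩW
  have c4 := contDiffOn_gradClosure hΩ hΩs hv
  have c5 : ContinuousOn (fun x => tr (fderivWithin ℝ (gradClosure Ω v) (closure Ω) x))
      (closure Ω) := continuous_tr.comp_continuousOn
    (c4.continuousOn_fderivWithin (uniqueDiffOn_closure hΩ hΩs) (by simp))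
  have c6 := c4.continuousOn
  have c7 := hv.continuousOn
  refine integrableOn_of_continuousOn_closure hΩ hΩb
    (f := fun x => (-h ^ 2 * tr (fderivWithin ℝ (gradClosure Ω v) (closure Ω) x) -
      (1 + k * φ x) ^ 2 * ‖∇ φ x‖ ^ 2 * v x + h * convLap φ k x * v x +
      2 * h * ((1 + k * φ x) * inner ℝ (∇ φ x) (gradClosure Ω v x))) ^ 2) ?_ ?_
  · have c8 : ContinuousOn (fun x => inner ℝ (∇ φ x) (gradClosure Ω v x)) (closure Ω) := c1.inner c6
    fun_prop
  · intro x hx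
    rw [conjLap, gradClosure_eq hΩ v hx, ← hess_eq_fderivWithin_gradClosure hΩ v hx, lap]

/-- The Carleman estimate for real functions that vanish on the boundary. -/
theorem IsLimitingCarlemanWeight.carleman_real (hΩ : IsOpen Ω) (hΩb : Bornology.IsBounded Ω)
    (hΩs : HasSmoothBoundary Ω) {σ : Measure (Rn (m + 1))} [IsFiniteMeasure σ]
    (hσ0 : σ (frontier Ω)ᶜ = 0) (hσ : IsDivergenceMeasure Ω σ) (hW : IsOpen W)
    (hΩW : closure Ω ⊆ W) (hφ : IsLimitingCarlemanWeight W φ) {K : ℝ} (hK : 0 ≤ K) :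
    ∃ ε > 0, ∃ h₀ > 0, ∀ h : ℝ, 0 < h → h ≤ h₀ →
      h / ε ≤ 1 ∧ (∀ x ∈ closure Ω, |h / ε * φ x| ≤ 1 / 2) ∧
      ∀ v : Rn (m + 1) → ℝ, ContDiffOn ℝ ∞ v (closure Ω) → (∀ x ∈ frontier Ω, v x = 0) →
        h ^ 2 * K * ∫ x in Ω, (v x ^ 2 + h ^ 2 * ‖∇ v x‖ ^ 2) ≤
          (∫ x in Ω, conjLap φ (h / ε) h v x ^ 2) +
          2 * h ^ 3 * ∫ x, (1 + h / ε * φ x) * normalDerivWeight Ω φ x *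
            fderivWithin ℝ v (closure Ω) x (exteriorNormal Ω x) ^ 2 ∂σ := by
  have hS : IsCompact (closure Ω) := hΩb.isCompact_closure
  have hΦc := contDiffOn_gradient hW hφ.contDiffOn
  have hm0 : ∀ x ∈ W, ‖∇ φ x‖ ^ 2 ≠ 0 := fun x hx => by
    have := hφ.gradient_ne_zero x hx
    positivity
  have hmc : ContinuousOn (fun x => (‖∇ φ x‖ ^ 2)⁻¹) (closure Ω) :=
    ((hΦc.continuousOn.norm.pow 2).inv₀ hm0).mono hΩW
  obtain ⟨M0, hM0⟩ := hS.exists_bound_of_continuousOn hmc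
  -- A lower bound for `|∇φ|²` on the closure, capped at `1` as the algebraic inequality demands.
  set κ : ℝ := (max M0 1)⁻¹ with hκdef
  have hM1 : 1 ≤ max M0 1 := le_max_right _ _
  have hκ : 0 < κ := by positivity
  have hκ1 : κ ≤ 1 := inv_le_one_of_one_le₀ hM1
  have hκm : ∀ x ∈ closure Ω, κ ≤ ‖∇ φ x‖ ^ 2 := fun x hx => by
    have h1 : 0 < ‖∇ φ x‖ ^ 2 := lt_of_le_of_ne (by positivity) (hm0 x (hΩW hx)).symm
    have h2 := hM0 x hx
    rw [Real.norm_of_nonneg (by positivity)] at h2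
    exact inv_le_of_inv_le₀ h1 (h2.trans (le_max_left _ _))
  obtain ⟨MD, hMD⟩ := exists_C1_bound_affine hW hS hΩW (contDiffOn_lap hW hφ.contDiffOn)
    (contDiffOn_convLap_slope hW hφ.contDiffOn)
  obtain ⟨MG, hMG⟩ := exists_C1_bound_affine hW hS hΩW (hφ.contDiffOn_multiplier_zero hW)
    (hφ.contDiffOn_multiplierSlope hW κ)
  obtain ⟨MΦ, hMΦ⟩ := hS.exists_bound_of_continuousOn (hΦc.continuousOn.mono hΩW)
  obtain ⟨Mφ, hMφ⟩ := hS.exists_bound_of_continuousOn (hφ.contDiffOn.continuousOn.mono hΩW)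
  have hηc : ContinuousOn (fun x => ‖hess φ x (∇ φ x)‖ / ‖∇ φ x‖ ^ 2) (closure Ω) :=
    ((((contDiffOn_hess hW hφ.contDiffOn).clm_apply hΦc).continuousOn.norm).div
      (hΦc.continuousOn.norm.pow 2) hm0).mono hΩW
  obtain ⟨Mη, hMη⟩ := hS.exists_bound_of_continuousOn hηc
  set B : ℝ := 1 + |MD| + |MG| + |MD| * (2 * |MΦ|) + |Mη| with hBdef
  have p1 : 0 ≤ |MD| * (2 * |MΦ|) := by positivity
  have hB : 1 ≤ B := by
    linarith [abs_nonneg MD, abs_nonneg MG, abs_nonneg Mη]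
  have hBD : MD ≤ B := by
    linarith [le_abs_self MD, abs_nonneg MD, abs_nonneg MG, abs_nonneg Mη]
  have hBG : MG ≤ B := by
    linarith [le_abs_self MG, abs_nonneg MD, abs_nonneg MG, abs_nonneg Mη]
  have hBη : Mη ≤ B := by
    linarith [le_abs_self Mη, abs_nonneg MD, abs_nonneg MG, abs_nonneg Mη]
  have hBP : |MD| * (2 * |MΦ|) ≤ B := by
    linarith [abs_nonneg MD, abs_nonneg MG, abs_nonneg Mη]
  have hpos : 0 < 6 * B ^ 2 + K := by positivity
  -- With `k = h/ε` this makes the smallness condition `h(6B² + K) ≤ k · (3/4)κ²` an equality.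
  set ε : ℝ := 3 / 4 * κ ^ 2 / (6 * B ^ 2 + K) with hε
  have hε0 : 0 < ε := by positivity
  -- The bound on `h` gives `k ≤ 1`, the range in which the coefficients are uniformly bounded, and
  -- `|kφ| ≤ 1/2`, hence `1/2 ≤ 1 + kφ ≤ 3/2`.
  refine ⟨ε, hε0, ε / (2 * (|Mφ| + 1)), by positivity, fun h hh hh0 => ?_⟩
  set k := h / ε with hk
  have hk0 : 0 ≤ k := by positivity
  have hkb : k * (2 * (|Mφ| + 1)) ≤ 1 := by
    rw [hk, div_mul_eq_mul_div, div_le_one hε0]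
    rwa [le_div_iff₀ (by positivity)] at hh0
  have hk1 : k ≤ 1 := by nlinarith [abs_nonneg Mφ]
  have hkφ : ∀ x ∈ closure Ω, |k * φ x| ≤ 1 / 2 := fun x hx => by
    have := hMφ x hx
    rw [Real.norm_eq_abs] at this
    rw [abs_mul, abs_of_nonneg hk0]
    nlinarith [le_abs_self Mφ, abs_nonneg (φ x)]
  refine ⟨hk1, hkφ, fun v hv hv0 => ?_⟩
  have hKh : h * (6 * B ^ 2 + K) ≤ k * (3 / 4 * κ ^ 2) := by
    rw [hk, hε]
    apply le_of_eq
    field_simp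
  have hpt : ∀ x ∈ Ω, tr (fderiv ℝ (flux φ κ k h v (gradClosure Ω v)) x) +
      h ^ 2 * K * (v x ^ 2 + h ^ 2 * ‖∇ v x‖ ^ 2) ≤ conjLap φ k h v x ^ 2 := by
    intro x hx
    have hxc : x ∈ closure Ω := subset_closure hx
    have he : fderiv ℝ (flux φ κ k h v (gradClosure Ω v)) x =
        fderiv ℝ (flux φ κ k h v (gradient v)) x := by
      refine Filter.EventuallyEq.fderiv_eq ?_
      filter_upwards [hΩ.mem_nhds hx] with y hy
      rw [flux, flux, gradClosure_eq hΩ v hy]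
    have hak := abs_le.1 (hkφ x hxc)
    obtain ⟨hD1, hD2, hD3⟩ := hMD k hk0 hk1 x hxc
    obtain ⟨hG1, hG2, hG3⟩ := hMG k hk0 hk1 x hxc
    rw [he]
    refine hφ.tr_fderiv_flux_add_le hW (hΩW hxc) hh.le hk0 hκ (hκm x hxc) hκ1 ?_ hB hG1 hD1
      (hG2.trans hBG) (hD2.trans hBD) ?_ (hG3.trans hBG) ?_ hKh ?_
    · nlinarith
    · refine le_trans ?_ hBP
      rw [← Real.norm_eq_abs]
      refine (ContinuousLinearMap.le_opNorm _ _).trans ?_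
      refine mul_le_mul (hD3.trans (le_abs_self _)) ?_ (norm_nonneg _) (abs_nonneg _)
      rw [norm_smul]
      refine mul_le_mul ?_ ((hMΦ x hxc).trans (le_abs_self _)) (norm_nonneg _) (by norm_num)
      rw [Real.norm_eq_abs, abs_le]
      constructor <;> linarith
    · have := hMη x hxc
      rw [Real.norm_of_nonneg (by positivity)] at this
      exact this.trans hBη
    · exact ((hv.mono subset_closure).contDiffAt (hΩ.mem_nhds hx)).of_le two_le_infty
  have hF := contDiffOn_flux hΩ hΩs hW hΩW hφ hv κ k h
  have hi1 : IntegrableOn (fun x => tr (fderiv ℝ (flux φ κ k h v (gradClosure Ω v)) x)) Ω :=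
    integrableOn_of_continuousOn_closure hΩ hΩb
      (continuous_tr.comp_continuousOn
        (hF.continuousOn_fderivWithin (uniqueDiffOn_closure hΩ hΩs) (by simp)))
      fun x hx => by
        simp only [Function.comp_apply]
        rw [fderivWithin_closure_eq hΩ _ hx]
  have hi2 : IntegrableOn (fun x => v x ^ 2 + h ^ 2 * ‖∇ v x‖ ^ 2) Ω := by
    have c6 := (contDiffOn_gradClosure hΩ hΩs hv).continuousOn
    have c7 := hv.continuousOn
    refine integrableOn_of_continuousOn_closure hΩ hΩb
      (f := fun x => v x ^ 2 + h ^ 2 * ‖gradClosure Ω v x‖ ^ 2) (by fun_prop) fun x hx => ?_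
    rw [gradClosure_eq hΩ v hx]
  have hi3 := integrableOn_conjLap_sq hΩ hΩb hΩs hW hΩW hφ.contDiffOn hv k h
  have hint : (∫ x in Ω, tr (fderiv ℝ (flux φ κ k h v (gradClosure Ω v)) x)) +
      h ^ 2 * K * ∫ x in Ω, (v x ^ 2 + h ^ 2 * ‖∇ v x‖ ^ 2) ≤
      ∫ x in Ω, conjLap φ k h v x ^ 2 := by
    rw [← integral_const_mul, ← integral_add hi1 (hi2.const_mul _)]
    exact setIntegral_mono_on (hi1.add (hi2.const_mul _)) hi3 hΩ.measurableSet hpt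
  rw [hσ.integral_tr_fderiv hΩ hΩb hΩs hσ0 hF] at hint
  have hae : ∀ᵐ x ∂σ, x ∈ frontier Ω := hσ0
  have hbd : ∫ x, inner ℝ (flux φ κ k h v (gradClosure Ω v) x) (exteriorNormal Ω x) ∂σ =
      -(2 * h ^ 3 * ∫ x, (1 + k * φ x) * normalDerivWeight Ω φ x *
            fderivWithin ℝ v (closure Ω) x (exteriorNormal Ω x) ^ 2 ∂σ) := by
    rw [← integral_const_mul, ← integral_neg]
    refine integral_congr_ae ?_
    filter_upwards [hae] with x hx
    exact inner_flux_exteriorNormal hΩ hΩs hv hv0 hx φ κ k h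
  rw [hbd] at hint
  linarith

end Integrated

/-! ### Conjugation by the convexified weight -/

section Conjugation

variable {n : ℕ}

/-- The weight `e^{ψ/h}` for `ψ = φ + k φ² / 2`. -/
noncomputable def convWeight (φ : Rn n → ℝ) (k h : ℝ) (x : Rn n) : ℝ :=
  Real.exp ((φ x + k * φ x ^ 2 / 2) / h)

theorem hasFDerivAt_convWeight {φ : Rn n → ℝ} {x : Rn n} (hφ : DifferentiableAt ℝ φ x) (k h : ℝ) :
    HasFDerivAt (convWeight φ k h)
      ((convWeight φ k h x * (1 + k * φ x) / h) • fderiv ℝ φ x) x := by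
  have h1 := hφ.hasFDerivAt
  have h2 : HasFDerivAt (fun y => (φ y + k * φ y ^ 2 / 2) / h)
      (((1 + k * φ x) / h) • fderiv ℝ φ x) x := by
    have := ((h1.add (((h1.pow 2).const_mul k).mul_const (1 / 2))).mul_const (1 / h))
    refine (this.congr_fderiv ?_).congr_of_eventuallyEq (Eventually.of_forall fun y => ?_)
    · ext w
      simp only [smul_apply, add_apply, smul_eq_mul, nsmul_eq_mul]
      push_cast
      ring
    · simp only [Pi.add_apply]
      ring
  refine h2.exp.congr_fderiv ?_
  rw [smul_smul, convWeight]
  congr 1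
  ring

theorem gradient_convWeight_mul {φ u : Rn n → ℝ} {x : Rn n} (hφ : DifferentiableAt ℝ φ x)
    (hu : DifferentiableAt ℝ u x) (k h : ℝ) :
    ∇ (fun y => convWeight φ k h y * u y) x = convWeight φ k h x • ∇ u x +
      (convWeight φ k h x * u x / h) • ((1 + k * φ x) • ∇ φ x) := by
  refine ext_inner_right ℝ fun w => ?_
  have h1 : HasFDerivAt (fun y => convWeight φ k h y * u y) _ x :=
    (hasFDerivAt_convWeight hφ k h).mul hu.hasFDerivAt
  rw [inner_gradient, h1.fderiv]
  simp only [smul_apply, add_apply, smul_eq_mul, inner_add_left, real_inner_smul_left,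
    inner_gradient]
  ring

/-- Differentiating the product twice gives, besides `e^{ψ/h}Δu`, terms in `∇u` and in `u`; the
remaining terms of `conjLap` are exactly those that cancel them. -/
theorem conjLap_convWeight_mul {φ u : Rn n → ℝ} {x : Rn n} (hφ : ContDiffAt ℝ 2 φ x)
    (hu : ContDiffAt ℝ 2 u x) (k : ℝ) {h : ℝ} (hh : h ≠ 0) :
    conjLap φ k h (fun y => convWeight φ k h y * u y) x =
      -(h ^ 2 * (convWeight φ k h x * lap u x)) := by
  have dφ : HasFDerivAt φ (fderiv ℝ φ x) x := (hφ.differentiableAt (by simp)).hasFDerivAt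
  have du : HasFDerivAt u (fderiv ℝ u x) x := (hu.differentiableAt (by simp)).hasFDerivAt
  have dω := hasFDerivAt_convWeight dφ.differentiableAt k h
  have dΦ : HasFDerivAt (gradient φ) (hess φ x) x := hasFDerivAt_gradient hφ
  have dp : HasFDerivAt (gradient u) (hess u x) x := hasFDerivAt_gradient hu
  have da : HasFDerivAt (fun y => 1 + k * φ y) (k • fderiv ℝ φ x) x :=
    (dφ.const_mul k).const_add 1
  have dr : HasFDerivAt (fun y => convWeight φ k h y * u y / h)
      ((1 / h) • (convWeight φ k h x • fderiv ℝ u x +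
        u x • (convWeight φ k h x * (1 + k * φ x) / h) • fderiv ℝ φ x)) x := by
    refine ((dω.mul du).const_mul (1 / h)).congr_of_eventuallyEq
      (Eventually.of_forall fun y => ?_)
    simp only [Pi.mul_apply]
    ring
  have he : gradient (fun y => convWeight φ k h y * u y) =ᶠ[𝓝 x]
      fun y => convWeight φ k h y • ∇ u y +
        (convWeight φ k h y * u y / h) • ((1 + k * φ y) • ∇ φ y) := by
    filter_upwards [(hφ.eventually (by simp)), (hu.eventually (by simp))] with y hy1 hy2
    exact gradient_convWeight_mul (hy1.differentiableAt (by simp)) (hy2.differentiableAt (by simp)) k h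
  have hΨ : HasFDerivAt (fun y => (1 + k * φ y) • ∇ φ y) _ x := da.smul dΦ
  have htr : tr ((1 + k * φ x) • hess φ x + (k • fderiv ℝ φ x).smulRight (∇ φ x)) =
      convLap φ k x := by
    rw [tr_add, tr_smul, tr_smulRight, smul_apply, ← inner_gradient,
      real_inner_self_eq_norm_sq, convLap, lap, smul_eq_mul]
    ring
  rw [conjLap, lap, hess, he.fderiv_eq, tr_fderiv_smul_add_smul dω dr dp hΨ, htr, he.eq_of_nhds]
  simp only [smul_apply, add_apply, smul_eq_mul, map_smul, ← inner_gradient, inner_add_right,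
    real_inner_smul_right, real_inner_self_eq_norm_sq, lap]
  rw [real_inner_comm (∇ φ x) (∇ u x)]
  field_simp
  ring

end Conjugation

/-! ### Integrals against comparable measures -/

section Measures

theorem integral_le_toReal_mul_integral {α : Type*} {mα : MeasurableSpace α} {μ ν : Measure α}
    {C : ℝ≥0∞} (hC : C ≠ ⊤) (h : μ ≤ C • ν) {g : α → ℝ} (hg0 : ∀ x, 0 ≤ g x)
    (hg : Integrable g ν) : ∫ x, g x ∂μ ≤ C.toReal * ∫ x, g x ∂ν := by
  have := integral_mono_measure h (Eventually.of_forall hg0) (hg.smul_measure hC)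
  rwa [integral_smul_measure, smul_eq_mul] at this

end Measures

/-! ### Return to `u`, to the original weight and to the surface measure -/

section Weighted

variable {m : ℕ} {Ω W : Set (Rn (m + 1))} {φ : Rn (m + 1) → ℝ}

/-- The density of the boundary terms. -/
noncomputable def boundaryDensity (Ω : Set (Rn (m + 1))) (φ : Rn (m + 1) → ℝ) (h : ℝ)
    (u : Rn (m + 1) → ℝ) (x : Rn (m + 1)) : ℝ :=
  Real.exp (φ x / h) ^ 2 * fderivWithin ℝ u (closure Ω) x (exteriorNormal Ω x) ^ 2

theorem boundaryDensity_nonneg (h : ℝ) (u : Rn (m + 1) → ℝ) (x : Rn (m + 1)) :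
    0 ≤ boundaryDensity Ω φ h u x := by
  unfold boundaryDensity; positivity

theorem continuousOn_normalDerivWeight (hΩ : IsOpen Ω) (hΩs : HasSmoothBoundary Ω) (hW : IsOpen W)
    (hΩW : closure Ω ⊆ W) (hφ : ContDiffOn ℝ ∞ φ W) :
    ContinuousOn (normalDerivWeight Ω φ) (frontier Ω) :=
  ((contDiffOn_gradient hW hφ).continuousOn.mono (frontier_subset_closure.trans hΩW)).inner
    (continuousOn_exteriorNormal hΩ hΩs)

theorem continuousOn_boundaryDensity (hΩ : IsOpen Ω) (hΩs : HasSmoothBoundary Ω)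
    (hΩW : closure Ω ⊆ W) (hφ : ContDiffOn ℝ ∞ φ W) (h : ℝ) {u : Rn (m + 1) → ℝ}
    (hu : ContDiffOn ℝ ∞ u (closure Ω)) :
    ContinuousOn (boundaryDensity Ω φ h u) (frontier Ω) := by
  have c1 : ContinuousOn φ (frontier Ω) :=
    hφ.continuousOn.mono (frontier_subset_closure.trans hΩW)
  have c2 : ContinuousOn (fun x => fderivWithin ℝ u (closure Ω) x (exteriorNormal Ω x))
      (frontier Ω) :=
    ((hu.continuousOn_fderivWithin (uniqueDiffOn_closure hΩ hΩs) (by simp)).mono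
      frontier_subset_closure).clm_apply (continuousOn_exteriorNormal hΩ hΩs)
  exact ((Real.continuous_exp.comp_continuousOn (c1.div_const h)).pow 2).mul (c2.pow 2)

/-- The boundary integral with the convexified weight is controlled from above by boundary
integrals with the original weight, for every comparable boundary measure. -/
theorem integral_boundary_le (hΩ : IsOpen Ω) (hΩb : Bornology.IsBounded Ω)
    (hΩs : HasSmoothBoundary Ω) {σ S : Measure (Rn (m + 1))} [IsFiniteMeasure σ]
    [IsFiniteMeasure S] (hσ0 : σ (frontier Ω)ᶜ = 0) (hS0 : S (frontier Ω)ᶜ = 0) {C : ℝ≥0∞}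
    (hC : C ≠ ⊤) (hσS : σ ≤ C • S) (hSσ : S ≤ C • σ) {c : ℝ} (hc : 0 < c) (hCc : C.toReal ≤ c)
    (hW : IsOpen W) (hΩW : closure Ω ⊆ W) (hφ : ContDiffOn ℝ ∞ φ W)
    {h : ℝ} {a w : Rn (m + 1) → ℝ} {Q : ℝ} (hQ : 0 ≤ Q)
    (ha : ∀ x ∈ frontier Ω, 1 / 2 ≤ a x ∧ a x ≤ 3 / 2) {u : Rn (m + 1) → ℝ}
    (hu : ContDiffOn ℝ ∞ u (closure Ω))
    (hw : ∀ x ∈ frontier Ω, boundaryDensity Ω φ h u x ≤ w x ∧ w x ≤ Q * boundaryDensity Ω φ h u x)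
    (hint : Integrable (fun x => a x * normalDerivWeight Ω φ x * w x) σ) :
    ∫ x, a x * normalDerivWeight Ω φ x * w x ∂σ ≤
      3 / 2 * Q * c * (∫ x, max (normalDerivWeight Ω φ x) 0 * boundaryDensity Ω φ h u x ∂S) -
      1 / (2 * c) * (∫ x, max (-normalDerivWeight Ω φ x) 0 * boundaryDensity Ω φ h u x ∂S) := by
  have c1 := continuousOn_normalDerivWeight hΩ hΩs hW hΩW hφ
  have c2 := continuousOn_boundaryDensity hΩ hΩs hΩW hφ h hu
  have cp : ContinuousOn (fun x => max (normalDerivWeight Ω φ x) 0 * boundaryDensity Ω φ h u x)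
      (frontier Ω) := (c1.sup continuousOn_const).mul c2
  have cm : ContinuousOn (fun x => max (-normalDerivWeight Ω φ x) 0 * boundaryDensity Ω φ h u x)
      (frontier Ω) := (c1.neg.sup continuousOn_const).mul c2
  have np : ∀ x, 0 ≤ max (normalDerivWeight Ω φ x) 0 * boundaryDensity Ω φ h u x := fun x =>
    mul_nonneg (le_max_right _ _) (boundaryDensity_nonneg _ _ _)
  have nm : ∀ x, 0 ≤ max (-normalDerivWeight Ω φ x) 0 * boundaryDensity Ω φ h u x := fun x =>
    mul_nonneg (le_max_right _ _) (boundaryDensity_nonneg _ _ _)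
  have ipσ := continuousOn_integrable_of_frontier hΩb hσ0 cp
  have imσ := continuousOn_integrable_of_frontier hΩb hσ0 cm
  have ipS := continuousOn_integrable_of_frontier hΩb hS0 cp
  have h1 := integral_le_toReal_mul_integral hC hσS np ipS
  have h2 := integral_le_toReal_mul_integral hC hSσ nm imσ
  have hae : ∀ᵐ x ∂σ, x ∈ frontier Ω := hσ0
  -- Where `∂_νφ ≥ 0` the upper bounds `a ≤ 3/2` and `w ≤ Qb` apply, with `b` the boundary density;
  -- where `∂_νφ ≤ 0` the lower bounds `a ≥ 1/2` and `w ≥ b` do. Accordingly `σ ≤ C·S` serves the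
  -- positive part and `S ≤ C·σ` the negative one.
  have h3 : ∫ x, a x * normalDerivWeight Ω φ x * w x ∂σ ≤
      ∫ x, (3 / 2 * Q * (max (normalDerivWeight Ω φ x) 0 * boundaryDensity Ω φ h u x) -
        1 / 2 * (max (-normalDerivWeight Ω φ x) 0 * boundaryDensity Ω φ h u x)) ∂σ := by
    refine integral_mono_ae hint ((ipσ.const_mul _).sub (imσ.const_mul _)) ?_
    filter_upwards [hae] with x hx
    obtain ⟨a1, a2⟩ := ha x hx
    obtain ⟨w1, w2⟩ := hw x hx
    have hb := boundaryDensity_nonneg (Ω := Ω) (φ := φ) h u x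
    set b := boundaryDensity Ω φ h u x
    set t := normalDerivWeight Ω φ x
    have hw0 : 0 ≤ w x := hb.trans w1
    rcases le_total 0 t with ht | ht
    · rw [max_eq_left ht, max_eq_right (by linarith)]
      have := mul_le_mul (mul_le_mul_of_nonneg_right a2 ht) w2 hw0 (by positivity)
      linarith
    · rw [max_eq_right ht, max_eq_left (by linarith)]
      have := mul_le_mul (mul_le_mul_of_nonneg_right a1 (neg_nonneg.2 ht)) w1 hb
        (mul_nonneg (by linarith) (neg_nonneg.2 ht))
      linarith
  rw [integral_sub (ipσ.const_mul _) (imσ.const_mul _), integral_const_mul,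
    integral_const_mul] at h3
  have p1 : 0 ≤ ∫ x, max (normalDerivWeight Ω φ x) 0 * boundaryDensity Ω φ h u x ∂S :=
    integral_nonneg np
  have p2 : 0 ≤ ∫ x, max (-normalDerivWeight Ω φ x) 0 * boundaryDensity Ω φ h u x ∂σ :=
    integral_nonneg nm
  have h4 := h1.trans (mul_le_mul_of_nonneg_right hCc p1)
  have h5 := h2.trans (mul_le_mul_of_nonneg_right hCc p2)
  refine h3.trans (sub_le_sub ?_ ?_)
  · rw [mul_assoc _ c]
    exact mul_le_mul_of_nonneg_left h4 (by positivity)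
  · rw [div_mul_eq_mul_div, div_le_iff₀ (by positivity)]
    linarith

/-- Bookkeeping: `X` and `Y` are the energies of `u` and `v`, `Z` the weighted norm of `Δu`, `I` the
boundary integral against `σ`, and `P`, `N` the boundary integrals over the two parts. Multiplying
by `c` clears the denominator in front of `N`. -/
theorem carleman_constants {h c M K Q X Y Z I P N : ℝ} (hh : 0 < h) (hc : 1 ≤ c) (hM : 1 ≤ M)
    (hK : 0 ≤ K) (hX : 0 ≤ X) (hZ : 0 ≤ Z) (hN : 0 ≤ N)
    (h1 : h ^ 2 * K * Y ≤ h ^ 4 * Z + 2 * h ^ 3 * I) (h2 : X ≤ M * Y)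
    (h3 : I ≤ 3 / 2 * Q * c * P - 1 / (2 * c) * N) :
    K * X + h * N ≤ 3 * M * c ^ 2 * h ^ 2 * Z + 3 * M * c ^ 2 * Q * h * P := by
  have s1 : K * Y ≤ h ^ 2 * Z + 2 * h * I := by
    have : h ^ 2 * (K * Y) ≤ h ^ 2 * (h ^ 2 * Z + 2 * h * I) := by linarith
    exact le_of_mul_le_mul_left this (by positivity)
  have s2 : K * X ≤ M * (K * Y) := by
    have := mul_le_mul_of_nonneg_left h2 hK
    linarith
  have s3 : c * I ≤ 3 / 2 * Q * c ^ 2 * P - 1 / 2 * N := by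
    have := mul_le_mul_of_nonneg_left h3 (by linarith : 0 ≤ c)
    refine this.trans (le_of_eq ?_)
    field_simp
  have s4 : c * (K * X) ≤ M * (h ^ 2 * c * Z + 2 * h * (3 / 2 * Q * c ^ 2 * P - 1 / 2 * N)) := by
    have t1 := mul_le_mul_of_nonneg_left s1 (by linarith : 0 ≤ c)
    have t2 := mul_le_mul_of_nonneg_left s3 (by linarith : 0 ≤ 2 * h)
    calc c * (K * X) ≤ c * (M * (K * Y)) := by gcongr
      _ = M * (c * (K * Y)) := by ring
      _ ≤ _ := by
        refine mul_le_mul_of_nonneg_left ?_ (by linarith)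
        linarith
  have s5 : K * X ≤ c * (K * X) := le_mul_of_one_le_left (by positivity) hc
  have s6 : h * N ≤ M * (h * N) := le_mul_of_one_le_left (by positivity) hM
  have s7 : M * (h ^ 2 * Z) * c ≤ M * (h ^ 2 * Z) * (3 * c ^ 2) := by
    have : c ≤ 3 * c ^ 2 := by nlinarith
    gcongr
  linarith

/-- The Carleman estimate with the convexified weight, for real functions. -/
theorem IsLimitingCarlemanWeight.carleman_weighted (hΩ : IsOpen Ω)
    (hΩb : Bornology.IsBounded Ω) (hΩs : HasSmoothBoundary Ω) (hW : IsOpen W)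
    (hΩW : closure Ω ⊆ W) (hφ : IsLimitingCarlemanWeight W φ) :
    IsFiniteMeasure (surfaceMeasure Ω) ∧ ∃ M : ℝ, 1 ≤ M ∧ ∀ K : ℝ, 0 ≤ K → ∃ Q : ℝ, 1 ≤ Q ∧
      ∃ h₀ > 0, ∀ h : ℝ, 0 < h → h ≤ h₀ → ∃ E : Rn (m + 1) → ℝ,
      ContinuousOn E (closure Ω) ∧
      (∀ x ∈ closure Ω, Real.exp (φ x / h) ^ 2 ≤ E x ∧ E x ≤ Q * Real.exp (φ x / h) ^ 2) ∧
      ∀ u : Rn (m + 1) → ℝ, ContDiffOn ℝ ∞ u (closure Ω) → (∀ x ∈ frontier Ω, u x = 0) →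
        K * (∫ x in Ω, E x * (u x ^ 2 + h ^ 2 * ‖∇ u x‖ ^ 2)) +
          h * (∫ x, max (-normalDerivWeight Ω φ x) 0 * boundaryDensity Ω φ h u x
            ∂surfaceMeasure Ω) ≤
        M * h ^ 2 * (∫ x in Ω, E x * lap u x ^ 2) +
          M * Q * h * (∫ x, max (normalDerivWeight Ω φ x) 0 * boundaryDensity Ω φ h u x
            ∂surfaceMeasure Ω) := by
  obtain ⟨σ, hσf, C, hC, hσS, hSσ, hσ⟩ := exists_boundaryMeasure hΩ hΩb hΩs
  have hCσ : IsFiniteMeasure (C • σ) := ⟨by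
    rw [Measure.smul_apply, smul_eq_mul]
    exact ENNReal.mul_lt_top hC.lt_top (measure_lt_top _ _)⟩
  have hSf : IsFiniteMeasure (surfaceMeasure Ω) := isFiniteMeasure_of_le _ hSσ
  have hS0 : surfaceMeasure Ω (frontier Ω)ᶜ = 0 := by
    rw [surfaceMeasure, Measure.restrict_apply isClosed_frontier.measurableSet.compl]
    simp
  have hσ0 : σ (frontier Ω)ᶜ = 0 := by
    refine le_antisymm ((hσS _).trans ?_) bot_le
    rw [Measure.smul_apply, hS0, smul_zero]
  refine ⟨hSf, ?_⟩
  have hcl : IsCompact (closure Ω) := hΩb.isCompact_closure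
  have hφc : ContDiffOn ℝ ∞ φ (closure Ω) := hφ.contDiffOn.mono hΩW
  have hΦc : ContinuousOn (gradient φ) (closure Ω) :=
    (contDiffOn_gradient hW hφ.contDiffOn).continuousOn.mono hΩW
  obtain ⟨MΦ, hMΦ⟩ := hcl.exists_bound_of_continuousOn hΦc
  obtain ⟨Mφ, hMφ⟩ := hcl.exists_bound_of_continuousOn hφc.continuousOn
  set c : ℝ := C.toReal + 1 with hcdef
  have hc1 : 1 ≤ c := by linarith [ENNReal.toReal_nonneg (a := C)]
  -- This comes from `h e^{ψ/h}∇u = h∇v - v∇ψ`, the bound `|∇ψ| ≤ (3/2)MΦ` and `(x + y)² ≤ 2x² +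
  -- 2y²`.
  set M' : ℝ := 2 + 9 / 2 * MΦ ^ 2 with hM'
  have hM'1 : 1 ≤ M' := by nlinarith [sq_nonneg MΦ]
  -- The constant is fixed before `K`: only `Q` and `h₀` depend on `K`, through `ε`. The later
  -- choice of `K` in terms of this constant is thus not circular.
  refine ⟨3 * M' * c ^ 2, by nlinarith, fun K hK => ?_⟩
  obtain ⟨ε, hε, h₀, hh₀, key⟩ := hφ.carleman_real hΩ hΩb hΩs hσ0 hσ hW hΩW hK
  set Q : ℝ := Real.exp (Mφ ^ 2 / (2 * ε)) ^ 2 with hQdef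
  have hQ1 : 1 ≤ Q := one_le_pow₀ (Real.one_le_exp (by positivity))
  refine ⟨Q, hQ1, h₀, hh₀, fun h hh hhh => ?_⟩
  obtain ⟨-, hkφ, key⟩ := key h hh hhh
  set k := h / ε with hk
  set wt := convWeight φ k h with hω
  have hωc : ContDiffOn ℝ ∞ wt (closure Ω) :=
    Real.contDiff_exp.comp_contDiffOn ((hφc.add ((contDiffOn_const.mul (hφc.pow 2)).div_const 2)).div_const h)
  have hω0 : ∀ x, 0 < wt x := fun x => Real.exp_pos _
  -- As `k/h = 1/ε`, the correction factor does not involve `h`; on the bounded range of `φ` it lies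
  -- between `1` and the square root of `Q`.
  have hωe : ∀ x, wt x = Real.exp (φ x / h) * Real.exp (φ x ^ 2 / (2 * ε)) := fun x => by
    rw [← Real.exp_add, hω, convWeight, hk]
    congr 1
    field_simp
  have hE : ∀ x ∈ closure Ω, Real.exp (φ x / h) ^ 2 ≤ wt x ^ 2 ∧
      wt x ^ 2 ≤ Q * Real.exp (φ x / h) ^ 2 := by
    intro x hx
    have h1 := hMφ x hx
    have h2 : φ x ^ 2 ≤ Mφ ^ 2 := by
      rw [Real.norm_eq_abs] at h1
      exact sq_le_sq' (neg_le_of_abs_le h1) (le_of_abs_le h1)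
    rw [hωe, mul_pow]
    constructor
    · exact le_mul_of_one_le_right (by positivity) (one_le_pow₀ (Real.one_le_exp (by positivity)))
    · rw [mul_comm, hQdef]
      gcongr
  refine ⟨fun x => wt x ^ 2, hωc.continuousOn.pow 2, hE, fun u hu hu0 => ?_⟩
  set v : Rn (m + 1) → ℝ := fun x => wt x * u x with hv
  have hvc : ContDiffOn ℝ ∞ v (closure Ω) := hωc.mul hu
  have key := key v hvc fun x hx => by rw [hv]; simp only [hu0 x hx, mul_zero]
  have hφ2 : ∀ x ∈ Ω, ContDiffAt ℝ 2 φ x := fun x hx =>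
    (hφ.contDiffOn.contDiffAt (hW.mem_nhds (hΩW (subset_closure hx)))).of_le two_le_infty
  have hu2 : ∀ x ∈ Ω, ContDiffAt ℝ 2 u x := fun x hx =>
    ((hu.mono subset_closure).contDiffAt (hΩ.mem_nhds hx)).of_le two_le_infty
  have e1 : ∫ x in Ω, conjLap φ k h v x ^ 2 = h ^ 4 * ∫ x in Ω, wt x ^ 2 * lap u x ^ 2 := by
    rw [← integral_const_mul]
    refine setIntegral_congr_fun hΩ.measurableSet fun x hx => ?_
    simp only [hv]
    rw [hω, conjLap_convWeight_mul (hφ2 x hx) (hu2 x hx) k hh.ne']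
    ring
  have hgu := (contDiffOn_gradClosure hΩ hΩs hu).continuousOn
  have hgv := (contDiffOn_gradClosure hΩ hΩs hvc).continuousOn
  have hωc' := hωc.continuousOn
  have huc' := hu.continuousOn
  have hvc' := hvc.continuousOn
  have e2 : ∫ x in Ω, wt x ^ 2 * (u x ^ 2 + h ^ 2 * ‖∇ u x‖ ^ 2) ≤
      M' * ∫ x in Ω, (v x ^ 2 + h ^ 2 * ‖∇ v x‖ ^ 2) := by
    rw [← integral_const_mul]
    refine setIntegral_mono_on ?_ (Integrable.const_mul ?_ _) hΩ.measurableSet fun x hx => ?_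
    · refine integrableOn_of_continuousOn_closure hΩ hΩb
        (f := fun x => wt x ^ 2 * (u x ^ 2 + h ^ 2 * ‖gradClosure Ω u x‖ ^ 2)) (by fun_prop)
        fun x hx => ?_
      rw [gradClosure_eq hΩ u hx]
    · refine integrableOn_of_continuousOn_closure hΩ hΩb
        (f := fun x => v x ^ 2 + h ^ 2 * ‖gradClosure Ω v x‖ ^ 2) (by fun_prop) fun x hx => ?_
      rw [gradClosure_eq hΩ v hx]
    · have hxc := subset_closure hx
      have hg : ∇ v x = wt x • ∇ u x + (wt x * u x / h) • ((1 + k * φ x) • ∇ φ x) :=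
        gradient_convWeight_mul ((hφ2 x hx).differentiableAt (by simp))
          ((hu2 x hx).differentiableAt (by simp)) k h
      have hg' : (h * wt x) • ∇ u x = h • ∇ v x - v x • ((1 + k * φ x) • ∇ φ x) := by
        rw [hg, hv, smul_add, smul_smul, smul_smul, mul_div_cancel₀ _ hh.ne', add_sub_cancel_right]
      have hak := abs_le.1 (hkφ x hxc)
      have h1 : ‖(1 + k * φ x) • ∇ φ x‖ ≤ 3 / 2 * MΦ := by
        rw [norm_smul]
        refine mul_le_mul ?_ (hMΦ x hxc) (norm_nonneg _) (by norm_num)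
        rw [Real.norm_eq_abs, abs_le]
        constructor <;> linarith
      have h2 : ‖(h * wt x) • ∇ u x‖ ≤ h * ‖∇ v x‖ + |v x| * (3 / 2 * MΦ) := by
        rw [hg']
        refine (norm_sub_le _ _).trans ?_
        rw [norm_smul, norm_smul (v x), Real.norm_of_nonneg hh.le, Real.norm_eq_abs (v x)]
        gcongr
      rw [norm_smul, Real.norm_of_nonneg (by have := hω0 x; positivity)] at h2
      have h3 : (h * wt x * ‖∇ u x‖) ^ 2 ≤ (h * ‖∇ v x‖ + |v x| * (3 / 2 * MΦ)) ^ 2 := by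
        have := hω0 x
        gcongr
      have h4 : (h * ‖∇ v x‖ + |v x| * (3 / 2 * MΦ)) ^ 2 ≤
          2 * (h ^ 2 * ‖∇ v x‖ ^ 2) + 2 * (v x ^ 2 * (3 / 2 * MΦ) ^ 2) := by
        rw [← sq_abs (v x)]
        linarith [sq_nonneg (h * ‖∇ v x‖ - |v x| * (3 / 2 * MΦ))]
      have h5 : wt x ^ 2 * (u x ^ 2 + h ^ 2 * ‖∇ u x‖ ^ 2) =
        v x ^ 2 + (h * wt x * ‖∇ u x‖) ^ 2 := by rw [hv]; ring
      rw [h5, hM']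
      have h6 : 0 ≤ MΦ ^ 2 * (h ^ 2 * ‖∇ v x‖ ^ 2) := by positivity
      linarith [sq_nonneg (v x)]
  have hbv : ∀ x ∈ frontier Ω, fderivWithin ℝ v (closure Ω) x (exteriorNormal Ω x) =
      wt x * fderivWithin ℝ u (closure Ω) x (exteriorNormal Ω x) := by
    intro x hx
    have hxc := frontier_subset_closure hx
    rw [hv, fderivWithin_fun_mul (uniqueDiffOn_closure hΩ hΩs x hxc)
      (hωc.differentiableOn (by simp) x hxc) (hu.differentiableOn (by simp) x hxc), hu0 x hx]
    simp
  have hφf : ContinuousOn φ (frontier Ω) := hφc.continuousOn.mono frontier_subset_closure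
  have hnv : ContinuousOn (fun x => fderivWithin ℝ v (closure Ω) x (exteriorNormal Ω x))
      (frontier Ω) :=
    ((hvc.continuousOn_fderivWithin (uniqueDiffOn_closure hΩ hΩs) (by simp)).mono
      frontier_subset_closure).clm_apply (continuousOn_exteriorNormal hΩ hΩs)
  have hb := integral_boundary_le hΩ hΩb hΩs hσ0 hS0 hC hσS hSσ (c := c) (by linarith)
    (by linarith) hW hΩW hφ.contDiffOn (h := h) (a := fun x => 1 + k * φ x)
    (w := fun x => fderivWithin ℝ v (closure Ω) x (exteriorNormal Ω x) ^ 2) (Q := Q) (by linarith)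
    (fun x hx => by
      have := abs_le.1 (hkφ x (frontier_subset_closure hx))
      constructor <;> linarith) hu
    (fun x hx => by
      have := hE x (frontier_subset_closure hx)
      rw [hbv x hx, mul_pow, boundaryDensity, ← mul_assoc]
      constructor
      · exact mul_le_mul_of_nonneg_right this.1 (sq_nonneg _)
      · exact mul_le_mul_of_nonneg_right this.2 (sq_nonneg _))
    (continuousOn_integrable_of_frontier hΩb hσ0
      (((continuousOn_const.add (continuousOn_const.mul hφf)).mul
        (continuousOn_normalDerivWeight hΩ hΩs hW hΩW hφ.contDiffOn)).mul (hnv.pow 2)))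
  set Bp := ∫ x, max (normalDerivWeight Ω φ x) 0 * boundaryDensity Ω φ h u x ∂surfaceMeasure Ω
  set Bm := ∫ x, max (-normalDerivWeight Ω φ x) 0 * boundaryDensity Ω φ h u x ∂surfaceMeasure Ω
    with hBm
  have hBm0 : 0 ≤ Bm := integral_nonneg fun x =>
    mul_nonneg (le_max_right _ _) (boundaryDensity_nonneg _ _ _)
  rw [e1] at key
  set X := ∫ x in Ω, wt x ^ 2 * (u x ^ 2 + h ^ 2 * ‖∇ u x‖ ^ 2)
  have hX0 : 0 ≤ X := integral_nonneg fun x => by positivity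
  set Y := ∫ x in Ω, (v x ^ 2 + h ^ 2 * ‖∇ v x‖ ^ 2)
  set Z := ∫ x in Ω, wt x ^ 2 * lap u x ^ 2
  have hZ0 : 0 ≤ Z := integral_nonneg fun x => by positivity
  set I := ∫ x, (1 + k * φ x) * normalDerivWeight Ω φ x *
    fderivWithin ℝ v (closure Ω) x (exteriorNormal Ω x) ^ 2 ∂σ
  exact carleman_constants hh hc1 hM'1 hK hX0 hZ0 hBm0 key e2 hb

end Weighted

/-! ### Complex functions and the magnetic operator -/

section ComplexParts

variable {n : ℕ}

theorem fderiv_re_apply {u : Rn n → ℂ} {x : Rn n} (hu : DifferentiableAt ℝ u x) (w : Rn n) :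
    fderiv ℝ (fun y => (u y).re) x w = (fderiv ℝ u x w).re := by
  have h : HasFDerivAt (fun y => (u y).re) (Complex.reCLM.comp (fderiv ℝ u x)) x :=
    Complex.reCLM.hasFDerivAt.comp x hu.hasFDerivAt
  rw [h.fderiv]; rfl

theorem fderiv_im_apply {u : Rn n → ℂ} {x : Rn n} (hu : DifferentiableAt ℝ u x) (w : Rn n) :
    fderiv ℝ (fun y => (u y).im) x w = (fderiv ℝ u x w).im := by
  have h : HasFDerivAt (fun y => (u y).im) (Complex.imCLM.comp (fderiv ℝ u x)) x :=
    Complex.imCLM.hasFDerivAt.comp x hu.hasFDerivAt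
  rw [h.fderiv]; rfl

theorem normSq_fderivWithin_eq {u : Rn n → ℂ} {s : Set (Rn n)} {x : Rn n}
    (hs : UniqueDiffWithinAt ℝ s x) (hu : DifferentiableWithinAt ℝ u s x) (w : Rn n) :
    ‖fderivWithin ℝ u s x w‖ ^ 2 = fderivWithin ℝ (fun y => (u y).re) s x w ^ 2 +
      fderivWithin ℝ (fun y => (u y).im) s x w ^ 2 := by
  have h1 : HasFDerivWithinAt (fun y => (u y).re) (Complex.reCLM.comp (fderivWithin ℝ u s x)) s x :=
    Complex.reCLM.hasFDerivAt.comp_hasFDerivWithinAt x hu.hasFDerivWithinAt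
  have h2 : HasFDerivWithinAt (fun y => (u y).im) (Complex.imCLM.comp (fderivWithin ℝ u s x)) s x :=
    Complex.imCLM.hasFDerivAt.comp_hasFDerivWithinAt x hu.hasFDerivWithinAt
  rw [h1.fderivWithin hs, h2.fderivWithin hs, Complex.sq_norm, Complex.normSq_apply]
  simp only [ContinuousLinearMap.comp_apply, Complex.reCLM_apply, Complex.imCLM_apply]
  ring

theorem sum_normSq_pderiv {u : Rn n → ℂ} {x : Rn n} (hu : DifferentiableAt ℝ u x) :
    ∑ j, ‖pderiv j u x‖ ^ 2 =
      ‖∇ (fun y => (u y).re) x‖ ^ 2 + ‖∇ (fun y => (u y).im) x‖ ^ 2 := by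
  have hc : ∀ (f : Rn n → ℝ) (j : Fin n),
      (∇ f x) j = fderiv ℝ f x (EuclideanSpace.single j 1) := fun f j => by
    rw [← inner_gradient, EuclideanSpace.inner_single_right]
    simp
  rw [EuclideanSpace.norm_sq_eq, EuclideanSpace.norm_sq_eq, ← Finset.sum_add_distrib]
  refine Finset.sum_congr rfl fun j _ => ?_
  rw [hc, hc, fderiv_re_apply hu, fderiv_im_apply hu, pderiv, Complex.sq_norm,
    Complex.normSq_apply, Real.norm_eq_abs, Real.norm_eq_abs, sq_abs, sq_abs]
  ring

theorem pderiv_pderiv_eq {u : Rn n → ℂ} {x : Rn n} (hu : ContDiffAt ℝ 2 u x) (j : Fin n) :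
    pderiv j (pderiv j u) x =
      (inner ℝ (hess (fun y => (u y).re) x (EuclideanSpace.single j 1))
        (EuclideanSpace.single j 1) : ℝ) +
      (inner ℝ (hess (fun y => (u y).im) x (EuclideanSpace.single j 1))
        (EuclideanSpace.single j 1) : ℝ) * Complex.I := by
  have hd : ∀ᶠ y in 𝓝 x, DifferentiableAt ℝ u y := by
    filter_upwards [hu.eventually (by simp)] with y hy using hy.differentiableAt (by simp)
  have hp : DifferentiableAt ℝ (pderiv j u) x :=
    ((hu.fderiv_right (m := 1) (by norm_num)).differentiableAt (by simp)).clm_apply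
      (differentiableAt_const _)
  have hre : ContDiffAt ℝ 2 (fun y => (u y).re) x := Complex.reCLM.contDiff.contDiffAt.comp x hu
  have him : ContDiffAt ℝ 2 (fun y => (u y).im) x := Complex.imCLM.contDiff.contDiffAt.comp x hu
  have key : ∀ f : Rn n → ℝ, ContDiffAt ℝ 2 f x → ∀ w,
      inner ℝ (hess f x w) (EuclideanSpace.single j 1) =
        fderiv ℝ (fun y => fderiv ℝ f y (EuclideanSpace.single j 1)) x w := by
    intro f hf w
    have := fderiv_clm_apply ((hf.fderiv_right (m := 1) (by norm_num)).differentiableAt (by simp))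
      (differentiableAt_const (EuclideanSpace.single j (1 : ℝ)))
    rw [hess, inner_fderiv_gradient hf, this]
    simp
  rw [key _ hre, key _ him]
  have e1 : (fun y => fderiv ℝ (fun z => (u z).re) y (EuclideanSpace.single j 1)) =ᶠ[𝓝 x]
      fun y => (pderiv j u y).re := by
    filter_upwards [hd] with y hy using fderiv_re_apply hy _
  have e2 : (fun y => fderiv ℝ (fun z => (u z).im) y (EuclideanSpace.single j 1)) =ᶠ[𝓝 x]
      fun y => (pderiv j u y).im := by
    filter_upwards [hd] with y hy using fderiv_im_apply hy _
  rw [e1.fderiv_eq, e2.fderiv_eq, fderiv_re_apply hp, fderiv_im_apply hp, Complex.re_add_im]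
  rfl

/-- The first and zeroth order terms of `∑ (D_j + A_j)²`, where `A'` is the derivative of `A`. -/
noncomputable def magneticRest (A : Rn n → Rn n) (A' : Rn n → Rn n →L[ℝ] Rn n)
    (u : Rn n → ℂ) (u' : Rn n → Rn n →L[ℝ] ℂ) (x : Rn n) : ℂ :=
  ∑ j, (-2 * Complex.I * (A x j : ℂ) * u' x (EuclideanSpace.single j 1) +
    (-Complex.I * (A' x (EuclideanSpace.single j 1) j : ℂ) + (A x j : ℂ) ^ 2) * u x)

/-- Expanding the squares gives `-Δ - 2iA·∇ - i div A + |A|² + q`. Only the terms after the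
Laplacian couple real and imaginary parts. -/
theorem magneticSchrodinger_eq {A : Rn n → Rn n} {q u : Rn n → ℂ} {x : Rn n}
    (hA : DifferentiableAt ℝ A x) (hu : ContDiffAt ℝ 2 u x) :
    magneticSchrodinger A q u x =
      -((lap (fun y => (u y).re) x : ℂ) + (lap (fun y => (u y).im) x : ℂ) * Complex.I) +
        magneticRest A (fderiv ℝ A) u (fderiv ℝ u) x + q x * u x := by
  have du : HasFDerivAt u (fderiv ℝ u x) x := (hu.differentiableAt (by simp)).hasFDerivAt
  have hstep : ∀ j, magneticD A j (magneticD A j u) x = -pderiv j (pderiv j u) x +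
      (-2 * Complex.I * (A x j : ℂ) * fderiv ℝ u x (EuclideanSpace.single j 1) +
    (-Complex.I * (fderiv ℝ A x (EuclideanSpace.single j 1) j : ℂ) + (A x j : ℂ) ^ 2) * u x) := by
    intro j
    have hp : HasFDerivAt (pderiv j u) (fderiv ℝ (pderiv j u) x) x :=
      (((hu.fderiv_right (m := 1) (by norm_num)).differentiableAt (by simp)).clm_apply
        (differentiableAt_const _)).hasFDerivAt
    have hAj : HasFDerivAt (fun y => (A y j : ℂ))
        (Complex.ofRealCLM.comp ((EuclideanSpace.proj (𝕜 := ℝ) j).comp (fderiv ℝ A x))) x :=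
      Complex.ofRealCLM.hasFDerivAt.comp x
        ((EuclideanSpace.proj (𝕜 := ℝ) j).hasFDerivAt.comp x hA.hasFDerivAt)
    have hD : HasFDerivAt (magneticD A j u) _ x := (hp.const_mul (-Complex.I)).add (hAj.mul du)
    have e : pderiv j (magneticD A j u) x = -Complex.I * pderiv j (pderiv j u) x +
        ((A x j : ℂ) * pderiv j u x +
          u x * (fderiv ℝ A x (EuclideanSpace.single j 1) j : ℂ)) := by
      rw [pderiv, hD.fderiv]
      rfl
    rw [magneticD, e, magneticD, ← pderiv]
    linear_combination (pderiv j (pderiv j u) x) * Complex.I_mul_I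
  rw [magneticSchrodinger, Finset.sum_congr rfl fun j _ => hstep j, Finset.sum_add_distrib,
    magneticRest]
  congr 2
  rw [Finset.sum_neg_distrib, Finset.sum_congr rfl fun j _ => pderiv_pderiv_eq hu j,
    Finset.sum_add_distrib, ← Finset.sum_mul, lap, lap, tr, tr]
  push_cast
  rfl

/-- The triangle inequality, the Cauchy–Schwarz inequality for the sum over `j`, and `(x + y)² ≤ 2x²
+ 2y²`. -/
theorem normSq_magneticRest_add_le {A : Rn n → Rn n} {A' : Rn n → Rn n →L[ℝ] Rn n}
    {q u : Rn n → ℂ} {u' : Rn n → Rn n →L[ℝ] ℂ} {x : Rn n} {M : ℝ}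
    (hA : ‖A x‖ ≤ M) (hA' : ‖A' x‖ ≤ M) (hq : ‖q x‖ ≤ M) :
    ‖magneticRest A A' u u' x + q x * u x‖ ^ 2 ≤
      2 * (2 * M) ^ 2 * n * (∑ j, ‖u' x (EuclideanSpace.single j 1)‖ ^ 2) +
        2 * (n * (M + M ^ 2) + M) ^ 2 * ‖u x‖ ^ 2 := by
  have hAj : ∀ j, ‖(A x j : ℂ)‖ ≤ M := fun j => by
    rw [Complex.norm_real]
    exact (PiLp.norm_apply_le (A x) j).trans hA
  have hA'j : ∀ j, ‖(A' x (EuclideanSpace.single j 1) j : ℂ)‖ ≤ M := fun j => by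
    rw [Complex.norm_real]
    refine (PiLp.norm_apply_le _ j).trans (((A' x).le_opNorm _).trans ?_)
    simpa using hA'
  have h1 : ‖magneticRest A A' u u' x‖ ≤
      2 * M * (∑ j, ‖u' x (EuclideanSpace.single j 1)‖) + n * (M + M ^ 2) * ‖u x‖ := by
    have : ∀ j ∈ (Finset.univ : Finset (Fin n)),
        ‖-2 * Complex.I * (A x j : ℂ) * u' x (EuclideanSpace.single j 1) +
        (-Complex.I * (A' x (EuclideanSpace.single j 1) j : ℂ) + (A x j : ℂ) ^ 2) * u x‖ ≤
        2 * M * ‖u' x (EuclideanSpace.single j 1)‖ + (M + M ^ 2) * ‖u x‖ := by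
      intro j _
      refine (norm_add_le _ _).trans (add_le_add ?_ ?_)
      · rw [norm_mul, norm_mul, norm_mul, norm_neg, Complex.norm_I, Complex.norm_ofNat, mul_one]
        gcongr
        exact hAj j
      · rw [norm_mul]
        gcongr
        refine (norm_add_le _ _).trans (add_le_add ?_ ?_)
        · rw [norm_mul, norm_neg, Complex.norm_I, one_mul]
          exact hA'j j
        · rw [norm_pow]
          gcongr
          exact hAj j
    refine (norm_sum_le_of_le _ this).trans (le_of_eq ?_)
    rw [Finset.sum_add_distrib, ← Finset.mul_sum, Finset.sum_const, Finset.card_univ,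
      Fintype.card_fin, nsmul_eq_mul]
    ring
  set s := ∑ j, ‖u' x (EuclideanSpace.single j 1)‖ with hs
  have hs2 : s ^ 2 ≤ n * ∑ j, ‖u' x (EuclideanSpace.single j 1)‖ ^ 2 := by
    have := sq_sum_le_card_mul_sum_sq (s := (Finset.univ : Finset (Fin n)))
      (f := fun j => ‖u' x (EuclideanSpace.single j 1)‖)
    simpa using this
  have h2 : ‖magneticRest A A' u u' x + q x * u x‖ ≤
      2 * M * s + (n * (M + M ^ 2) + M) * ‖u x‖ := by
    refine (norm_add_le _ _).trans ?_
    rw [norm_mul]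
    have := mul_le_mul_of_nonneg_right hq (norm_nonneg (u x))
    linarith
  have h3 : (2 * M) ^ 2 * s ^ 2 ≤
      (2 * M) ^ 2 * (n * ∑ j, ‖u' x (EuclideanSpace.single j 1)‖ ^ 2) := by gcongr
  calc _ ≤ (2 * M * s + (n * (M + M ^ 2) + M) * ‖u x‖) ^ 2 := by gcongr
    _ ≤ 2 * (2 * M) ^ 2 * s ^ 2 + 2 * (n * (M + M ^ 2) + M) ^ 2 * ‖u x‖ ^ 2 := by
      linarith [sq_nonneg (2 * M * s - (n * (M + M ^ 2) + M) * ‖u x‖)]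
    _ ≤ _ := by linarith

theorem exists_ae_norm_le {α : Type*} {mα : MeasurableSpace α} {μ : Measure α} {q : α → ℂ}
    (hq : MemLp q ⊤ μ) : ∃ M : ℝ, ∀ᵐ x ∂μ, ‖q x‖ ≤ M := by
  refine ⟨(eLpNorm q ⊤ μ).toReal, ?_⟩
  filter_upwards [ae_le_eLpNormEssSup (f := q) (μ := μ)] with x hx
  rw [← eLpNorm_exponent_top] at hx
  have := ENNReal.toReal_mono hq.eLpNorm_lt_top.ne hx
  simpa using this

end ComplexParts

/-! ### The terms of the estimate, split into real and imaginary parts -/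

section Final

variable {m : ℕ} {Ω W : Set (Rn (m + 1))} {φ : Rn (m + 1) → ℝ} {u : Rn (m + 1) → ℂ}

theorem contDiffOn_re (hu : ContDiffOn ℝ ∞ u (closure Ω)) :
    ContDiffOn ℝ ∞ (fun x => (u x).re) (closure Ω) :=
  Complex.reCLM.contDiff.comp_contDiffOn hu

theorem contDiffOn_im (hu : ContDiffOn ℝ ∞ u (closure Ω)) :
    ContDiffOn ℝ ∞ (fun x => (u x).im) (closure Ω) :=
  Complex.imCLM.contDiff.comp_contDiffOn hu

theorem contDiffAt_two_of_closure (hΩ : IsOpen Ω) (hu : ContDiffOn ℝ ∞ u (closure Ω))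
    {x : Rn (m + 1)} (hx : x ∈ Ω) : ContDiffAt ℝ 2 u x :=
  ((hu.mono subset_closure).contDiffAt (hΩ.mem_nhds hx)).of_le two_le_infty

theorem differentiableAt_of_closure (hΩ : IsOpen Ω) {A : Rn (m + 1) → Rn (m + 1)}
    (hA : ContDiffOn ℝ 1 A (closure Ω)) {x : Rn (m + 1)} (hx : x ∈ Ω) :
    DifferentiableAt ℝ A x :=
  ((hA.mono subset_closure).contDiffAt (hΩ.mem_nhds hx)).differentiableAt (by simp)

/-- All terms except `qu` extend continuously to the compact closure, and `qu` is a product of an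
`L^∞` and an `L²` function. -/
theorem memLp_magneticSchrodinger (hΩ : IsOpen Ω) (hΩb : Bornology.IsBounded Ω)
    (hΩs : HasSmoothBoundary Ω) {A : Rn (m + 1) → Rn (m + 1)} (hA : ContDiffOn ℝ 1 A (closure Ω))
    {q : Rn (m + 1) → ℂ} (hq : MemLp q ⊤ (volume.restrict Ω))
    (hu : ContDiffOn ℝ ∞ u (closure Ω)) :
    MemLp (magneticSchrodinger A q u) 2 (volume.restrict Ω) := by
  have hU := uniqueDiffOn_closure hΩ hΩs
  have cl : ∀ f : Rn (m + 1) → ℝ, ContDiffOn ℝ ∞ f (closure Ω) →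
      ContinuousOn (fun x => tr (fderivWithin ℝ (gradClosure Ω f) (closure Ω) x)) (closure Ω) :=
    fun f hf => continuous_tr.comp_continuousOn
      ((contDiffOn_gradClosure hΩ hΩs hf).continuousOn_fderivWithin hU (by simp))
  have c1 := Complex.continuous_ofReal.comp_continuousOn (cl _ (contDiffOn_re hu))
  have c2 := Complex.continuous_ofReal.comp_continuousOn (cl _ (contDiffOn_im hu))
  have c3 : ContinuousOn (magneticRest A (fderivWithin ℝ A (closure Ω)) u
      (fderivWithin ℝ u (closure Ω))) (closure Ω) := by
    have d1 := hA.continuousOn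
    have d2 := hA.continuousOn_fderivWithin hU le_rfl
    have d3 := hu.continuousOn
    have d4 := hu.continuousOn_fderivWithin hU (by simp)
    have hj : ∀ j : Fin (m + 1), Continuous fun y : Rn (m + 1) => (y j : ℂ) := fun j =>
      Complex.continuous_ofReal.comp (EuclideanSpace.proj (𝕜 := ℝ) j).continuous
    refine continuousOn_finsetSum _ fun j _ => ?_
    have e1 : ContinuousOn (fun x => (A x j : ℂ)) (closure Ω) := (hj j).comp_continuousOn d1
    have e2 : ContinuousOn
        (fun x => (fderivWithin ℝ A (closure Ω) x (EuclideanSpace.single j 1) j : ℂ))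
        (closure Ω) := (hj j).comp_continuousOn (d2.clm_apply continuousOn_const)
    have e3 : ContinuousOn (fun x => fderivWithin ℝ u (closure Ω) x (EuclideanSpace.single j 1))
        (closure Ω) := d4.clm_apply continuousOn_const
    exact ((continuousOn_const.mul e1).mul e3).add
      (((continuousOn_const.mul e2).add (e1.pow 2)).mul d3)
  have h1 := memLp_of_continuousOn_closure hΩ hΩb
    (((c1.add (c2.mul (continuousOn_const (c := Complex.I)))).neg).add c3) fun x _ => rfl
  have h2 : MemLp (q * u) 2 (volume.restrict Ω) :=
    (memLp_of_continuousOn_closure hΩ hΩb hu.continuousOn fun x _ => rfl).mul hq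
  refine (h1.add h2).ae_eq ?_
  filter_upwards [ae_restrict_mem hΩ.measurableSet] with x hx
  rw [magneticSchrodinger_eq (differentiableAt_of_closure hΩ hA hx)
    (contDiffAt_two_of_closure hΩ hu hx), lap, lap, hess_eq_fderivWithin_gradClosure hΩ _ hx,
    hess_eq_fderivWithin_gradClosure hΩ _ hx]
  simp only [Pi.add_apply, Pi.neg_apply, Pi.mul_apply, Function.comp_apply, magneticRest,
    fderivWithin_closure_eq hΩ A hx, fderivWithin_closure_eq hΩ u hx]

/-- The Laplacian is controlled by the magnetic Schrödinger operator. -/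
theorem exists_lap_sq_le (hΩ : IsOpen Ω) (hΩb : Bornology.IsBounded Ω)
    (hΩs : HasSmoothBoundary Ω) {A : Rn (m + 1) → Rn (m + 1)} (hA : ContDiffOn ℝ 1 A (closure Ω))
    {q : Rn (m + 1) → ℂ} (hq : MemLp q ⊤ (volume.restrict Ω)) :
    ∃ b : ℝ, 0 ≤ b ∧ ∀ᵐ x ∂volume.restrict Ω, ∀ u : Rn (m + 1) → ℂ,
      ContDiffOn ℝ ∞ u (closure Ω) →
      lap (fun y => (u y).re) x ^ 2 + lap (fun y => (u y).im) x ^ 2 ≤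
        2 * ‖magneticSchrodinger A q u x‖ ^ 2 +
          b * (‖u x‖ ^ 2 + (‖∇ (fun y => (u y).re) x‖ ^ 2 + ‖∇ (fun y => (u y).im) x‖ ^ 2)) := by
  have hS : IsCompact (closure Ω) := hΩb.isCompact_closure
  obtain ⟨M1, h1⟩ := hS.exists_bound_of_continuousOn hA.continuousOn
  obtain ⟨M2, h2⟩ := hS.exists_bound_of_continuousOn
    (hA.continuousOn_fderivWithin (uniqueDiffOn_closure hΩ hΩs) le_rfl)
  obtain ⟨M3, h3⟩ := exists_ae_norm_le hq
  set M := max M1 (max M2 M3)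
  set b1 : ℝ := 2 * (2 * M) ^ 2 * ((m + 1 : ℕ) : ℝ)
  set b2 : ℝ := 2 * (((m + 1 : ℕ) : ℝ) * (M + M ^ 2) + M) ^ 2
  have hb1 : 0 ≤ b1 := by positivity
  have hb2 : 0 ≤ b2 := by positivity
  refine ⟨2 * (b1 + b2), by positivity, ?_⟩
  -- The exceptional null set comes from `q` alone, so it serves all `u` at once.
  filter_upwards [ae_restrict_mem hΩ.measurableSet, h3] with x hx hq3 u hu
  have hxc := subset_closure hx
  have hA2 := h2 x hxc
  rw [fderivWithin_closure_eq hΩ A hx] at hA2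
  have hc := contDiffAt_two_of_closure hΩ hu hx
  have hd := differentiableAt_of_closure hΩ hA hx
  have key := normSq_magneticRest_add_le (A' := fderiv ℝ A) (u := u) (u' := fderiv ℝ u)
    ((h1 x hxc).trans (le_max_left _ _))
    (hA2.trans ((le_max_left _ _).trans (le_max_right _ _)))
    (hq3.trans ((le_max_right M2 M3).trans (le_max_right _ _)))
  have hs := sum_normSq_pderiv (hc.differentiableAt (by simp))
  simp only [pderiv] at hs
  rw [hs] at key
  have heq := magneticSchrodinger_eq (q := q) hd hc
  set R := magneticRest A (fderiv ℝ A) u (fderiv ℝ u) x + q x * u x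
  set L := magneticSchrodinger A q u x
  set l1 := lap (fun y => (u y).re) x
  set l2 := lap (fun y => (u y).im) x
  set g := ‖∇ (fun y => (u y).re) x‖ ^ 2 + ‖∇ (fun y => (u y).im) x‖ ^ 2
  have hg : 0 ≤ g := by positivity
  have h5 : (l1 : ℂ) + (l2 : ℂ) * Complex.I = R - L := by
    rw [heq]; ring
  have h6 : l1 ^ 2 + l2 ^ 2 = ‖R - L‖ ^ 2 := by
    rw [← h5, Complex.sq_norm, Complex.normSq_add_mul_I]
  have h7 : ‖R - L‖ ^ 2 ≤ (‖R‖ + ‖L‖) ^ 2 := by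
    gcongr
    exact norm_sub_le _ _
  rw [h6]
  have h8 : 0 ≤ b1 * ‖u x‖ ^ 2 := by positivity
  have h9 : 0 ≤ b2 * g := by positivity
  linarith [sq_nonneg (‖R‖ - ‖L‖)]

theorem isClosed_boundaryPlus (hΩ : IsOpen Ω) (hΩs : HasSmoothBoundary Ω) (hW : IsOpen W)
    (hΩW : closure Ω ⊆ W) (hφ : ContDiffOn ℝ ∞ φ W) : IsClosed (boundaryPlus Ω φ) :=
  (continuousOn_normalDerivWeight hΩ hΩs hW hΩW hφ).preimage_isClosed_of_isClosed
    isClosed_frontier isClosed_Ici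

theorem isClosed_boundaryMinus (hΩ : IsOpen Ω) (hΩs : HasSmoothBoundary Ω) (hW : IsOpen W)
    (hΩW : closure Ω ⊆ W) (hφ : ContDiffOn ℝ ∞ φ W) : IsClosed (boundaryMinus Ω φ) :=
  (continuousOn_normalDerivWeight hΩ hΩs hW hΩW hφ).neg.preimage_isClosed_of_isClosed
    isClosed_frontier isClosed_Ici

theorem normSq_weighted_normalDeriv (hΩ : IsOpen Ω) (hΩs : HasSmoothBoundary Ω) (h : ℝ)
    (hu : ContDiffOn ℝ ∞ u (closure Ω)) {x : Rn (m + 1)} (hx : x ∈ frontier Ω) :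
    ‖(Real.exp (φ x / h) : ℂ) * normalDeriv Ω u x‖ ^ 2 =
      boundaryDensity Ω φ h (fun y => (u y).re) x + boundaryDensity Ω φ h (fun y => (u y).im) x := by
  have hxc := frontier_subset_closure hx
  rw [norm_mul, mul_pow, normalDeriv, normSq_fderivWithin_eq (uniqueDiffOn_closure hΩ hΩs x hxc)
    (hu.differentiableOn (by simp) x hxc), Complex.norm_real, Real.norm_eq_abs, sq_abs,
    boundaryDensity, boundaryDensity]
  ring

theorem ae_mem_frontier : ∀ᵐ x ∂surfaceMeasure Ω, x ∈ frontier Ω :=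
  ae_restrict_mem isClosed_frontier.measurableSet

/-- On `∂Ω₊` the factor `∂_νφ` is its own positive part, which vanishes on the rest of the boundary.
The integral over a subset thus becomes one over the whole boundary. -/
theorem boundaryForm_boundaryPlus (hΩ : IsOpen Ω) (hΩb : Bornology.IsBounded Ω)
    (hΩs : HasSmoothBoundary Ω) [IsFiniteMeasure (surfaceMeasure Ω)] (hW : IsOpen W)
    (hΩW : closure Ω ⊆ W) (hφ : ContDiffOn ℝ ∞ φ W) (h : ℝ) (hu : ContDiffOn ℝ ∞ u (closure Ω)) :
    boundaryForm Ω φ h u (boundaryPlus Ω φ) =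
      (∫ x, max (normalDerivWeight Ω φ x) 0 * boundaryDensity Ω φ h (fun y => (u y).re) x
        ∂surfaceMeasure Ω) +
      ∫ x, max (normalDerivWeight Ω φ x) 0 * boundaryDensity Ω φ h (fun y => (u y).im) x
        ∂surfaceMeasure Ω := by
  have c1 := continuousOn_normalDerivWeight hΩ hΩs hW hΩW hφ
  have i : ∀ f : Rn (m + 1) → ℝ, ContDiffOn ℝ ∞ f (closure Ω) →
      Integrable (fun x => max (normalDerivWeight Ω φ x) 0 * boundaryDensity Ω φ h f x)
        (surfaceMeasure Ω) := fun f hf =>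
    continuousOn_integrable_of_frontier hΩb ae_mem_frontier ((c1.sup continuousOn_const).mul
      (continuousOn_boundaryDensity hΩ hΩs hΩW hφ h hf))
  rw [← integral_add (i _ (contDiffOn_re hu)) (i _ (contDiffOn_im hu)), boundaryForm,
    ← integral_indicator (isClosed_boundaryPlus hΩ hΩs hW hΩW hφ).measurableSet]
  refine integral_congr_ae ?_
  filter_upwards [ae_mem_frontier] with x hx
  rw [← mul_add, ← normSq_weighted_normalDeriv hΩ hΩs h hu hx]
  by_cases hp : 0 ≤ normalDerivWeight Ω φ x
  · rw [indicator_of_mem (show x ∈ boundaryPlus Ω φ from ⟨hx, hp⟩), max_eq_left hp]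
  · rw [indicator_of_notMem (fun hx' : x ∈ boundaryPlus Ω φ => hp hx'.2),
      max_eq_right (not_le.1 hp).le, zero_mul]

theorem boundaryForm_boundaryMinus (hΩ : IsOpen Ω) (hΩb : Bornology.IsBounded Ω)
    (hΩs : HasSmoothBoundary Ω) [IsFiniteMeasure (surfaceMeasure Ω)] (hW : IsOpen W)
    (hΩW : closure Ω ⊆ W) (hφ : ContDiffOn ℝ ∞ φ W) (h : ℝ) (hu : ContDiffOn ℝ ∞ u (closure Ω)) :
    -boundaryForm Ω φ h u (boundaryMinus Ω φ) =
      (∫ x, max (-normalDerivWeight Ω φ x) 0 * boundaryDensity Ω φ h (fun y => (u y).re) x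
        ∂surfaceMeasure Ω) +
      ∫ x, max (-normalDerivWeight Ω φ x) 0 * boundaryDensity Ω φ h (fun y => (u y).im) x
        ∂surfaceMeasure Ω := by
  have c1 := continuousOn_normalDerivWeight hΩ hΩs hW hΩW hφ
  have i : ∀ f : Rn (m + 1) → ℝ, ContDiffOn ℝ ∞ f (closure Ω) →
      Integrable (fun x => max (-normalDerivWeight Ω φ x) 0 * boundaryDensity Ω φ h f x)
        (surfaceMeasure Ω) := fun f hf =>
    continuousOn_integrable_of_frontier hΩb ae_mem_frontier ((c1.neg.sup continuousOn_const).mul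
      (continuousOn_boundaryDensity hΩ hΩs hΩW hφ h hf))
  rw [← integral_add (i _ (contDiffOn_re hu)) (i _ (contDiffOn_im hu)), boundaryForm,
    ← integral_indicator (isClosed_boundaryMinus hΩ hΩs hW hΩW hφ).measurableSet, ← integral_neg]
  refine integral_congr_ae ?_
  filter_upwards [ae_mem_frontier] with x hx
  rw [← mul_add, ← normSq_weighted_normalDeriv hΩ hΩs h hu hx]
  by_cases hp : 0 ≤ -normalDerivWeight Ω φ x
  · rw [indicator_of_mem (show x ∈ boundaryMinus Ω φ from ⟨hx, hp⟩), max_eq_left hp, neg_mul]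
  · rw [indicator_of_notMem (fun hx' : x ∈ boundaryMinus Ω φ => hp hx'.2),
      max_eq_right (not_le.1 hp).le, zero_mul, neg_zero]

/-- The sum of the weighted `L²` norms of `u` and `h∇u` as one integral. -/
theorem normSq_add_sum_normSq (hΩ : IsOpen Ω) (hΩb : Bornology.IsBounded Ω)
    (hΩs : HasSmoothBoundary Ω) (hφ : ContinuousOn φ (closure Ω)) (h : ℝ)
    (hu : ContDiffOn ℝ ∞ u (closure Ω)) :
    normSq Ω (fun x => (Real.exp (φ x / h) : ℂ) * u x) +
      ∑ j, normSq Ω (fun x => (Real.exp (φ x / h) : ℂ) * ((h : ℂ) * pderiv j u x)) =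
    ∫ x in Ω, Real.exp (φ x / h) ^ 2 * (‖u x‖ ^ 2 +
      h ^ 2 * (‖∇ (fun y => (u y).re) x‖ ^ 2 + ‖∇ (fun y => (u y).im) x‖ ^ 2)) := by
  have c1 : ContinuousOn (fun x => (Real.exp (φ x / h) : ℂ)) (closure Ω) :=
    Complex.continuous_ofReal.comp_continuousOn
      (Real.continuous_exp.comp_continuousOn (hφ.div_const h))
  have i1 : IntegrableOn (fun x => ‖(Real.exp (φ x / h) : ℂ) * u x‖ ^ 2) Ω :=
    integrableOn_of_continuousOn_closure hΩ hΩb ((c1.mul hu.continuousOn).norm.pow 2)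
      fun x _ => rfl
  have i2 : ∀ j, IntegrableOn
      (fun x => ‖(Real.exp (φ x / h) : ℂ) * ((h : ℂ) * pderiv j u x)‖ ^ 2) Ω := fun j =>
    integrableOn_of_continuousOn_closure hΩ hΩb
      ((c1.mul ((continuousOn_const (c := (h : ℂ))).mul
        ((hu.continuousOn_fderivWithin (uniqueDiffOn_closure hΩ hΩs) (by simp)).clm_apply
          (continuousOn_const (c := EuclideanSpace.single j (1 : ℝ)))))).norm.pow 2)
      fun x hx => by
        simp only [Pi.pow_apply, Pi.mul_apply, pderiv, fderivWithin_closure_eq hΩ u hx]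
  simp only [normSq]
  rw [← integral_finsetSum _ fun j _ => i2 j,
    ← integral_add i1 (integrable_finsetSum _ fun j _ => i2 j)]
  refine setIntegral_congr_fun hΩ.measurableSet fun x hx => ?_
  beta_reduce
  rw [← sum_normSq_pderiv ((contDiffAt_two_of_closure hΩ hu hx).differentiableAt (by simp))]
  simp only [norm_mul, mul_pow, Complex.norm_real, Real.norm_eq_abs, sq_abs]
  rw [← Finset.mul_sum, ← Finset.mul_sum]
  ring

end Final

end Carleman


/-! ### Absorption of the lower order terms -/

theorem proposition2p3 (n : ℕ) (hn : 3 ≤ n)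
    (Ω W : Set (Carleman.Rn n)) (hΩ : IsOpen Ω) (hΩb : Bornology.IsBounded Ω)
    (hΩs : Carleman.HasSmoothBoundary Ω) (hW : IsOpen W) (hΩW : closure Ω ⊆ W)
    (φ : Carleman.Rn n → ℝ) (hφ : Carleman.IsLimitingCarlemanWeight W φ)
    (A : Carleman.Rn n → Carleman.Rn n) (hA : ContDiffOn ℝ 1 A (closure Ω))
    (q : Carleman.Rn n → ℂ) (hq : MemLp q ∞ (volume.restrict Ω)) :
    ∃ C > (0 : ℝ), ∃ h₀ > (0 : ℝ), ∀ h : ℝ, 0 < h → h ≤ h₀ →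
      ∀ u : Carleman.Rn n → ℂ, ContDiffOn ℝ ∞ u (closure Ω) → Carleman.MemH10 Ω u →
        -h * Carleman.boundaryForm Ω φ h u (Carleman.boundaryMinus Ω φ)
          + Carleman.normSq Ω (fun x => (Real.exp (φ x / h) : ℂ) * u x)
          + ∑ j, Carleman.normSq Ω
              (fun x => (Real.exp (φ x / h) : ℂ) * ((h : ℂ) * Carleman.pderiv j u x))
        ≤ C * (h ^ 2 * Carleman.normSq Ω
              (fun x => (Real.exp (φ x / h) : ℂ) * Carleman.magneticSchrodinger A q u x)
            + h * Carleman.boundaryForm Ω φ h u (Carleman.boundaryPlus Ω φ)) := by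
  obtain ⟨m, rfl⟩ : ∃ m, n = m + 1 := ⟨n - 1, by omega⟩
  obtain ⟨hSf, M, hM, key⟩ := hφ.carleman_weighted hΩ hΩb hΩs hW hΩW
  obtain ⟨b, hb, hlap⟩ := Carleman.exists_lap_sq_le hΩ hΩb hΩs hA hq
  -- `Mb` copies of the energy are spent on the first and zeroth order terms of the operator, and
  -- one copy is left for the left side.
  obtain ⟨Q, hQ, h₀, hh₀, key⟩ := key (M * b + 1) (by positivity)
  refine ⟨2 * M * Q, by positivity, min h₀ 1, by positivity, fun h hh hhh u hu hu0 => ?_⟩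
  have hh1 : h ≤ 1 := hhh.trans (min_le_right _ _)
  obtain ⟨E, hEc, hE, key⟩ := key h hh (hhh.trans (min_le_left _ _))
  have hφc : ContDiffOn ℝ ∞ φ (closure Ω) := hφ.contDiffOn.mono hΩW
  have hu0 := hu0.eq_zero_on_frontier hΩ hΩb hΩs hu
  have hr := Carleman.contDiffOn_re hu
  have hi := Carleman.contDiffOn_im hu
  have kr := key _ hr fun x hx => by rw [hu0 x hx, Complex.zero_re]
  have ki := key _ hi fun x hx => by rw [hu0 x hx, Complex.zero_im]
  have bP := Carleman.boundaryForm_boundaryPlus hΩ hΩb hΩs hW hΩW hφ.contDiffOn h hu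
  have bM := Carleman.boundaryForm_boundaryMinus hΩ hΩb hΩs hW hΩW hφ.contDiffOn h hu
  have hN := Carleman.normSq_add_sum_normSq hΩ hΩb hΩs hφc.continuousOn h hu
  have gr := (Carleman.contDiffOn_gradClosure hΩ hΩs hr).continuousOn
  have gi := (Carleman.contDiffOn_gradClosure hΩ hΩs hi).continuousOn
  have hrc := hr.continuousOn
  have hic := hi.continuousOn
  have huc := hu.continuousOn
  have hlc : ∀ f : Carleman.Rn (m + 1) → ℝ, ContDiffOn ℝ ∞ f (closure Ω) →
      IntegrableOn (fun x => E x * Carleman.lap f x ^ 2) Ω := fun f hf =>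
    Carleman.integrableOn_of_continuousOn_closure hΩ hΩb
      (hEc.mul ((Carleman.continuous_tr.comp_continuousOn
        ((Carleman.contDiffOn_gradClosure hΩ hΩs hf).continuousOn_fderivWithin
          (Carleman.uniqueDiffOn_closure hΩ hΩs) (by simp))).pow 2))
      fun x hx => by
        rw [Carleman.lap, Carleman.hess_eq_fderivWithin_gradClosure hΩ f hx]
        rfl
  have ir : IntegrableOn (fun x => E x * ((u x).re ^ 2 +
      h ^ 2 * ‖∇ (fun y => (u y).re) x‖ ^ 2)) Ω :=
    Carleman.integrableOn_of_continuousOn_closure hΩ hΩb (f := fun x => E x * ((u x).re ^ 2 +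
      h ^ 2 * ‖Carleman.gradClosure Ω (fun y => (u y).re) x‖ ^ 2)) (by fun_prop)
      fun x hx => by rw [Carleman.gradClosure_eq hΩ _ hx]
  have ii : IntegrableOn (fun x => E x * ((u x).im ^ 2 +
      h ^ 2 * ‖∇ (fun y => (u y).im) x‖ ^ 2)) Ω :=
    Carleman.integrableOn_of_continuousOn_closure hΩ hΩb (f := fun x => E x * ((u x).im ^ 2 +
      h ^ 2 * ‖Carleman.gradClosure Ω (fun y => (u y).im) x‖ ^ 2)) (by fun_prop)
      fun x hx => by rw [Carleman.gradClosure_eq hΩ _ hx]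
  have hL2 : IntegrableOn (fun x => ‖Carleman.magneticSchrodinger A q u x‖ ^ 2) Ω :=
    (Carleman.memLp_magneticSchrodinger hΩ hΩb hΩs hA hq hu).integrable_norm_pow two_ne_zero
  have hmul : ∀ w : Carleman.Rn (m + 1) → ℝ, ContinuousOn w (closure Ω) →
      IntegrableOn (fun x => w x * ‖Carleman.magneticSchrodinger A q u x‖ ^ 2) Ω := fun w hw => by
    obtain ⟨B, hB⟩ := hΩb.isCompact_closure.exists_bound_of_continuousOn hw
    refine Integrable.bdd_mul (c := B) hL2
      ((hw.mono subset_closure).aestronglyMeasurable hΩ.measurableSet) ?_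
    filter_upwards [ae_restrict_mem hΩ.measurableSet] with x hx using hB x (subset_closure hx)
  have hec : ContinuousOn (fun x => Real.exp (φ x / h) ^ 2) (closure Ω) :=
    (Real.continuous_exp.comp_continuousOn (hφc.continuousOn.div_const h)).pow 2
  have hsq : ∀ x, ‖u x‖ ^ 2 = (u x).re ^ 2 + (u x).im ^ 2 := fun x => by
    rw [Complex.sq_norm, Complex.normSq_apply]; ring
  have hE0 : ∀ x ∈ Ω, 0 ≤ E x := fun x hx =>
    (by positivity : 0 ≤ Real.exp (φ x / h) ^ 2).trans (hE x (subset_closure hx)).1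
  have hX := integral_add ir ii
  have iX : IntegrableOn (fun x => E x * ((u x).re ^ 2 + h ^ 2 * ‖∇ (fun y => (u y).re) x‖ ^ 2) +
        E x * ((u x).im ^ 2 + h ^ 2 * ‖∇ (fun y => (u y).im) x‖ ^ 2)) Ω := ir.add ii
  have hY : ∫ x in Ω, Real.exp (φ x / h) ^ 2 * (‖u x‖ ^ 2 +
      h ^ 2 * (‖∇ (fun y => (u y).re) x‖ ^ 2 + ‖∇ (fun y => (u y).im) x‖ ^ 2)) ≤
      ∫ x in Ω, (E x * ((u x).re ^ 2 + h ^ 2 * ‖∇ (fun y => (u y).re) x‖ ^ 2) +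
        E x * ((u x).im ^ 2 + h ^ 2 * ‖∇ (fun y => (u y).im) x‖ ^ 2)) := by
    refine setIntegral_mono_on ?_ iX hΩ.measurableSet fun x hx => ?_
    · refine Carleman.integrableOn_of_continuousOn_closure hΩ hΩb
        (f := fun x => Real.exp (φ x / h) ^ 2 * (‖u x‖ ^ 2 + h ^ 2 *
          (‖Carleman.gradClosure Ω (fun y => (u y).re) x‖ ^ 2 +
            ‖Carleman.gradClosure Ω (fun y => (u y).im) x‖ ^ 2))) (by fun_prop) fun x hx => ?_
      rw [Carleman.gradClosure_eq hΩ _ hx, Carleman.gradClosure_eq hΩ _ hx]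
    · rw [← mul_add, hsq]
      refine (mul_le_mul_of_nonneg_right (hE x (subset_closure hx)).1 (by positivity)).trans
        (le_of_eq ?_)
      ring
  -- The factor `h²` turns `b(|u|² + |∇u|²)` into at most `b(|u|² + h²|∇u|²)`, because `h ≤ 1`.
  have hZ : h ^ 2 * ((∫ x in Ω, E x * Carleman.lap (fun y => (u y).re) x ^ 2) +
      ∫ x in Ω, E x * Carleman.lap (fun y => (u y).im) x ^ 2) ≤
      2 * h ^ 2 * (∫ x in Ω, E x * ‖Carleman.magneticSchrodinger A q u x‖ ^ 2) +
      b * ∫ x in Ω, (E x * ((u x).re ^ 2 + h ^ 2 * ‖∇ (fun y => (u y).re) x‖ ^ 2) +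
        E x * ((u x).im ^ 2 + h ^ 2 * ‖∇ (fun y => (u y).im) x‖ ^ 2)) := by
    rw [← integral_add (hlc _ hr) (hlc _ hi), ← integral_const_mul, ← integral_const_mul,
      ← integral_const_mul, ← integral_add ((hmul E hEc).const_mul _) (iX.const_mul _)]
    refine integral_mono_ae (((hlc _ hr).add (hlc _ hi)).const_mul _)
      (((hmul E hEc).const_mul _).add (iX.const_mul _)) ?_
    filter_upwards [ae_restrict_mem hΩ.measurableSet, hlap] with x hx hlapx
    have h1 := mul_le_mul_of_nonneg_left (hlapx u hu)
      (mul_nonneg (sq_nonneg h) (hE0 x hx))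
    have h2 : 0 ≤ b * E x * ((1 - h ^ 2) * ‖u x‖ ^ 2) := by
      have h3 : 0 ≤ 1 - h ^ 2 := by nlinarith
      have := hE0 x hx
      positivity
    rw [hsq] at h1 h2
    linarith
  have hV : ∫ x in Ω, E x * ‖Carleman.magneticSchrodinger A q u x‖ ^ 2 ≤
      Q * Carleman.normSq Ω
        (fun x => (Real.exp (φ x / h) : ℂ) * Carleman.magneticSchrodinger A q u x) := by
    have hn : Carleman.normSq Ω
        (fun x => (Real.exp (φ x / h) : ℂ) * Carleman.magneticSchrodinger A q u x) =
        ∫ x in Ω, Real.exp (φ x / h) ^ 2 * ‖Carleman.magneticSchrodinger A q u x‖ ^ 2 := by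
      simp only [Carleman.normSq, norm_mul, mul_pow, Complex.norm_real, Real.norm_eq_abs, sq_abs]
    rw [hn, ← integral_const_mul]
    refine setIntegral_mono_on (hmul E hEc) ((hmul _ hec).const_mul _) hΩ.measurableSet
      fun x hx => ?_
    rw [← mul_assoc]
    exact mul_le_mul_of_nonneg_right (hE x (subset_closure hx)).2 (by positivity)
  have hP0 : 0 ≤ Carleman.boundaryForm Ω φ h u (Carleman.boundaryPlus Ω φ) := by
    rw [bP]
    have hd := fun f x => mul_nonneg (le_max_right (Carleman.normalDerivWeight Ω φ x) 0)
      (Carleman.boundaryDensity_nonneg (Ω := Ω) (φ := φ) h f x)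
    exact add_nonneg (integral_nonneg (hd _)) (integral_nonneg (hd _))
  rw [add_assoc, hN, neg_mul, ← mul_neg, bM]
  rw [bP] at hP0 ⊢
  rw [hX] at hY hZ
  have hZ' := mul_le_mul_of_nonneg_left hZ (by linarith : 0 ≤ M)
  have hV' := mul_le_mul_of_nonneg_left hV (by positivity : 0 ≤ 2 * M * h ^ 2)
  have hPh : 0 ≤ M * Q * h * _ := mul_nonneg (by positivity) hP0
  -- The term `Mb` times the energy cancels on both sides. The norm of the operator carries `2MQ`
  -- and the boundary term `MQ`, which is raised to `2MQ` since the `∂Ω₊` integral is nonnegative.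
  linarith
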